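/- Let $n\ge 3$ be an odd integer, $R>0$, $B_R=\{x\in\mathbb{R}^n:|x|<R\}$, and $\gamma_n=\frac{(n-1)!}{2}|S^n|$, where $|S^n|$ is the surface measure of the unit sphere $S^n\subset\mathbb{R}^{n+1}$. For a bounded function $\varphi$ and $x$ near which $\varphi$ is $C^2$ put $$(-\Delta)^{\frac12}\varphi(x)=-\frac{C_{n}}{2}\int_{\mathbb{R}^n}\frac{\varphi(x+y)+\varphi(x-y)-2\varphi(x)}{|y|^{n+1}}\,dy,\qquad C_{n}=\left(\int_{\mathbb{R}^n}\frac{1-\cos x_1}{|x|^{n+1}}\,dx\right)^{-1}.$$ Let $f\in L^1(B_R)$. We say that $u$ is a (very weak) solution of $$(-\Delta)^{\frac{n-1}{2}}(-\Delta)^{\frac12}u=f\ \text{ in } B_R,\qquad (-\Delta)^j(-\Delta)^{\frac12}u=0\ \text{ on }\partial B_R,\quad j=0,1,\dots,\tfrac{n-3}{2},$$ if $u\in L^1_{loc}(\mathbb{R}^n)$, $\int_{\mathbb{R}^n}\frac{|u(x)|}{1+|x|^{n+1}}dx<\infty$, $\int_{\{x\notin B_R,\ d(x,\partial B_R)<2\}}\frac{|u(x)|}{\sqrt{d(x,B_R)}}dx<\infty$,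 and there is $W\in L^1(B_R)$ such that $$\int_{\mathbb{R}^n}u\,(-\Delta)^{\frac12}\varphi\,dx=\int_{B_R}W\varphi\,dx\quad\text{for all }\varphi\in T_1,\qquad \int_{B_R}W\,(-\Delta)^{\frac{n-1}{2}}\varphi\,dx=\int_{B_R}f\varphi\,dx\quad\text{for all }\varphi\in T_2.$$ Here $T_1$ is the set of $\varphi\in C^\infty(B_R)\cap C^{\frac12}(\mathbb{R}^n)$ with $\varphi=0$ on $\mathbb{R}^n\setminus B_R$ and such that $(-\Delta)^{\frac12}\varphi=\psi$ in $B_R$ for some $\psi\in C_c^\infty(B_R)$, and $T_2$ is the set of $\varphi\in C^{n-1}(\overline{B_R})$ with $\Delta^j\varphi=0$ on $\partial B_R$ for $j=0,1,\dots,\frac{n-3}{2}$. **Theorem.** Let $p>0$ and let $M$ be a real number with $pM<\gamma_n$. There is a constant $C$, depending only on $n$, $p$, $R$ and $M$, such that for every $f\in L^1(B_R)$ with $\|f\|_{L^1(B_R)}\le M$ and every $u\in L^1(B_R)$ that is a solution of the above problem with $u=0$ (a.e.) on $\mathbb{R}^n\setminus B_R$, $$\int_{B_R}e^{np|u|}\,dx\le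 C .$$ In particular, for a given $f\in L^1(B_R)$ and each $p\in\left(0,\gamma_n/\|f\|_{L^1(B_R)}\right)$ one has $e^{np|u|}\in L^1(B_R)$, with a bound depending only on $n$, $p$, $R$ and $\|f\|_{L^1(B_R)}$. -/

import Mathlib

open MeasureTheory
open scoped ContDiff NNReal

noncomputable section

namespace FracBM

/-- Euclidean space `ℝⁿ`. -/
abbrev E (n : ℕ) := EuclideanSpace ℝ (Fin n)

/-- `γ_n = (n-1)! / 2 * |S^n|`, where `|S^n|` is the surface area of the unit sphere
of `ℝ^(n+1)`. -/
def gammaConst (n : ℕ) : ℝ :=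
  ((n - 1).factorial : ℝ) / 2 * (volume : Measure (E (n + 1))).toSphere.real Set.univ

/-- `C_{n,1/2} = (∫ (1 - cos x₁) / |x|^(n+1) dx)⁻¹`: the constant for which `halfLaplacian` below
has Fourier symbol `|ξ|`. -/
def halfConst (n : ℕ) [NeZero n] : ℝ :=
  (∫ x : E n, (1 - Real.cos (x 0)) / ‖x‖ ^ (n + 1))⁻¹

/-- The pointwise half-Laplacian
`(-Δ)^{1/2} φ(x) = -(C_{n,1/2}/2) ∫ (φ(x+y) + φ(x-y) - 2φ(x)) / |y|^(n+1) dy`.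
The integral converges absolutely at each `x` near which the bounded function `φ` is `C²`. -/
def halfLaplacian {n : ℕ} [NeZero n] (φ : E n → ℝ) (x : E n) : ℝ :=
  -(1 / 2) * halfConst n * ∫ y : E n, (φ (x + y) + φ (x - y) - 2 * φ x) / ‖y‖ ^ (n + 1)

/-- The iterated negative Laplacian `(-Δ)^k φ` of a function on the set `s`. We use it on closures
`s` of open sets `Ω`: it is the ordinary `(-Δ)^k φ` in `Ω`, with boundary values computed from the
derivatives of `φ` up to the boundary. -/
def negLaplacianPow {n : ℕ} (s : Set (E n)) (k : ℕ) (φ : E n → ℝ) : E n → ℝ :=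
  (fun g x => -InnerProductSpace.laplacianWithin g s x)^[k] φ

/-- The space `L_s(ℝⁿ)`: locally integrable `v` with `∫ |v(x)| / (1 + |x|^(n+2s)) dx < ∞`. -/
def MemLs {n : ℕ} (s : ℝ) (v : E n → ℝ) : Prop :=
  LocallyIntegrable v ∧ Integrable fun x => |v x| / (1 + ‖x‖ ^ ((n : ℝ) + 2 * s))

/-- The test space `T₁`: `φ ∈ C^∞(Ω) ∩ C^{1/2}(ℝⁿ)` with `φ = 0` on the complement of `Ω` and
`(-Δ)^{1/2} φ = ψ` in `Ω` for some `ψ ∈ C_c^∞(Ω)`. -/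
def IsTest₁ {n : ℕ} [NeZero n] (Ω : Set (E n)) (φ : E n → ℝ) : Prop :=
  ContDiffOn ℝ ∞ φ Ω ∧ (∃ K : ℝ≥0, HolderWith K (1 / 2) φ) ∧ (∀ x ∉ Ω, φ x = 0) ∧
    ∃ ψ : E n → ℝ, ContDiff ℝ ∞ ψ ∧ HasCompactSupport ψ ∧ tsupport ψ ⊆ Ω ∧
      ∀ x ∈ Ω, halfLaplacian φ x = ψ x

/-- The test space `T₂` (`n` odd): `φ ∈ C^{n-1}(closure Ω)` with `(-Δ)^j φ = 0` on `∂Ω` for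
`0 ≤ j < (n-1)/2`, that is, for `j = 0, …, (n-3)/2`. -/
def IsTest₂ {n : ℕ} (Ω : Set (E n)) (φ : E n → ℝ) : Prop :=
  ContDiffOn ℝ ((n - 1 : ℕ) : WithTop ℕ∞) φ (closure Ω) ∧
    ∀ j < (n - 1) / 2, ∀ x ∈ frontier Ω, negLaplacianPow (closure Ω) j φ x = 0

/-- `W ∈ L¹(Ω)` solves, in the very weak sense, `(-Δ)^{(n-1)/2} W = f` in `Ω` and
`(-Δ)^j W = 0` on `∂Ω` for `j = 0, …, (n-3)/2`. -/
def IsNavierSolution {n : ℕ} (Ω : Set (E n)) (f W : E n → ℝ) : Prop :=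
  IntegrableOn W Ω ∧ ∀ φ : E n → ℝ, IsTest₂ Ω φ →
    ∫ x in Ω, W x * negLaplacianPow (closure Ω) ((n - 1) / 2) φ x = ∫ x in Ω, f x * φ x

/-- `w ∈ L_{1/2}(ℝⁿ)` solves, in the very weak sense, `(-Δ)^{(n-1)/2} (-Δ)^{1/2} w = f` in `Ω` and
`(-Δ)^j (-Δ)^{1/2} w = 0` on `∂Ω` for `j = 0, …, (n-3)/2`. -/
def IsSolution {n : ℕ} [NeZero n] (Ω : Set (E n)) (f w : E n → ℝ) : Prop :=
  MemLs (1 / 2) w ∧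
  IntegrableOn (fun x => |w x| / √(Metric.infDist x Ω))
    {x | x ∉ Ω ∧ Metric.infDist x (frontier Ω) < 2} ∧
  ∃ W : E n → ℝ,
    (∀ φ : E n → ℝ, IsTest₁ Ω φ → ∫ x, w x * halfLaplacian φ x = ∫ x in Ω, W x * φ x) ∧
    IsNavierSolution Ω f W

end FracBM

end

noncomputable section

namespace FracBM

open Set Filter Topology
open scoped ENNReal

/-! Write n = 2m+1 and B for the ball. Everything rests on a pointwise bound with the sharp
constant, `IsSolution.ae_le_log_potential`: for almost every y in B, |u(y)| ≤ γₙ⁻¹ ∫_B |f(z)| log(R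
e⁶/|y-z|) dz. Given it, |f| is dominated by M' times a probability density on B, and Jensen's
inequality bounds e^{np|u(y)|} by the mean of (R e⁶/|y-z|)^s with s = npM'/γₙ < n. This power is
integrable over a ball uniformly in z.

The bound composes two kernel estimates, |W| ≤ a ∫ |f(x)| |y-x|⁻¹ dx and |u| ≤ c ∫ |W(x)|
|y-x|^{1-n} dx. The composed kernel is at most |S^{n-1}| (log(R/|y-z|) + 6) by
`lintegral_kernel_le`, and c·a·|S^{n-1}| = 1/γₙ by `rieszConst_mul_navConst`. Each estimate is
proved by duality (`ae_abs_le_of_forall_isDensity`): for a nonnegative bump ψ in B one needs an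
admissible test function that solves the adjoint problem with right-hand side ψ, exactly or
approximately, and is bounded by the potential of ψ for the whole-space fundamental solution.

For the half-Laplacian the test function is explicit: the Riesz potential of ψ minus the potential
of its balayage onto the complement of B. The balayage of a point mass at y comes from the
equilibrium density (R²-|w|²)^{-1/2} by a Kelvin transform along an anti-inversion centred at y. The
equilibrium potential is computable because this density has integral π along every chord, so the
potential at x only counts the lines through x that meet the ball. The Green function is therefore
|x-y|^{1-n} times the fraction of lines through the image of x that miss B. That fraction lies in
[0,1], and its square-root behaviour gives the C^{1/2} regularity demanded by T₁. The equation
(-Δ)^{1/2}φ = ψ is verified with the Poisson semigroup, under which |x|^{-2m} becomes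
(t²+|x|²)^{-m}.

For the poly-Laplacian all test functions are polynomials: the Dirichlet problem on a ball with
polynomial data has a polynomial solution, so T₂ is reached without regularity theory. A bump is
approximated uniformly by a polynomial, and the iterated solutions are compared by the maximum
principle with convolutions against regularised fundamental solutions (`abs_evalE_le`). -/

/-- The surface measure on the unit sphere of `ℝⁿ`. -/
abbrev sphMeas (n : ℕ) : Measure (Metric.sphere (0 : E n) 1) := (volume : Measure (E n)).toSphere

/-! ### Polar coordinates and integration along lines. -/

theorem lintegral_polar {n : ℕ} [NeZero n] {f : E n → ℝ≥0∞} (hf : Measurable f) :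
    ∫⁻ x, f x = ∫⁻ θ, (∫⁻ r in Ioi (0 : ℝ), ENNReal.ofReal (r ^ (n - 1)) * f (r • (θ : E n)))
      ∂(sphMeas n) := by
  have hmp := (volume : Measure (E n)).measurePreserving_homeomorphUnitSphereProd
  have hfin : Module.finrank ℝ (E n) = n := by simp
  rw [hfin] at hmp
  have h1 : ∫⁻ x, f x = ∫⁻ x : ({0}ᶜ : Set (E n)), f x ∂(Measure.comap Subtype.val volume) := by
    rw [lintegral_subtype_comap (measurableSet_singleton _).compl f, restrict_compl_singleton]
  have h2 : ∫⁻ x : ({0}ᶜ : Set (E n)), f x ∂(Measure.comap Subtype.val volume)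
      = ∫⁻ q, f ((homeomorphUnitSphereProd (E n)).symm q)
        ∂((sphMeas n).prod (Measure.volumeIoiPow (n - 1))) := by
    rw [← hmp.lintegral_comp_emb (Homeomorph.measurableEmbedding _)]
    simp
  rw [h1, h2, lintegral_prod]
  · refine lintegral_congr fun θ => ?_
    rw [Measure.volumeIoiPow, lintegral_withDensity_eq_lintegral_mul, ← lintegral_subtype_comap measurableSet_Ioi (fun r : ℝ => ENNReal.ofReal (r ^ (n - 1)) * f (r • (θ : E n)))]
    · rfl
    · fun_prop
    · simp only [homeomorphUnitSphereProd_symm_apply_coe]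
      fun_prop
  · simp only [homeomorphUnitSphereProd_symm_apply_coe]
    fun_prop

theorem lintegral_radial {n : ℕ} [NeZero n] {f : ℝ → ℝ≥0∞} (hf : Measurable f) :
    ∫⁻ x : E n, f ‖x‖ = (sphMeas n) univ * ∫⁻ r in Ioi (0 : ℝ), ENNReal.ofReal (r ^ (n - 1)) * f r := by
  rw [lintegral_polar (by fun_prop)]
  have : ∀ θ : Metric.sphere (0 : E n) 1,
      ∫⁻ r in Ioi (0 : ℝ), ENNReal.ofReal (r ^ (n - 1)) * f ‖r • (θ : E n)‖ =
      ∫⁻ r in Ioi (0 : ℝ), ENNReal.ofReal (r ^ (n - 1)) * f r := by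
    intro θ
    refine setLIntegral_congr_fun measurableSet_Ioi fun r hr => ?_
    have : ‖(θ : E n)‖ = 1 := by simp
    simp only [norm_smul, this, mul_one, Real.norm_eq_abs, abs_of_pos (mem_Ioi.1 hr)]
  simp_rw [this]
  rw [lintegral_const, mul_comm]

/-- Symmetrised polar coordinates: integration along lines through `x`. -/
theorem lintegral_lines {n : ℕ} [NeZero n] {g : E n → ℝ≥0∞} (hg : Measurable g) (x : E n) :
    ∫⁻ w, ENNReal.ofReal ((‖w - x‖ ^ (n - 1))⁻¹) * g w =
      2⁻¹ * ∫⁻ θ, (∫⁻ r : ℝ, g (x + r • (θ : E n))) ∂(sphMeas n) := by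
  have h1 : ∫⁻ w, ENNReal.ofReal ((‖w - x‖ ^ (n - 1))⁻¹) * g w =
      ∫⁻ w, ENNReal.ofReal ((‖w‖ ^ (n - 1))⁻¹) * g (x + w) := by
    rw [← lintegral_add_left_eq_self _ x]; simp
  have h2 : ∫⁻ w, ENNReal.ofReal ((‖w‖ ^ (n - 1))⁻¹) * g (x + w) =
      ∫⁻ w, ENNReal.ofReal ((‖w‖ ^ (n - 1))⁻¹) * g (x + -w) := by
    conv_lhs => rw [← lintegral_neg_eq_self]
    simp
  have hm : Measurable fun w : E n => ENNReal.ofReal ((‖w‖ ^ (n - 1))⁻¹) * g (x + w) := by fun_prop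
  have hm' : Measurable fun w : E n => ENNReal.ofReal ((‖w‖ ^ (n - 1))⁻¹) * g (x + -w) := by fun_prop
  have h3 : ∫⁻ w, ENNReal.ofReal ((‖w - x‖ ^ (n - 1))⁻¹) * g w = 2⁻¹ *
      ∫⁻ w, (ENNReal.ofReal ((‖w‖ ^ (n - 1))⁻¹) * g (x + w) +
        ENNReal.ofReal ((‖w‖ ^ (n - 1))⁻¹) * g (x + -w)) := by
    rw [lintegral_add_left hm, ← h2, h1, ← two_mul, ← mul_assoc, ENNReal.inv_mul_cancel (by simp) (by simp), one_mul]
  have h7 := lintegral_polar (hm.add hm')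
  simp only [Pi.add_apply] at h7
  rw [h3, h7]
  congr 1
  refine lintegral_congr fun θ => ?_
  have hu : ‖(θ : E n)‖ = 1 := by simp
  have h4 : ∀ r ∈ Ioi (0 : ℝ), ENNReal.ofReal (r ^ (n - 1)) *
      (ENNReal.ofReal ((‖r • (θ : E n)‖ ^ (n - 1))⁻¹) * g (x + r • (θ : E n)) +
        ENNReal.ofReal ((‖r • (θ : E n)‖ ^ (n - 1))⁻¹) * g (x + -(r • (θ : E n)))) =
      g (x + r • (θ : E n)) + g (x + (-r) • (θ : E n)) := by
    intro r hr
    have hr0 : 0 < r := hr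
    rw [← mul_add, ← mul_assoc, ← ENNReal.ofReal_mul (by positivity), norm_smul, hu, mul_one,
      Real.norm_eq_abs, abs_of_pos hr0, mul_inv_cancel₀ (by positivity), ENNReal.ofReal_one, one_mul,
      neg_smul]
  rw [setLIntegral_congr_fun measurableSet_Ioi h4, lintegral_add_left (by fun_prop)]
  have h5 : ∫⁻ r in Ioi (0 : ℝ), g (x + (-r) • (θ : E n)) = ∫⁻ r in Iio (0 : ℝ), g (x + r • (θ : E n)) := by
    have := (Measure.measurePreserving_neg (volume : Measure ℝ)).setLIntegral_comp_preimage
      (measurableSet_Iio (a := (0 : ℝ))) (f := fun r => g (x + r • (θ : E n))) (by fun_prop)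
    rw [← this]; simp
  rw [h5, setLIntegral_congr Iio_ae_eq_Iic, add_comm]
  have h6 := lintegral_add_compl (μ := volume) (fun r : ℝ => g (x + r • (θ : E n))) (measurableSet_Iic (a := (0 : ℝ)))
  rw [compl_Iic] at h6
  exact h6

/-! ### The equilibrium density of the ball and its potential. -/

/-- The antiderivative is arcsin(r/√a). The value does not depend on a, and this is why the
equilibrium density gives every chord the same mass. -/
theorem lintegral_inv_sqrt_sub_sq {a : ℝ} (ha : 0 < a) :
    ∫⁻ r : ℝ, ENNReal.ofReal (√(a - r ^ 2))⁻¹ = ENNReal.ofReal Real.pi := by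
  set b := √a with hb
  have hb0 : 0 < b := Real.sqrt_pos.2 ha
  have hbs : b ^ 2 = a := Real.sq_sqrt ha.le
  have hder : ∀ r ∈ Ioo (-b) b, HasDerivAt (fun r => Real.arcsin (r / b)) (√(a - r ^ 2))⁻¹ r := by
    intro r hr
    have h1 : r / b ≠ -1 := by
      rw [Ne, div_eq_iff hb0.ne']; linarith [hr.1]
    have h2 : r / b ≠ 1 := by
      rw [Ne, div_eq_iff hb0.ne']; linarith [hr.2]
    have h0 : HasDerivAt (fun r => Real.arcsin (r / b)) (1 / √(1 - (r / b) ^ 2) * (1 / b)) r :=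
      HasDerivAt.comp r (h₂ := Real.arcsin) (h := fun r => r / b) (Real.hasDerivAt_arcsin h1 h2)
        ((hasDerivAt_id' r).div_const b)
    refine h0.congr_deriv ?_
    have h3 : a - r ^ 2 = b ^ 2 * (1 - (r / b) ^ 2) := by field_simp; rw [hbs]
    rw [h3, Real.sqrt_mul (by positivity), Real.sqrt_sq hb0.le]
    field_simp
  have hcont : ContinuousOn (fun r => Real.arcsin (r / b)) (Icc (-b) b) := by
    exact (Real.continuous_arcsin.comp (continuous_id.div_const b)).continuousOn
  have hint := intervalIntegral.integrableOn_deriv_of_nonneg hcont hder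
    (fun r _ => by positivity)
  have hval := intervalIntegral.integral_eq_sub_of_hasDerivAt_of_le (by linarith : -b ≤ b) hcont hder
    ((intervalIntegrable_iff_integrableOn_Ioc_of_le (by linarith)).2 hint)
  rw [neg_div, div_self hb0.ne', Real.arcsin_neg, Real.arcsin_one, sub_neg_eq_add, add_halves,
    intervalIntegral.integral_of_le (by linarith)] at hval
  rw [← hval, ofReal_integral_eq_lintegral_ofReal hint (Filter.Eventually.of_forall fun r => by positivity)]
  rw [← lintegral_indicator measurableSet_Ioc]
  refine lintegral_congr fun r => ?_
  by_cases hr : r ∈ Ioc (-b) b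
  · rw [indicator_of_mem hr]
  -- Beyond the endpoints the conventions √(negative) = 0 and 0⁻¹ = 0 cut the integrand off, so no
  -- indicator of the ball is needed in the density.
  · rw [indicator_of_notMem hr, Real.sqrt_eq_zero_of_nonpos, inv_zero, ENNReal.ofReal_zero]
    rw [← hbs, sub_nonpos, sq_le_sq, abs_of_pos hb0]
    by_contra h
    rw [not_le, abs_lt] at h
    exact hr ⟨h.1, h.2.le⟩

/-- Completing the square along the line reduces to the one-dimensional integral. The discriminant
R² - |x|² + ⟨x,θ⟩² is positive exactly when the line meets the open ball. -/
theorem lintegral_chord {n : ℕ} (R : ℝ) (x θ : E n) (hu : ‖θ‖ = 1) :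
    ∫⁻ r : ℝ, ENNReal.ofReal (√(R ^ 2 - ‖x + r • θ‖ ^ 2))⁻¹ =
      if 0 < R ^ 2 - ‖x‖ ^ 2 + inner ℝ x θ ^ 2 then ENNReal.ofReal Real.pi else 0 := by
  have h1 : ∀ r : ℝ, R ^ 2 - ‖x + r • θ‖ ^ 2 =
      (R ^ 2 - ‖x‖ ^ 2 + inner ℝ x θ ^ 2) - (r + inner ℝ x θ) ^ 2 := by
    intro r
    rw [norm_add_sq_real, norm_smul, hu, inner_smul_right, mul_one, Real.norm_eq_abs, sq_abs]
    ring
  simp_rw [h1]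
  rw [lintegral_add_right_eq_self (fun r => ENNReal.ofReal
    (√((R ^ 2 - ‖x‖ ^ 2 + inner ℝ x θ ^ 2) - r ^ 2))⁻¹)]
  split_ifs with h
  · exact lintegral_inv_sqrt_sub_sq h
  · rw [lintegral_eq_zero_iff (by fun_prop)]
    refine Filter.Eventually.of_forall fun r => ?_
    simp only [Pi.zero_apply]
    rw [Real.sqrt_eq_zero_of_nonpos, inv_zero, ENNReal.ofReal_zero]
    nlinarith [sq_nonneg r]

/-- The potential of the equilibrium density of a ball, in terms of the directions of the lines
through `x` that meet the ball. -/
theorem lintegral_equilibrium {n : ℕ} [NeZero n] (R : ℝ) (x : E n) :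
    ∫⁻ w, ENNReal.ofReal ((‖w - x‖ ^ (n - 1))⁻¹) * ENNReal.ofReal (√(R ^ 2 - ‖w‖ ^ 2))⁻¹ =
      2⁻¹ * (ENNReal.ofReal Real.pi *
        sphMeas n {θ | 0 < R ^ 2 - ‖x‖ ^ 2 + inner ℝ x (θ : E n) ^ 2}) := by
  rw [lintegral_lines (by fun_prop)]
  congr 1
  have h : ∀ θ : Metric.sphere (0 : E n) 1,
      ∫⁻ r : ℝ, ENNReal.ofReal (√(R ^ 2 - ‖x + r • (θ : E n)‖ ^ 2))⁻¹ =
      indicator {θ : Metric.sphere (0 : E n) 1 | 0 < R ^ 2 - ‖x‖ ^ 2 + inner ℝ x (θ : E n) ^ 2}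
        (fun _ => ENNReal.ofReal Real.pi) θ := by
    intro θ
    rw [lintegral_chord R x θ (by simp)]
    simp [indicator]
  simp_rw [h]
  rw [lintegral_indicator_const]
  exact measurableSet_lt (by fun_prop) (by fun_prop)

/-- Replaces spherical measure by the volume of a truncated cone, where linear maps act by their
determinant. -/
theorem sphMeas_eq_cone {n : ℕ} (p : E n → Prop) (hm : MeasurableSet {w | p w})
    (hp : ∀ (r : ℝ) (w : E n), 0 < r → (p (r • w) ↔ p w)) :
    sphMeas n {θ | p θ} = n * volume {w : E n | ‖w‖ < 1 ∧ w ≠ 0 ∧ p w} := by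
  have hm' : MeasurableSet {θ : Metric.sphere (0 : E n) 1 | p θ} := measurable_subtype_coe hm
  rw [Measure.toSphere_apply' _ hm']
  congr 2
  · simp
  ext w
  simp only [Set.mem_smul, mem_Ioo, mem_image, mem_ofPred_eq, Subtype.exists, exists_and_left,
    exists_prop, Set.mem_smul]
  constructor
  · rintro ⟨r, ⟨hr0, hr1⟩, θ, ⟨v, hv, hs, rfl⟩, rfl⟩
    rw [mem_sphere_zero_iff_norm] at hs
    refine ⟨?_, ?_, (hp r v hr0).2 hv⟩
    · rw [norm_smul, hs, mul_one, Real.norm_eq_abs, abs_of_pos hr0]; exact hr1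
    · rw [← norm_ne_zero_iff, norm_smul, hs, mul_one, norm_ne_zero_iff]; exact hr0.ne'
  · rintro ⟨h1, h0, hw⟩
    have hw0 : 0 < ‖w‖ := norm_pos_iff.2 h0
    refine ⟨‖w‖, ⟨hw0, h1⟩, ‖w‖⁻¹ • w, ⟨‖w‖⁻¹ • w, (hp _ _ (by positivity)).2 hw, ?_, rfl⟩, ?_⟩
    · rw [mem_sphere_zero_iff_norm, norm_smul, norm_inv, norm_norm, inv_mul_cancel₀ hw0.ne']
    · rw [smul_smul, mul_inv_cancel₀ hw0.ne', one_smul]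

theorem measure_inner_eq_zero {n : ℕ} {x : E n} (hx : x ≠ 0) :
    volume {w : E n | inner ℝ x w = 0} = 0 := by
  have h := Measure.addHaar_submodule (volume : Measure (E n)) (LinearMap.ker (innerₛₗ ℝ x)) (by
    intro h
    have : x ∈ LinearMap.ker (innerₛₗ ℝ x) := h ▸ Submodule.mem_top
    simp [hx] at this)
  convert h using 2
  ext w; simp

/-- From a point of the closed ball almost every line meets the open ball: the exceptional
directions are orthogonal to x. Hence the equilibrium potential is constant there. -/
theorem lintegral_equilibrium_of_mem {n : ℕ} [NeZero n] {R : ℝ} (hR : 0 < R) {x : E n} (hx : ‖x‖ ≤ R) :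
    ∫⁻ w, ENNReal.ofReal ((‖w - x‖ ^ (n - 1))⁻¹) * ENNReal.ofReal (√(R ^ 2 - ‖w‖ ^ 2))⁻¹ =
      2⁻¹ * (ENNReal.ofReal Real.pi * sphMeas n univ) := by
  rw [lintegral_equilibrium]
  congr 2
  refine measure_congr (ae_eq_univ.2 ?_)
  rcases eq_or_ne x 0 with rfl | hx0
  · have : {θ : Metric.sphere (0 : E n) 1 | 0 < R ^ 2 - ‖(0 : E n)‖ ^ 2 + inner ℝ 0 (θ : E n) ^ 2}ᶜ = ∅ := by
      ext θ; simp [hR.ne']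
    rw [this, measure_empty]
  · refine measure_mono_null (t := {θ : Metric.sphere (0 : E n) 1 | inner ℝ x (θ : E n) = 0}) ?_ ?_
    · intro θ ht
      simp only [mem_compl_iff, mem_ofPred_eq, not_lt] at ht ⊢
      have h1 : ‖x‖ ^ 2 ≤ R ^ 2 := by gcongr
      exact pow_eq_zero_iff (two_ne_zero) |>.1 (le_antisymm (by linarith) (sq_nonneg _))
    · rw [sphMeas_eq_cone (fun w : E n => inner ℝ x w = 0) (measurableSet_eq_fun (by fun_prop) (by fun_prop))]
      · rw [measure_mono_null _ (measure_inner_eq_zero hx0), mul_zero]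
        exact fun w hw => hw.2.2
      · intro r w hr
        rw [inner_smul_right, mul_eq_zero, or_iff_right hr.ne']

theorem exists_linearIsometryEquiv_map {n : ℕ} [NeZero n] (x : E n) :
    ∃ U : E n ≃ₗᵢ[ℝ] E n, U (‖x‖ • EuclideanSpace.single 0 1) = x := by
  set v : E n := ‖x‖ • EuclideanSpace.single 0 1 with hv
  refine ⟨Submodule.reflection (ℝ ∙ (v - x))ᗮ, ?_⟩
  apply Submodule.reflection_sub
  rw [hv, norm_smul]; simp

/-! ### Directions that miss the ball: square-root bound and Hölder continuity. -/

/-- The measure of the directions of the lines through a point at distance `R √(1 + q)` of the centre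
that miss the ball of radius `R`. -/
def missing (n : ℕ) [NeZero n] (q : ℝ) : ℝ :=
  n * (volume : Measure (E n)).real {w | ‖w‖ < 1 ∧ w 0 ^ 2 ≤ q * (‖w‖ ^ 2 - w 0 ^ 2)}

theorem sphMeas_missing {n : ℕ} [NeZero n] {R : ℝ} (hR : 0 < R) (x : E n) (hx : R ≤ ‖x‖) :
    sphMeas n {θ | ¬ 0 < R ^ 2 - ‖x‖ ^ 2 + inner ℝ x (θ : E n) ^ 2} =
      ENNReal.ofReal (missing n ((‖x‖ ^ 2 - R ^ 2) / R ^ 2)) := by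
  obtain ⟨U, hU⟩ := exists_linearIsometryEquiv_map x
  have hx0 : 0 < ‖x‖ := hR.trans_le hx
  have h1 : sphMeas n {θ | ¬ 0 < R ^ 2 - ‖x‖ ^ 2 + inner ℝ x (θ : E n) ^ 2} =
      sphMeas n {θ | inner ℝ x (θ : E n) ^ 2 ≤ (‖x‖ ^ 2 - R ^ 2) * ‖(θ : E n)‖ ^ 2} := by
    congr 1; ext θ
    have : ‖(θ : E n)‖ = 1 := by simp
    simp only [mem_ofPred_eq, this, not_lt]
    constructor <;> intro h <;> linarith
  rw [h1, sphMeas_eq_cone (fun w : E n => inner ℝ x w ^ 2 ≤ (‖x‖ ^ 2 - R ^ 2) * ‖w‖ ^ 2)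
    (measurableSet_le (by fun_prop) (by fun_prop))]
  · rw [missing, ENNReal.ofReal_mul (by positivity), ENNReal.ofReal_natCast,
      ofReal_measureReal (measure_ne_top_of_subset (fun w hw => by simpa using hw.1) (measure_ball_lt_top (x := (0 : E n)) (r := 1)).ne)]
    congr 1
    rw [← U.measurePreserving.measure_preimage_emb U.toHomeomorph.measurableEmbedding]
    have : volume {w : E n | ‖w‖ < 1 ∧ w 0 ^ 2 ≤ (‖x‖ ^ 2 - R ^ 2) / R ^ 2 * (‖w‖ ^ 2 - w 0 ^ 2)} =
      volume ({w : E n | ‖w‖ < 1 ∧ w 0 ^ 2 ≤ (‖x‖ ^ 2 - R ^ 2) / R ^ 2 * (‖w‖ ^ 2 - w 0 ^ 2)} \ {0}) :=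
      (measure_sdiff_null (measure_singleton _)).symm
    rw [this]
    congr 1
    ext w
    have hi : inner ℝ x (U w) = ‖x‖ * w 0 := by
      conv_lhs => rw [← hU, U.inner_map_map, inner_smul_left, EuclideanSpace.inner_single_left]
      simp
    simp only [mem_preimage, mem_ofPred_eq, LinearIsometryEquiv.norm_map, hi, Set.mem_sdiff, mem_singleton_iff]
    have : ((‖x‖ * w 0) ^ 2 ≤ (‖x‖ ^ 2 - R ^ 2) * ‖w‖ ^ 2) ↔
        w 0 ^ 2 ≤ (‖x‖ ^ 2 - R ^ 2) / R ^ 2 * (‖w‖ ^ 2 - w 0 ^ 2) := by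
      rw [div_mul_eq_mul_div, le_div_iff₀ (by positivity)]
      constructor <;> intro h <;> nlinarith
    rw [this]
    simp
    tauto
  · intro r w hr
    rw [inner_smul_right, norm_smul, Real.norm_eq_abs, abs_of_pos hr]
    have : 0 < r ^ 2 := by positivity
    constructor <;> intro h <;> nlinarith

/-- The linear map that multiplies the zeroth coordinate by `a`. -/
def scaleZero (n : ℕ) [NeZero n] (a : ℝ) : E n →ₗ[ℝ] E n :=
  LinearMap.transvection ((a - 1) • (EuclideanSpace.proj (0 : Fin n) : E n →L[ℝ] ℝ).toLinearMap)
    (EuclideanSpace.single 0 1)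

theorem volume_image_scaleZero {n : ℕ} [NeZero n] {a : ℝ} (ha : 0 ≤ a) (s : Set (E n)) :
    volume (scaleZero n a '' s) = ENNReal.ofReal a * volume s := by
  rw [Measure.addHaar_image_linearMap, scaleZero, LinearMap.transvection.det]
  simp [abs_of_nonneg ha]

theorem scaleZero_apply_zero {n : ℕ} [NeZero n] (a : ℝ) (w : E n) : scaleZero n a w 0 = a * w 0 := by
  simp [scaleZero, LinearMap.transvection]; ring

theorem norm_scaleZero_sq {n : ℕ} [NeZero n] (a : ℝ) (w : E n) :
    ‖scaleZero n a w‖ ^ 2 = ‖w‖ ^ 2 - w 0 ^ 2 + (a * w 0) ^ 2 := by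
  have : scaleZero n a w = w + ((a - 1) * w 0) • EuclideanSpace.single 0 1 := by
    simp [scaleZero, LinearMap.transvection]
  rw [this, norm_add_sq_real, inner_smul_right, norm_smul, mul_pow, Real.norm_eq_abs,
    sq_abs, EuclideanSpace.inner_single_right]
  simp; ring

theorem scaleZero_scaleZero {n : ℕ} [NeZero n] {a b : ℝ} (h : a * b = 1) (w : E n) :
    scaleZero n a (scaleZero n b w) = w := by
  have : ∀ (a : ℝ) (w : E n), scaleZero n a w = w + ((a - 1) * w 0) • EuclideanSpace.single 0 1 := by
    intro a w; simp [scaleZero, LinearMap.transvection]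
  rw [this a, scaleZero_apply_zero, this b, add_assoc, ← add_smul]
  have : (b - 1) * w 0 + (a - 1) * (b * w 0) = 0 := by linear_combination w 0 * h
  rw [this, zero_smul, add_zero]

theorem sq_apply_zero_le {n : ℕ} [NeZero n] (w : E n) : w 0 ^ 2 ≤ ‖w‖ ^ 2 := by
  rw [EuclideanSpace.real_norm_sq_eq]
  exact Finset.single_le_sum (f := fun i => w i ^ 2) (fun i _ => sq_nonneg _) (Finset.mem_univ _)

theorem missing_mono {n : ℕ} [NeZero n] {q q' : ℝ} (h : q ≤ q') : missing n q ≤ missing n q' := by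
  unfold missing
  refine mul_le_mul_of_nonneg_left (measureReal_mono ?_ ?_) (by positivity)
  · rintro w ⟨h1, h2⟩
    refine ⟨h1, h2.trans ?_⟩
    have := sq_apply_zero_le w
    gcongr
  · exact measure_ne_top_of_subset (fun w hw => by simpa using hw.1) (measure_ball_lt_top (x := (0 : E n)) (r := 1)).ne

theorem missing_nonneg {n : ℕ} [NeZero n] (q : ℝ) : 0 ≤ missing n q := by
  unfold missing; positivity

/-- The cone of missing directions is thin in the zeroth coordinate: for q > 0 it lies in the image
of a fixed ball under the compression of that coordinate by √q. -/
theorem exists_missing_le (n : ℕ) [NeZero n] : ∃ C : ℝ, 0 ≤ C ∧ ∀ q, 0 ≤ q → missing n q ≤ C * √q := by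
  refine ⟨n * (volume : Measure (E n)).real (Metric.closedBall 0 2), by positivity, fun q hq => ?_⟩
  rcases hq.eq_or_lt with rfl | hq
  · have h0 : volume {w : E n | ‖w‖ < 1 ∧ w 0 ^ 2 ≤ 0 * (‖w‖ ^ 2 - w 0 ^ 2)} = 0 := by
      refine measure_mono_null (t := {w : E n | inner ℝ (EuclideanSpace.single (0 : Fin n) (1 : ℝ)) w = 0}) ?_
        (measure_inner_eq_zero (by simp))
      rintro w ⟨-, h⟩
      rw [zero_mul] at h
      simp only [mem_ofPred_eq, EuclideanSpace.inner_single_left]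
      have := pow_eq_zero_iff (two_ne_zero) |>.1 (le_antisymm h (sq_nonneg _))
      simp [this]
    rw [missing, measureReal_def, h0]
    simp
  · rw [missing, mul_assoc]
    refine mul_le_mul_of_nonneg_left ?_ (by positivity)
    have hq0 : 0 < √q := Real.sqrt_pos.2 hq
    have hqs := Real.sq_sqrt hq.le
    have hsub : {w : E n | ‖w‖ < 1 ∧ w 0 ^ 2 ≤ q * (‖w‖ ^ 2 - w 0 ^ 2)} ⊆
        scaleZero n √q '' Metric.closedBall 0 2 := by
      rintro w ⟨h1, h2⟩
      refine ⟨scaleZero n (√q)⁻¹ w, ?_, scaleZero_scaleZero (mul_inv_cancel₀ hq0.ne') w⟩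
      rw [mem_closedBall_zero_iff, ← sq_le_sq₀ (norm_nonneg _) (by norm_num), norm_scaleZero_sq,
        mul_pow, inv_pow, hqs]
      have h3 : q⁻¹ * w 0 ^ 2 ≤ ‖w‖ ^ 2 - w 0 ^ 2 := by
        rw [inv_mul_le_iff₀ hq]; exact h2
      nlinarith [norm_nonneg w, sq_nonneg (w 0)]
    have h := measure_mono (μ := volume) hsub
    rw [volume_image_scaleZero hq0.le] at h
    rw [measureReal_def, measureReal_def]
    have h' := ENNReal.toReal_mono (ENNReal.mul_ne_top ENNReal.ofReal_ne_top measure_closedBall_lt_top.ne) h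
    rw [ENNReal.toReal_mul, ENNReal.toReal_ofReal hq0.le] at h'
    linarith

/-- Says that `missing n q / √q` is nonincreasing: compressing the zeroth coordinate by √(q/q')
carries the truncated cone for q' into the one for q. -/
theorem missing_scale {n : ℕ} [NeZero n] {q q' : ℝ} (hq : 0 < q) (h : q ≤ q') :
    √q * missing n q' ≤ √q' * missing n q := by
  have hq' : 0 < q' := hq.trans_le h
  have h0 : 0 < √q := Real.sqrt_pos.2 hq
  have h0' : 0 < √q' := Real.sqrt_pos.2 hq'
  set a := √q / √q' with ha
  have ha0 : 0 < a := div_pos h0 h0'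
  have ha1 : a ^ 2 = q / q' := by rw [ha, div_pow, Real.sq_sqrt hq.le, Real.sq_sqrt hq'.le]
  have ha2 : a ^ 2 ≤ 1 := by rw [ha1, div_le_one hq']; exact h
  have hsub : scaleZero n a '' {w : E n | ‖w‖ < 1 ∧ w 0 ^ 2 ≤ q' * (‖w‖ ^ 2 - w 0 ^ 2)} ⊆
      {w : E n | ‖w‖ < 1 ∧ w 0 ^ 2 ≤ q * (‖w‖ ^ 2 - w 0 ^ 2)} := by
    rintro _ ⟨w, ⟨h1, h2⟩, rfl⟩
    refine ⟨?_, ?_⟩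
    · rw [← sq_lt_sq₀ (norm_nonneg _) (by norm_num), norm_scaleZero_sq]
      nlinarith [norm_nonneg w, sq_nonneg (w 0)]
    · rw [norm_scaleZero_sq, scaleZero_apply_zero, mul_pow, ha1, add_sub_cancel_right,
        div_mul_eq_mul_div, div_le_iff₀ hq']
      nlinarith
  have hfin : volume {w : E n | ‖w‖ < 1 ∧ w 0 ^ 2 ≤ q * (‖w‖ ^ 2 - w 0 ^ 2)} ≠ ⊤ :=
    measure_ne_top_of_subset (fun w hw => by simpa using hw.1) (measure_ball_lt_top (x := (0 : E n)) (r := 1)).ne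
  have h3 := ENNReal.toReal_mono hfin (measure_mono (μ := volume) hsub)
  rw [volume_image_scaleZero ha0.le, ENNReal.toReal_mul, ENNReal.toReal_ofReal ha0.le, ha,
    div_mul_eq_mul_div, div_le_iff₀ h0'] at h3
  simp only [missing, measureReal_def]
  have : (0 : ℝ) ≤ n := by positivity
  nlinarith [mul_le_mul_of_nonneg_left h3 this]

/-- For q ≤ q', the monotonicity of `missing n q / √q` gives an increment of at most
(missing(q')/√q')(√q' - √q), and the first factor is bounded. No derivative of `missing` is needed.
-/
theorem exists_missing_holder (n : ℕ) [NeZero n] : ∃ C : ℝ, 0 ≤ C ∧ ∀ q q', 0 ≤ q → 0 ≤ q' →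
    |missing n q - missing n q'| ≤ C * √|q - q'| := by
  obtain ⟨C, hC, h⟩ := exists_missing_le n
  refine ⟨C, hC, ?_⟩
  have key : ∀ q q', 0 ≤ q → q ≤ q' → missing n q' - missing n q ≤ C * √(q' - q) := by
    intro q q' hq hqq
    rcases hq.eq_or_lt with rfl | hq
    · have := missing_nonneg (n := n) 0
      have := h q' hqq
      simp only [sub_zero]; linarith
    · have h0' : 0 < √q' := Real.sqrt_pos.2 (hq.trans_le hqq)
      have h1 := missing_scale (n := n) hq hqq
      have h2 := h q' (hq.le.trans hqq)
      have h3 : √q ≤ √q' := Real.sqrt_le_sqrt hqq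
      have h4 : √q' - √q ≤ √(q' - q) := by
        rw [sub_le_iff_le_add]
        refine Real.sqrt_le_iff.2 ⟨by positivity, ?_⟩
        nlinarith [Real.sq_sqrt hq.le, Real.sq_sqrt (sub_nonneg.2 hqq), Real.sqrt_nonneg q,
          Real.sqrt_nonneg (q' - q), mul_nonneg (Real.sqrt_nonneg q) (Real.sqrt_nonneg (q' - q))]
      have h5 : √q' * (missing n q' - missing n q) ≤ √q' * (C * (√q' - √q)) := by
        nlinarith [mul_le_mul_of_nonneg_left h2 (sub_nonneg.2 h3)]
      have h6 := le_of_mul_le_mul_left h5 h0'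
      exact h6.trans (by gcongr)
  intro q q' hq hq'
  rcases le_total q q' with hle | hle
  · have h1 := key q q' hq hle
    rw [abs_sub_comm, abs_sub_comm q, abs_of_nonneg (sub_nonneg.2 (missing_mono hle)), abs_of_nonneg (sub_nonneg.2 hle)]
    exact h1
  · have h1 := key q' q hq' hle
    rw [abs_of_nonneg (sub_nonneg.2 (missing_mono hle)), abs_of_nonneg (sub_nonneg.2 hle)]
    exact h1

/-! ### Gaussian integrals, the mass of the Poisson kernel and the value of `halfConst`. -/

theorem integrable_gaussian {n : ℕ} {s : ℝ} (hs : 0 < s) :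
    Integrable fun x : E n => Real.exp (-s * ‖x‖ ^ 2) := by
  by_contra h
  have h1 := GaussianFourier.integral_rexp_neg_mul_sq_norm (V := E n) hs
  rw [integral_undef h] at h1
  have : 0 < (Real.pi / s) ^ (Module.finrank ℝ (E n) / 2 : ℝ) := by positivity
  linarith

theorem lintegral_gaussian {n : ℕ} {s : ℝ} (hs : 0 < s) :
    ∫⁻ x : E n, ENNReal.ofReal (Real.exp (-s * ‖x‖ ^ 2)) = ENNReal.ofReal ((Real.pi / s) ^ ((n : ℝ) / 2)) := by
  have h := GaussianFourier.integral_rexp_neg_mul_sq_norm (V := E n) hs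
  rw [← ofReal_integral_eq_lintegral_ofReal (integrable_gaussian hs)
    (Filter.Eventually.of_forall fun x => by positivity), h]
  simp

theorem integral_cos_gaussian {n : ℕ} [NeZero n] {s : ℝ} (hs : 0 < s) :
    ∫ x : E n, Real.cos (x 0) * Real.exp (-s * ‖x‖ ^ 2) =
      (Real.pi / s) ^ ((n : ℝ) / 2) * Real.exp (-(1 / (4 * s))) := by
  have h := GaussianFourier.integral_cexp_neg_mul_sq_norm_add (V := E n) (b := s) (by simpa) Complex.I
    (EuclideanSpace.single 0 1)
  have hint := (GaussianFourier.integrable_cexp_neg_mul_sq_norm_add (V := E n) (b := s) (by simpa) Complex.I (EuclideanSpace.single 0 1))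
  have h2 := congrArg Complex.re h
  rw [← RCLike.re_eq_complex_re, ← integral_re hint] at h2
  have h3 : ∀ x : E n, RCLike.re (Complex.exp (-(s : ℂ) * (‖x‖ : ℂ) ^ 2 + Complex.I * ((inner ℝ (EuclideanSpace.single (0 : Fin n) (1 : ℝ)) x : ℝ) : ℂ)))
      = Real.cos (x 0) * Real.exp (-s * ‖x‖ ^ 2) := by
    intro x
    rw [EuclideanSpace.inner_single_left, RCLike.re_eq_complex_re, Complex.exp_re, mul_comm]
    simp [← Complex.ofReal_pow]
  simp_rw [h3] at h2
  rw [h2, RCLike.re_eq_complex_re]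
  have h4 : ((Real.pi : ℂ) / s) ^ ((Module.finrank ℝ (E n) : ℂ) / 2) = (((Real.pi / s) ^ ((n : ℝ) / 2) : ℝ) : ℂ) := by
    rw [Complex.ofReal_cpow (by positivity)]; simp
  have h5 : Complex.exp (Complex.I ^ 2 * (‖(EuclideanSpace.single (0 : Fin n) (1 : ℝ))‖ : ℂ) ^ 2 / (4 * s)) =
      ((Real.exp (-(1 / (4 * s))) : ℝ) : ℂ) := by
    push_cast; congr 1; simp; ring
  rw [h4, h5, ← Complex.ofReal_mul, Complex.ofReal_re]

theorem lintegral_rpow_mul_exp {a r : ℝ} (ha : 0 < a) (hr : 0 < r) :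
    ∫⁻ t in Ioi (0 : ℝ), ENNReal.ofReal (t ^ (a - 1) * Real.exp (-(r * t))) =
      ENNReal.ofReal ((1 / r) ^ a * Real.Gamma a) := by
  have h := Real.integral_rpow_mul_exp_neg_mul_Ioi ha hr
  rw [← h, ofReal_integral_eq_lintegral_ofReal]
  · by_contra h1
    rw [integral_undef h1] at h
    have := Real.Gamma_pos_of_pos ha
    have : 0 < (1 / r) ^ a * Real.Gamma a := by positivity
    linarith
  · filter_upwards [ae_restrict_mem measurableSet_Ioi] with t ht
    have : (0 : ℝ) < t := ht
    simp only [Pi.zero_apply]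
    positivity

theorem lintegral_pow_mul_exp (m : ℕ) {r : ℝ} (hr : 0 < r) :
    ∫⁻ t in Ioi (0 : ℝ), ENNReal.ofReal (t ^ m * Real.exp (-(r * t))) =
      ENNReal.ofReal (m.factorial / r ^ (m + 1)) := by
  have h := lintegral_rpow_mul_exp (a := m + 1) (by positivity) hr
  rw [add_sub_cancel_right, Real.Gamma_nat_eq_factorial] at h
  simp_rw [Real.rpow_natCast] at h
  rw [h]
  congr 1
  rw [← Nat.cast_succ, Real.rpow_natCast]
  simp; ring

theorem gaussian_exponent {m : ℕ} {s : ℝ} (hs : 0 < s) {n : ℕ} (hn : n = 2 * m + 1) :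
    s ^ m * (Real.pi / s) ^ ((n : ℝ) / 2) = Real.pi ^ m * √Real.pi * s ^ ((1 / 2 : ℝ) - 1) := by
  have h1 : (n : ℝ) / 2 = m + 1 / 2 := by rw [hn]; push_cast; ring
  rw [h1, Real.rpow_add (by positivity), Real.rpow_natCast, div_pow, ← Real.sqrt_eq_rpow, Real.sqrt_div Real.pi_pos.le,
    Real.rpow_sub hs, ← Real.sqrt_eq_rpow, Real.rpow_one]
  have := Real.sq_sqrt hs.le
  have h2 : 0 < √s := Real.sqrt_pos.2 hs
  field_simp
  rw [this]

/-- The total mass of the unnormalised Poisson kernel. -/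
theorem lintegral_poisson {m n : ℕ} (hn : n = 2 * m + 1) {t : ℝ} (ht : 0 < t) :
    ∫⁻ x : E n, ENNReal.ofReal (t * ((t ^ 2 + ‖x‖ ^ 2) ^ (m + 1))⁻¹) =
      ENNReal.ofReal (Real.pi ^ (m + 1) / m.factorial) := by
  have h1 : ∀ x : E n, ENNReal.ofReal (t * ((t ^ 2 + ‖x‖ ^ 2) ^ (m + 1))⁻¹) =
      ∫⁻ s in Ioi (0 : ℝ), ENNReal.ofReal (t / m.factorial * (s ^ m * Real.exp (-(t ^ 2 * s)))) *
        ENNReal.ofReal (Real.exp (-s * ‖x‖ ^ 2)) := by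
    intro x
    have h := lintegral_pow_mul_exp m (r := t ^ 2 + ‖x‖ ^ 2) (by positivity)
    have h2 : ∀ s : ℝ, ENNReal.ofReal (t / m.factorial * (s ^ m * Real.exp (-(t ^ 2 * s)))) *
        ENNReal.ofReal (Real.exp (-s * ‖x‖ ^ 2)) = ENNReal.ofReal (t / m.factorial) * ENNReal.ofReal (s ^ m * Real.exp (-((t ^ 2 + ‖x‖ ^ 2) * s))) := by
      intro s
      rw [← ENNReal.ofReal_mul' (by positivity), ← ENNReal.ofReal_mul (by positivity)]
      congr 1
      rw [mul_assoc, mul_assoc, ← Real.exp_add]; ring_nf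
    simp_rw [h2]
    rw [lintegral_const_mul _ (by fun_prop), h, ← ENNReal.ofReal_mul (by positivity)]
    congr 1
    have : (m.factorial : ℝ) ≠ 0 := by positivity
    field_simp
  simp_rw [h1]
  rw [lintegral_lintegral_swap (by fun_prop)]
  have h3 : ∀ s ∈ Ioi (0 : ℝ), ∫⁻ x : E n, ENNReal.ofReal (t / m.factorial * (s ^ m * Real.exp (-(t ^ 2 * s)))) *
        ENNReal.ofReal (Real.exp (-s * ‖x‖ ^ 2)) =
      ENNReal.ofReal (t / m.factorial * (Real.pi ^ m * √Real.pi)) *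
        ENNReal.ofReal (s ^ ((1 / 2 : ℝ) - 1) * Real.exp (-(t ^ 2 * s))) := by
    intro s hs
    have hs0 : 0 < s := hs
    rw [lintegral_const_mul _ (by fun_prop), lintegral_gaussian hs0, ← ENNReal.ofReal_mul (by positivity),
      ← ENNReal.ofReal_mul (by positivity)]
    congr 1
    linear_combination (t / m.factorial * Real.exp (-(t ^ 2 * s))) * gaussian_exponent hs0 hn
  rw [setLIntegral_congr_fun measurableSet_Ioi h3, lintegral_const_mul _ (by fun_prop),
    lintegral_rpow_mul_exp (by norm_num) (by positivity), ← ENNReal.ofReal_mul (by positivity),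
    Real.Gamma_one_half_eq, ← Real.sqrt_eq_rpow, Real.sqrt_div (by norm_num), Real.sqrt_sq ht.le]
  congr 1
  have := Real.mul_self_sqrt Real.pi_pos.le
  rw [Real.sqrt_one]
  field_simp
  rw [Real.sq_sqrt Real.pi_pos.le]; ring

theorem lintegral_Ioi_inv (g : ℝ → ℝ≥0∞) :
    ∫⁻ x in Ioi (0 : ℝ), g x = ∫⁻ x in Ioi (0 : ℝ), ENNReal.ofReal ((x ^ 2)⁻¹) * g x⁻¹ := by
  have himg : (fun x : ℝ => x⁻¹) '' Ioi 0 = Ioi 0 := by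
    ext x; constructor
    · rintro ⟨y, hy, rfl⟩; exact mem_Ioi.2 (inv_pos.2 (mem_Ioi.1 hy))
    · intro hx; exact ⟨x⁻¹, mem_Ioi.2 (inv_pos.2 (mem_Ioi.1 hx)), inv_inv x⟩
  have h1 := lintegral_image_eq_lintegral_abs_deriv_mul (s := Ioi (0 : ℝ)) (f := fun x => x⁻¹) (f' := fun x => -(x ^ 2)⁻¹) measurableSet_Ioi
    (fun x hx => (hasDerivAt_inv (ne_of_gt hx)).hasDerivWithinAt) (fun x _ y _ h => inv_injective h) g
  rw [himg] at h1
  rw [h1]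
  refine lintegral_congr fun x => ?_
  rw [abs_neg, abs_of_nonneg (by positivity)]

/-- After s ↦ 1/x, the factor 1 - e^{-x/4} is written as (x/4) ∫₀¹ e^{-vx/4} dv. Tonelli then leaves
a Gamma integral in x and v^{-1/2} in v. -/
theorem lintegral_rpow_one_sub_exp :
    ∫⁻ s in Ioi (0 : ℝ), ENNReal.ofReal (s ^ ((1 / 2 : ℝ) - 1) * (1 - Real.exp (-(1 / (4 * s))))) =
      ENNReal.ofReal √Real.pi := by
  rw [lintegral_Ioi_inv]
  have h2 : ∀ x ∈ Ioi (0 : ℝ), ENNReal.ofReal ((x ^ 2)⁻¹) * ENNReal.ofReal (x⁻¹ ^ ((1 / 2 : ℝ) - 1) * (1 - Real.exp (-(1 / (4 * x⁻¹))))) =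
      ∫⁻ v in Ioc (0 : ℝ) 1, ENNReal.ofReal (4⁻¹ * (x ^ ((1 / 2 : ℝ) - 1) * Real.exp (-(v / 4 * x)))) := by
    intro x hx
    have hx0 : 0 < x := hx
    rw [← ofReal_integral_eq_lintegral_ofReal, ← ENNReal.ofReal_mul (by positivity)]
    · congr 1
      rw [← intervalIntegral.integral_of_le zero_le_one, intervalIntegral.integral_const_mul,
        intervalIntegral.integral_const_mul]
      have h3 : ∫ v in (0 : ℝ)..1, Real.exp (-(v / 4 * x)) = 4 / x * (1 - Real.exp (-(x / 4))) := by
        have := intervalIntegral.integral_eq_sub_of_hasDerivAt (a := 0) (b := 1)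
          (f := fun v => -(4 / x) * Real.exp (-(v / 4 * x))) (f' := fun v => Real.exp (-(v / 4 * x))) ?_ ?_
        · rw [this]; simp; ring_nf
        · intro v _
          have := ((((hasDerivAt_id' v).div_const 4).mul_const x).fun_neg.exp).const_mul (-(4 / x))
          refine this.congr_deriv ?_
          field_simp
        · exact (by fun_prop : Continuous fun v : ℝ => Real.exp (-(v / 4 * x))).intervalIntegrable _ _
      rw [h3, Real.inv_rpow hx0.le, Real.rpow_sub hx0, Real.rpow_one, ← Real.sqrt_eq_rpow]
      have h4 : 1 / (4 * x⁻¹) = x / 4 := by field_simp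
      rw [h4]
      have := Real.sq_sqrt hx0.le
      have h5 : 0 < √x := Real.sqrt_pos.2 hx0
      field_simp
      rw [this]
    · exact (by fun_prop : Continuous fun v : ℝ => 4⁻¹ * (x ^ ((1 / 2 : ℝ) - 1) * Real.exp (-(v / 4 * x)))).integrableOn_Ioc
    · exact Filter.Eventually.of_forall fun v => by positivity
  rw [setLIntegral_congr_fun measurableSet_Ioi h2, lintegral_lintegral_swap (by fun_prop)]
  have h3 : ∀ v ∈ Ioc (0 : ℝ) 1, ∫⁻ x in Ioi (0 : ℝ), ENNReal.ofReal (4⁻¹ * (x ^ ((1 / 2 : ℝ) - 1) * Real.exp (-(v / 4 * x)))) =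
      ENNReal.ofReal (√Real.pi * (2⁻¹ * v ^ (-(1 / 2) : ℝ))) := by
    intro v hv
    have hv0 : 0 < v := hv.1
    simp_rw [ENNReal.ofReal_mul (show (0 : ℝ) ≤ 4⁻¹ by norm_num)]
    rw [lintegral_const_mul _ (by fun_prop), lintegral_rpow_mul_exp (by norm_num) (by positivity),
      ← ENNReal.ofReal_mul (by norm_num), Real.Gamma_one_half_eq]
    congr 1
    rw [one_div_div, Real.div_rpow (by norm_num) hv0.le, Real.rpow_neg hv0.le, ← Real.sqrt_eq_rpow, show (4 : ℝ) = 2 ^ 2 by norm_num,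
      Real.sqrt_sq (by norm_num)]
    ring
  rw [setLIntegral_congr_fun measurableSet_Ioc h3, ← ofReal_integral_eq_lintegral_ofReal]
  · rw [← intervalIntegral.integral_of_le zero_le_one, intervalIntegral.integral_const_mul,
        intervalIntegral.integral_const_mul, integral_rpow (by norm_num)]
    norm_num
  · exact ((intervalIntegral.intervalIntegrable_rpow' (by norm_num)).1.const_mul _).const_mul _
  · filter_upwards [ae_restrict_mem measurableSet_Ioc] with v hv
    have := hv.1
    simp only [Pi.zero_apply]
    positivity

/-- Since n + 1 = 2(m+1), the weight |x|^{-(n+1)} is the superposition (1/m!) ∫ s^m e^{-s|x|²} ds of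
Gaussians, whose cosine transforms are known. -/
theorem lintegral_one_sub_cos {m n : ℕ} [NeZero n] (hn : n = 2 * m + 1) :
    ∫⁻ x : E n, ENNReal.ofReal ((1 - Real.cos (x 0)) / ‖x‖ ^ (n + 1)) =
      ENNReal.ofReal (Real.pi ^ (m + 1) / m.factorial) := by
  have h1 : ∀ᵐ x : E n, ENNReal.ofReal ((1 - Real.cos (x 0)) / ‖x‖ ^ (n + 1)) =
      ∫⁻ s in Ioi (0 : ℝ), ENNReal.ofReal (s ^ m / m.factorial) * 
        ENNReal.ofReal ((1 - Real.cos (x 0)) * Real.exp (-s * ‖x‖ ^ 2)) := by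
    filter_upwards [Measure.ae_ne volume (0 : E n)] with x hx
    have hx0 : 0 < ‖x‖ := norm_pos_iff.2 hx
    have h := lintegral_pow_mul_exp m (r := ‖x‖ ^ 2) (by positivity)
    have hc : 0 ≤ 1 - Real.cos (x 0) := sub_nonneg.2 (Real.cos_le_one _)
    have h2 : ∀ s ∈ Ioi (0 : ℝ), ENNReal.ofReal (s ^ m / m.factorial) * 
        ENNReal.ofReal ((1 - Real.cos (x 0)) * Real.exp (-s * ‖x‖ ^ 2)) =
        ENNReal.ofReal ((1 - Real.cos (x 0)) / m.factorial) * ENNReal.ofReal (s ^ m * Real.exp (-(‖x‖ ^ 2 * s))) := by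
      intro s hs
      rw [← ENNReal.ofReal_mul' (by positivity), ← ENNReal.ofReal_mul (by positivity)]
      congr 1
      ring_nf
    rw [setLIntegral_congr_fun measurableSet_Ioi h2, lintegral_const_mul _ (by fun_prop), h, ← ENNReal.ofReal_mul (by positivity)]
    congr 1
    have : (m.factorial : ℝ) ≠ 0 := by positivity
    rw [← pow_mul, show 2 * (m + 1) = n + 1 by omega]
    field_simp
  rw [lintegral_congr_ae h1, lintegral_lintegral_swap (by fun_prop)]
  have h3 : ∀ s ∈ Ioi (0 : ℝ), ∫⁻ x : E n, ENNReal.ofReal (s ^ m / m.factorial) * 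
        ENNReal.ofReal ((1 - Real.cos (x 0)) * Real.exp (-s * ‖x‖ ^ 2)) =
      ENNReal.ofReal (Real.pi ^ m * √Real.pi / m.factorial) *
        ENNReal.ofReal (s ^ ((1 / 2 : ℝ) - 1) * (1 - Real.exp (-(1 / (4 * s))))) := by
    intro s hs
    have hs0 : 0 < s := hs
    have hi := integrable_gaussian (n := n) hs0
    have hi2 : Integrable fun x : E n => Real.cos (x 0) * Real.exp (-s * ‖x‖ ^ 2) := by
      refine hi.mono' (by fun_prop) (Filter.Eventually.of_forall fun x => ?_)
      rw [norm_mul, Real.norm_of_nonneg (Real.exp_pos _).le]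
      exact mul_le_of_le_one_left (Real.exp_pos _).le (Real.abs_cos_le_one _)
    have hi3 : Integrable fun x : E n => (1 - Real.cos (x 0)) * Real.exp (-s * ‖x‖ ^ 2) := by
      simp_rw [sub_mul, one_mul]; exact hi.sub hi2
    rw [lintegral_const_mul _ (by fun_prop), ← ofReal_integral_eq_lintegral_ofReal hi3
      (Filter.Eventually.of_forall fun x => mul_nonneg (sub_nonneg.2 (Real.cos_le_one _)) (Real.exp_pos _).le)]
    simp_rw [sub_mul, one_mul]
    rw [integral_sub hi hi2, integral_cos_gaussian hs0, GaussianFourier.integral_rexp_neg_mul_sq_norm hs0,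
      ← ENNReal.ofReal_mul (by positivity), ← ENNReal.ofReal_mul (by positivity)]
    congr 1
    have := gaussian_exponent hs0 hn
    rw [finrank_euclideanSpace_fin]
    linear_combination ((1 - Real.exp (-(1 / (4 * s)))) / m.factorial) * this
  rw [setLIntegral_congr_fun measurableSet_Ioi h3, lintegral_const_mul _ (by fun_prop), lintegral_rpow_one_sub_exp, ← ENNReal.ofReal_mul (by positivity)]
  congr 1
  rw [div_mul_eq_mul_div, mul_assoc, Real.mul_self_sqrt Real.pi_pos.le]; ring

theorem halfConst_eq {m n : ℕ} [NeZero n] (hn : n = 2 * m + 1) :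
    halfConst n = m.factorial / Real.pi ^ (m + 1) := by
  rw [halfConst, integral_eq_lintegral_of_nonneg_ae, lintegral_one_sub_cos hn, ENNReal.toReal_ofReal (by positivity), inv_div]
  · exact Filter.Eventually.of_forall fun x => div_nonneg (sub_nonneg.2 (Real.cos_le_one _)) (by positivity)
  · exact (Measurable.div (by fun_prop) (by fun_prop)).aestronglyMeasurable

theorem toSphere_real_univ_even (m : ℕ) :
    (volume : Measure (E (2 * m + 1 + 1))).toSphere.real univ = 2 * Real.pi ^ (m + 1) / m.factorial := by
  rw [Measure.toSphere_real_apply_univ, measureReal_def, EuclideanSpace.volume_ball]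
  have h : (((2 * m + 1 + 1 : ℕ) : ℝ) / 2 + 1) = ((m + 1 : ℕ) : ℝ) + 1 := by push_cast; ring
  simp only [finrank_euclideanSpace_fin, Fintype.card_fin, h, Real.Gamma_nat_eq_factorial, Nat.factorial_succ]
  rw [show √Real.pi ^ (2 * m + 1 + 1) = Real.pi ^ (m + 1) by
    rw [show 2 * m + 1 + 1 = 2 * (m + 1) by ring, pow_mul, Real.sq_sqrt Real.pi_pos.le]]
  simp
  rw [ENNReal.toReal_ofReal (by positivity)]
  field_simp
  ring

/-! ### Inversion and the Poisson extension of the Riesz kernel. -/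

/-- In polar coordinates inversion is r ↦ 1/r on each ray, so the Jacobian |w|^{-2n} follows from
the one-dimensional substitution. -/
theorem lintegral_inversion {n : ℕ} [NeZero n] {f : E n → ℝ≥0∞} (hf : Measurable f) :
    ∫⁻ w, f w = ∫⁻ w, ENNReal.ofReal ((‖w‖ ^ (2 * n))⁻¹) * f ((‖w‖ ^ 2)⁻¹ • w) := by
  rw [lintegral_polar hf, lintegral_polar (by fun_prop)]
  refine lintegral_congr fun θ => ?_
  have hu : ‖(θ : E n)‖ = 1 := by simp
  rw [lintegral_Ioi_inv]
  refine setLIntegral_congr_fun measurableSet_Ioi fun r hr => ?_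
  have hr0 : 0 < r := hr
  rw [norm_smul, hu, mul_one, Real.norm_of_nonneg hr0.le, ← mul_assoc, ← mul_assoc,
    ← ENNReal.ofReal_mul (by positivity), ← ENNReal.ofReal_mul (by positivity), smul_smul]
  congr 2
  · obtain ⟨k, rfl⟩ : ∃ k, n = k + 1 := ⟨n - 1, by have := NeZero.pos n; omega⟩
    simp only [Nat.add_sub_cancel, inv_pow]
    field_simp
    ring
  · congr 2; field_simp

/-- The Poisson extension of `‖x‖ ^ (1 - n)`. -/
theorem lintegral_poisson_mul_riesz {m n : ℕ} [NeZero n] (hn : n = 2 * m + 1) {t : ℝ} (ht : 0 < t) (x : E n) :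
    ∫⁻ y : E n, ENNReal.ofReal (t * ((t ^ 2 + ‖y‖ ^ 2) ^ (m + 1))⁻¹) * ENNReal.ofReal ((‖x - y‖ ^ (2 * m))⁻¹) =
      ENNReal.ofReal (Real.pi ^ (m + 1) / m.factorial * ((t ^ 2 + ‖x‖ ^ 2) ^ m)⁻¹) := by
  set A := t ^ 2 + ‖x‖ ^ 2 with hA
  have hA0 : 0 < A := by positivity
  rw [← lintegral_add_left_eq_self _ x]
  simp only [sub_add_cancel_left, norm_neg]
  rw [lintegral_inversion (by fun_prop)]
  -- Inversion about the pole of the Riesz kernel merges that kernel with the Jacobian. The Poisson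
  -- kernel at height t becomes the one at height t/A centred at -A⁻¹x, times A^{-m}, and its mass
  -- is known.
  have h1 : ∀ᵐ w : E n, ENNReal.ofReal ((‖w‖ ^ (2 * n))⁻¹) *
      (ENNReal.ofReal (t * ((t ^ 2 + ‖x + (‖w‖ ^ 2)⁻¹ • w‖ ^ 2) ^ (m + 1))⁻¹) *
        ENNReal.ofReal ((‖(‖w‖ ^ 2)⁻¹ • w‖ ^ (2 * m))⁻¹)) =
      ENNReal.ofReal ((A ^ m)⁻¹) * ENNReal.ofReal (t / A * (((t / A) ^ 2 + ‖w + A⁻¹ • x‖ ^ 2) ^ (m + 1))⁻¹) := by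
    filter_upwards [Measure.ae_ne volume (0 : E n)] with w hw
    have hw0 : 0 < ‖w‖ := norm_pos_iff.2 hw
    rw [← ENNReal.ofReal_mul (by positivity), ← ENNReal.ofReal_mul (by positivity), ← ENNReal.ofReal_mul (by positivity)]
    congr 1
    have e1 : ‖(‖w‖ ^ 2)⁻¹ • w‖ = ‖w‖⁻¹ := by
      rw [norm_smul, norm_inv, norm_pow, norm_norm]; field_simp
    have e2 : t ^ 2 + ‖x + (‖w‖ ^ 2)⁻¹ • w‖ ^ 2 = (‖w‖ ^ 2)⁻¹ * (A * ((t / A) ^ 2 + ‖w + A⁻¹ • x‖ ^ 2)) := by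
      rw [norm_add_sq_real, norm_add_sq_real, e1, inner_smul_right, inner_smul_right, norm_smul, norm_inv,
        Real.norm_of_nonneg hA0.le, real_inner_comm w x]
      field_simp
      rw [hA]; ring
    rw [e1, e2, mul_pow, mul_pow]
    have : 0 < (t / A) ^ 2 + ‖w + A⁻¹ • x‖ ^ 2 := by positivity
    generalize hB : (t / A) ^ 2 + ‖w + A⁻¹ • x‖ ^ 2 = B at this
    generalize ‖w‖ = b at hw0
    rw [show 2 * n = 2 * m + (2 * m + 2) by omega]
    simp only [inv_pow]
    field_simp
    ring
  rw [lintegral_congr_ae h1, lintegral_const_mul _ (by fun_prop),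
    lintegral_add_right_eq_self (fun w => ENNReal.ofReal (t / A * (((t / A) ^ 2 + ‖w‖ ^ 2) ^ (m + 1))⁻¹)),
    lintegral_poisson hn (by positivity), ← ENNReal.ofReal_mul (by positivity)]
  congr 1; ring

/-- The difference is 2m ∫₀¹ s(s²+|x|²)^{-(m+1)} ds, and every slice is an unnormalised Poisson
kernel of the same mass. -/
theorem lintegral_riesz_sub {m n : ℕ} [NeZero n] (hn : n = 2 * m + 1) :
    ∫⁻ x : E n, ENNReal.ofReal ((‖x‖ ^ (2 * m))⁻¹ - ((1 + ‖x‖ ^ 2) ^ m)⁻¹) =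
      ENNReal.ofReal (2 * m * (Real.pi ^ (m + 1) / m.factorial)) := by
  have h1 : ∀ᵐ x : E n, ENNReal.ofReal ((‖x‖ ^ (2 * m))⁻¹ - ((1 + ‖x‖ ^ 2) ^ m)⁻¹) =
      ∫⁻ s in Ioc (0 : ℝ) 1, ENNReal.ofReal (2 * m) * ENNReal.ofReal (s * ((s ^ 2 + ‖x‖ ^ 2) ^ (m + 1))⁻¹) := by
    filter_upwards [Measure.ae_ne volume (0 : E n)] with x hx
    have hx0 : 0 < ‖x‖ := norm_pos_iff.2 hx
    have hpos : ∀ s : ℝ, s ^ 2 + ‖x‖ ^ 2 ≠ 0 := fun s => by positivity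
    have hc : Continuous fun s : ℝ => s * ((s ^ 2 + ‖x‖ ^ 2) ^ (m + 1))⁻¹ := by
      refine continuous_id.mul (Continuous.inv₀ (by fun_prop) fun s => pow_ne_zero _ (hpos s))
    rw [lintegral_const_mul _ (by fun_prop), ← ofReal_integral_eq_lintegral_ofReal hc.integrableOn_Ioc,
      ← ENNReal.ofReal_mul (by positivity), ← intervalIntegral.integral_of_le zero_le_one, ← intervalIntegral.integral_const_mul]
    · congr 1
      rw [intervalIntegral.integral_eq_sub_of_hasDerivAt (f := fun s : ℝ => -((s ^ 2 + ‖x‖ ^ 2) ^ m)⁻¹)]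
      · rw [pow_mul]; simp; ring
      · intro s _
        have h := (((((hasDerivAt_id' s).fun_pow 2).add_const (‖x‖ ^ 2)).fun_pow m).fun_inv (pow_ne_zero _ (hpos s))).fun_neg
        refine h.congr_deriv ?_
        rcases m with _ | m
        · simp
        · have := hpos s
          push_cast
          field_simp
          ring_nf
      · exact (continuous_const.mul hc).intervalIntegrable _ _
    · filter_upwards [ae_restrict_mem measurableSet_Ioc] with v hv
      have := hv.1
      simp only [Pi.zero_apply]
      positivity
  rw [lintegral_congr_ae h1, lintegral_lintegral_swap (by fun_prop)]
  have h2 : ∀ s ∈ Ioc (0 : ℝ) 1, ∫⁻ x : E n, ENNReal.ofReal (2 * m) * ENNReal.ofReal (s * ((s ^ 2 + ‖x‖ ^ 2) ^ (m + 1))⁻¹) =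
      ENNReal.ofReal (2 * m * (Real.pi ^ (m + 1) / m.factorial)) := by
    intro s hs
    rw [lintegral_const_mul _ (by fun_prop), lintegral_poisson hn hs.1, ← ENNReal.ofReal_mul (by positivity)]
  rw [setLIntegral_congr_fun measurableSet_Ioc h2]
  simp

/-! ### The half-Laplacian as generator of the Poisson semigroup. -/

theorem integrableOn_ball_norm_rpow {n : ℕ} [NeZero n] {a : ℝ} (ha : a < n) (ρ : ℝ) :
    IntegrableOn (fun x : E n => ‖x‖ ^ (-a)) (Metric.ball 0 ρ) := by
  rw [integrableOn_fun_norm_addHaar volume (f := fun r : ℝ => r ^ (-a)), finrank_euclideanSpace_fin]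
  have h := (intervalIntegral.intervalIntegrable_rpow' (a := 0) (b := max ρ 0) (r := n - 1 - a) (by linarith)).1
  refine IntegrableOn.congr_fun (f := fun r : ℝ => r ^ ((n : ℝ) - 1 - a)) ?_ ?_ measurableSet_Ioo
  · exact h.mono_set fun r hr => ⟨hr.1, hr.2.le.trans (le_max_left _ _)⟩
  · intro r hr
    simp only [smul_eq_mul]
    rw [← Real.rpow_natCast, ← Real.rpow_add hr.1, Nat.cast_pred (NeZero.pos n)]; ring_nf

theorem integrableOn_compl_ball_norm_rpow {n : ℕ} [NeZero n] {a : ℝ} (ha : n < a) {ρ : ℝ} (hρ : 0 < ρ) :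
    IntegrableOn (fun x : E n => ‖x‖ ^ (-a)) (Metric.ball 0 ρ)ᶜ := by
  rw [← integrable_indicator_iff measurableSet_ball.compl]
  have h1 : (Metric.ball (0 : E n) ρ)ᶜ.indicator (fun x : E n => ‖x‖ ^ (-a)) =
      fun x => (Ici ρ).indicator (fun r : ℝ => r ^ (-a)) ‖x‖ := by
    ext x; simp [indicator]
  rw [h1, integrable_fun_norm_addHaar volume (f := (Ici ρ).indicator (fun r : ℝ => r ^ (-a))), finrank_euclideanSpace_fin]
  have h := integrableOn_Ioi_rpow_of_lt (a := (n : ℝ) - 1 - a) (by linarith) (c := ρ / 2) (by positivity)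
  have h2 := (h.indicator (measurableSet_Ici (a := ρ))).integrable_indicator measurableSet_Ioi
  refine (h2.congr ?_).integrableOn
  refine Eventually.of_forall fun r => ?_
  simp only [indicator, mem_Ioi, mem_Ici, smul_eq_mul]
  by_cases hr : ρ ≤ r
  · have hr0 : 0 < r := hρ.trans_le hr
    rw [if_pos hr, if_pos (by linarith), if_pos hr, ← Real.rpow_natCast, ← Real.rpow_add hr0,
      Nat.cast_pred (NeZero.pos n)]; ring_nf
  · simp [hr]

/-- The second symmetric difference of a function that is `C²` at a point is quadratically small. -/
theorem exists_second_difference_le {n : ℕ} {φ : E n → ℝ} {x : E n} (h : ContDiffAt ℝ 2 φ x) :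
    ∃ C δ : ℝ, 0 ≤ C ∧ 0 < δ ∧ ∀ y, ‖y‖ < δ → |φ (x + y) + φ (x - y) - 2 * φ x| ≤ C * ‖y‖ ^ 2 := by
  have h1 : ContDiffAt ℝ 1 (fderiv ℝ φ) x := h.fderiv_right (by norm_num)
  obtain ⟨K, t, ht, hK⟩ := h1.exists_lipschitzOnWith
  have h2 : ∀ᶠ z in 𝓝 x, DifferentiableAt ℝ φ z :=
    (h.eventually (by simp)).mono fun z hz => hz.differentiableAt (by norm_num)
  obtain ⟨δ, hδ, hb⟩ := Metric.eventually_nhds_iff_ball.1 (h2.and ht)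
  have key : ∀ y, ‖y‖ < δ → |φ (x + y) - φ x - fderiv ℝ φ x y| ≤ K * ‖y‖ * ‖y‖ := by
    intro y hy
    have hsub : ∀ z ∈ Metric.closedBall x ‖y‖, z ∈ Metric.ball x δ := fun z hz =>
      Metric.closedBall_subset_ball hy hz
    have := (convex_closedBall x ‖y‖).norm_image_sub_le_of_norm_fderiv_le' (f := φ) (φ := fderiv ℝ φ x) (C := K * ‖y‖) (x := x) (y := x + y)
      (fun z hz => (hb z (hsub z hz)).1) (fun z hz => ?_) (Metric.mem_closedBall_self (norm_nonneg _)) (by simp)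
    · simpa using this
    · have := hK.dist_le_mul z (hb z (hsub z hz)).2 x (hb x (Metric.mem_ball_self hδ)).2
      rw [dist_eq_norm, dist_eq_norm] at this
      refine this.trans (mul_le_mul_of_nonneg_left ?_ K.2)
      simpa [dist_eq_norm] using hz
  refine ⟨2 * K, δ, by positivity, hδ, fun y hy => ?_⟩
  have k1 := abs_le.1 (key y hy)
  have k2 := abs_le.1 (key (-y) (by simpa using hy))
  simp only [map_neg, norm_neg, ← sub_eq_add_neg] at k2
  rw [abs_le]
  constructor <;> nlinarith [k1.1, k1.2, k2.1, k2.2]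

theorem integrable_second_difference {n : ℕ} [NeZero n] {φ : E n → ℝ} {x : E n} (h : ContDiffAt ℝ 2 φ x)
    (hm : Measurable φ) {M : ℝ} (hM : ∀ z, |φ z| ≤ M) :
    Integrable fun y : E n => (φ (x + y) + φ (x - y) - 2 * φ x) / ‖y‖ ^ (n + 1) := by
  obtain ⟨C, δ, hC, hδ, hb⟩ := exists_second_difference_le h
  have hmeas : AEStronglyMeasurable (fun y : E n => (φ (x + y) + φ (x - y) - 2 * φ x) / ‖y‖ ^ (n + 1)) volume :=
    (Measurable.div (by fun_prop) (by fun_prop)).aestronglyMeasurable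
  rw [← integrableOn_univ, ← union_compl_self (Metric.ball (0 : E n) δ)]
  refine IntegrableOn.union ?_ ?_
  · refine Integrable.mono' ((integrableOn_ball_norm_rpow (n := n) (a := n - 1) (by linarith) δ).const_mul C) hmeas.restrict ?_
    filter_upwards [ae_restrict_mem measurableSet_ball, ae_restrict_of_ae (Measure.ae_ne volume (0 : E n))] with y hy hy0
    have hy1 : 0 < ‖y‖ := norm_pos_iff.2 hy0
    rw [norm_div, Real.norm_eq_abs, norm_pow, norm_norm, div_le_iff₀ (by positivity), mul_assoc, ← Real.rpow_natCast, ← Real.rpow_add hy1]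
    have := hb y (by simpa using hy)
    have e : -((n : ℝ) - 1) + ((n + 1 : ℕ) : ℝ) = (2 : ℕ) := by push_cast; ring
    rw [e, Real.rpow_natCast]
    exact this
  · refine Integrable.mono' ((integrableOn_compl_ball_norm_rpow (n := n) (a := n + 1) (by linarith) hδ).const_mul (4 * M)) hmeas.restrict ?_
    filter_upwards with y
    rw [norm_div, Real.norm_eq_abs, norm_pow, norm_norm, Real.rpow_neg (norm_nonneg _), div_eq_mul_inv]
    have e : ‖y‖ ^ ((n : ℝ) + 1) = ‖y‖ ^ (n + 1) := by
      rw [← Real.rpow_natCast]; push_cast; rfl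
    rw [e]
    gcongr
    have h1 := abs_le.1 (hM (x + y))
    have h2 := abs_le.1 (hM (x - y))
    have h3 := abs_le.1 (hM x)
    rw [abs_le]; constructor <;> linarith [h1.1, h1.2, h2.1, h2.2, h3.1, h3.2]

theorem integrable_poisson {m n : ℕ} (hn : n = 2 * m + 1) {t : ℝ} (ht : 0 < t) :
    Integrable fun y : E n => ((t ^ 2 + ‖y‖ ^ 2) ^ (m + 1))⁻¹ := by
  have h : Integrable fun y : E n => t * ((t ^ 2 + ‖y‖ ^ 2) ^ (m + 1))⁻¹ := by
    refine ⟨by fun_prop, ?_⟩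
    rw [hasFiniteIntegral_iff_ofReal (Eventually.of_forall fun y => by positivity), lintegral_poisson hn ht]
    exact ENNReal.ofReal_lt_top
  have := h.const_mul t⁻¹
  refine this.congr (Eventually.of_forall fun y => ?_)
  simp only
  rw [← mul_assoc, inv_mul_cancel₀ ht.ne', one_mul]

theorem integral_poisson {m n : ℕ} (hn : n = 2 * m + 1) {t : ℝ} (ht : 0 < t) :
    ∫ y : E n, ((t ^ 2 + ‖y‖ ^ 2) ^ (m + 1))⁻¹ = t⁻¹ * (Real.pi ^ (m + 1) / m.factorial) := by
  have h : ∫ y : E n, t * ((t ^ 2 + ‖y‖ ^ 2) ^ (m + 1))⁻¹ = Real.pi ^ (m + 1) / m.factorial := by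
    rw [integral_eq_lintegral_of_nonneg_ae (Eventually.of_forall fun y => by positivity) (by fun_prop), lintegral_poisson hn ht,
      ENNReal.toReal_ofReal (by positivity)]
  rw [integral_const_mul] at h
  rw [← h, ← mul_assoc, inv_mul_cancel₀ ht.ne', one_mul]

/-- The half-Laplacian as the generator of the Poisson semigroup. -/
theorem tendsto_poisson_generator {m n : ℕ} [NeZero n] (hn : n = 2 * m + 1) {φ : E n → ℝ} {x : E n} (h : ContDiffAt ℝ 2 φ x)
    (hm : Measurable φ) {M : ℝ} (hM : ∀ z, |φ z| ≤ M) :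
    Tendsto (fun t : ℝ => t⁻¹ * (φ x - halfConst n * ∫ y : E n, t * ((t ^ 2 + ‖y‖ ^ 2) ^ (m + 1))⁻¹ * φ (x - y)))
      (𝓝[>] 0) (𝓝 (halfLaplacian φ x)) := by
  have hK : halfConst n * (Real.pi ^ (m + 1) / m.factorial) = 1 := by
    rw [halfConst_eq hn]; field_simp
  have hi := integrable_second_difference h hm hM
  have hnm : ∀ y : E n, ‖y‖ ^ (n + 1) = (‖y‖ ^ 2) ^ (m + 1) := fun y => by rw [← pow_mul]; congr 1; omega
  -- The regularised weights (t²+|y|²)^{-(m+1)} stay below |y|^{-(n+1)}, so the integrable second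
  -- difference dominates them all.
  have h1 : Tendsto (fun t : ℝ => ∫ y : E n, (φ (x + y) + φ (x - y) - 2 * φ x) * ((t ^ 2 + ‖y‖ ^ 2) ^ (m + 1))⁻¹) (𝓝[>] 0)
      (𝓝 (∫ y : E n, (φ (x + y) + φ (x - y) - 2 * φ x) / ‖y‖ ^ (n + 1))) := by
    refine tendsto_integral_filter_of_dominated_convergence _ (Eventually.of_forall fun t => ?_) (Eventually.of_forall fun t => ?_) hi.norm ?_
    · exact Measurable.aestronglyMeasurable (by fun_prop)
    · filter_upwards [Measure.ae_ne volume (0 : E n)] with y hy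
      have hy1 : 0 < ‖y‖ := norm_pos_iff.2 hy
      rw [norm_mul, norm_div, div_eq_mul_inv, hnm, norm_inv, norm_pow, norm_pow, Real.norm_of_nonneg (by positivity : 0 ≤ t ^ 2 + ‖y‖ ^ 2),
        Real.norm_of_nonneg (by positivity : 0 ≤ ‖y‖ ^ 2)]
      gcongr
      nlinarith [sq_nonneg t]
    · filter_upwards [Measure.ae_ne volume (0 : E n)] with y hy
      have hy1 : 0 < ‖y‖ := norm_pos_iff.2 hy
      rw [div_eq_mul_inv, hnm]
      have : ContinuousAt (fun t : ℝ => (φ (x + y) + φ (x - y) - 2 * φ x) * ((t ^ 2 + ‖y‖ ^ 2) ^ (m + 1))⁻¹) 0 := by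
        refine continuousAt_const.mul (ContinuousAt.inv₀ (by fun_prop) (by positivity))
      have h2 := this.tendsto.mono_left (nhdsWithin_le_nhds (s := Ioi 0))
      simpa using h2
  have h2 := h1.const_mul (-(1 / 2) * halfConst n)
  refine (h2.congr' ?_)
  filter_upwards [self_mem_nhdsWithin] with t ht
  have ht0 : 0 < t := ht
  have hp := integrable_poisson hn ht0 (n := n)
  have hbd : ∀ (ψ : E n → E n), Measurable ψ → Integrable fun y : E n => φ (ψ y) * ((t ^ 2 + ‖y‖ ^ 2) ^ (m + 1))⁻¹ := by
    intro ψ hψ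
    exact hp.bdd_mul (c := M) (hm.comp hψ).aestronglyMeasurable (Eventually.of_forall fun y => hM _)
  have e1 : ∫ y : E n, (φ (x + y) + φ (x - y) - 2 * φ x) * ((t ^ 2 + ‖y‖ ^ 2) ^ (m + 1))⁻¹ =
      2 * (∫ y : E n, φ (x - y) * ((t ^ 2 + ‖y‖ ^ 2) ^ (m + 1))⁻¹) - 2 * φ x * (t⁻¹ * (Real.pi ^ (m + 1) / m.factorial)) := by
    simp_rw [sub_mul, add_mul]
    have k1 := hbd (fun y => x + y) (by fun_prop)
    have k2 := hbd (fun y => x - y) (by fun_prop)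
    rw [integral_sub (f := fun y => φ (x + y) * ((t ^ 2 + ‖y‖ ^ 2) ^ (m + 1))⁻¹ + φ (x - y) * ((t ^ 2 + ‖y‖ ^ 2) ^ (m + 1))⁻¹)
      (k1.add k2) (hp.const_mul _), integral_add k1 k2,
      integral_const_mul, integral_poisson hn ht0]
    have : ∫ y : E n, φ (x + y) * ((t ^ 2 + ‖y‖ ^ 2) ^ (m + 1))⁻¹ = ∫ y : E n, φ (x - y) * ((t ^ 2 + ‖y‖ ^ 2) ^ (m + 1))⁻¹ := by
      rw [← integral_neg_eq_self]; simp [sub_eq_add_neg]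
    rw [this]; ring
  have e2 : ∫ y : E n, t * ((t ^ 2 + ‖y‖ ^ 2) ^ (m + 1))⁻¹ * φ (x - y) = t * ∫ y : E n, φ (x - y) * ((t ^ 2 + ‖y‖ ^ 2) ^ (m + 1))⁻¹ := by
    rw [← integral_const_mul]; congr 1; ext y; ring
  rw [e1, e2]
  generalize ∫ y : E n, φ (x - y) * ((t ^ 2 + ‖y‖ ^ 2) ^ (m + 1))⁻¹ = I
  have ht1 : t⁻¹ * t = 1 := inv_mul_cancel₀ ht0.ne'
  linear_combination (t⁻¹ * φ x) * hK + (halfConst n * I) * ht1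

/-! ### The half-Laplacian of Riesz potentials. -/

/-- The potential of a measure for the kernel `‖x - z‖ ^ (-2m)`. -/
def pot {n : ℕ} (m : ℕ) (ν : Measure (E n)) (x : E n) : ℝ≥0∞ :=
  ∫⁻ z, ENNReal.ofReal ((‖x - z‖ ^ (2 * m))⁻¹) ∂ν

theorem measurable_pot {n : ℕ} (m : ℕ) (ν : Measure (E n)) [SFinite ν] : Measurable (pot m ν) := by
  unfold pot
  exact Measurable.lintegral_prod_right (f := fun x z : E n => ENNReal.ofReal ((‖x - z‖ ^ (2 * m))⁻¹)) (by fun_prop)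

/-- The factor that makes `‖x‖ ^ (1 - n)` the fundamental solution of the half-Laplacian. -/
def rieszConst (n : ℕ) [NeZero n] : ℝ := halfConst n / (n - 1)

theorem rieszConst_eq {m n : ℕ} [NeZero n] (hn : n = 2 * m + 1) :
    rieszConst n = m.factorial / Real.pi ^ (m + 1) / (2 * m) := by
  rw [rieszConst, halfConst_eq hn, hn]; push_cast; ring

theorem rieszConst_pos {m n : ℕ} [NeZero n] (hn : n = 2 * m + 1) (hm : m ≠ 0) : 0 < rieszConst n := by
  rw [rieszConst_eq hn]; positivity

theorem inv_pow_sub_le {a s : ℝ} (ha : 0 < a) (hs : 0 ≤ s) (m : ℕ) :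
    (a ^ m)⁻¹ - ((s + a) ^ m)⁻¹ ≤ m * s * (a ^ (m + 1))⁻¹ := by
  have h1 : 1 + (m : ℝ) * (-(s / (s + a))) ≤ (1 + -(s / (s + a))) ^ m :=
    one_add_mul_le_pow (by
      have : s / (s + a) ≤ 1 := by rw [div_le_one (by positivity)]; linarith
      linarith) m
  have h2 : 1 + -(s / (s + a)) = a / (s + a) := by field_simp; ring
  rw [h2, div_pow] at h1
  have h3 : s / (s + a) ≤ s / a := by gcongr; linarith
  have h4 : 1 - a ^ m / (s + a) ^ m ≤ m * (s / a) := by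
    have : (m : ℝ) * (s / (s + a)) ≤ m * (s / a) := by gcongr
    linarith
  calc (a ^ m)⁻¹ - ((s + a) ^ m)⁻¹ = (a ^ m)⁻¹ * (1 - a ^ m / (s + a) ^ m) := by field_simp
    _ ≤ (a ^ m)⁻¹ * (m * (s / a)) := by gcongr
    _ = _ := by rw [pow_succ]; field_simp

theorem inv_pow_sub_nonneg {a s : ℝ} (ha : 0 < a) (hs : 0 ≤ s) (m : ℕ) :
    0 ≤ (a ^ m)⁻¹ - ((s + a) ^ m)⁻¹ := by
  rw [sub_nonneg]
  gcongr
  linarith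

/-- Divided by t, the kernel is the dilation t^{-n}A((x-z)/t) of a function A of mass one that is
O(|x|^{-n-1}) at infinity. The mass fixes the value of `rieszConst`. -/
theorem tendsto_approximate_identity {m n : ℕ} [NeZero n] (hn : n = 2 * m + 1) (hm : m ≠ 0) {ψ : E n → ℝ} {x : E n}
    (hψ : Integrable ψ) (hc : ContinuousAt ψ x) :
    Tendsto (fun t : ℝ => t⁻¹ * (rieszConst n * ∫ z, ((‖x - z‖ ^ (2 * m))⁻¹ - ((t ^ 2 + ‖x - z‖ ^ 2) ^ m)⁻¹) * ψ z))
      (𝓝[>] 0) (𝓝 (ψ x)) := by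
  have hr := rieszConst_pos hn hm
  set A : E n → ℝ := fun x => rieszConst n * ((‖x‖ ^ (2 * m))⁻¹ - ((1 + ‖x‖ ^ 2) ^ m)⁻¹) with hA
  -- The absolute value matters only at the origin, where 0⁻¹ = 0 makes A negative.
  have hA0 : ∀ x, 0 ≤ |A x| := fun x => abs_nonneg _
  have hAe : ∀ x : E n, x ≠ 0 → 0 ≤ A x := by
    intro x hx
    have : 0 < ‖x‖ := norm_pos_iff.2 hx
    have := inv_pow_sub_nonneg (a := ‖x‖ ^ 2) (by positivity) zero_le_one m
    rw [hA]; simp only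
    rw [pow_mul]; positivity
  have hA1 : ∫ x, |A x| = 1 := by
    rw [integral_eq_lintegral_of_nonneg_ae (Eventually.of_forall hA0) (by fun_prop)]
    have : ∫⁻ x, ENNReal.ofReal |A x| = ENNReal.ofReal (rieszConst n) * ∫⁻ x : E n, ENNReal.ofReal ((‖x‖ ^ (2 * m))⁻¹ - ((1 + ‖x‖ ^ 2) ^ m)⁻¹) := by
      rw [← lintegral_const_mul _ (by fun_prop)]
      refine lintegral_congr_ae ?_
      filter_upwards [Measure.ae_ne volume (0 : E n)] with x hx
      rw [abs_of_nonneg (hAe x hx), ← ENNReal.ofReal_mul hr.le]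
    rw [this, lintegral_riesz_sub hn, ← ENNReal.ofReal_mul hr.le, ENNReal.toReal_ofReal (by positivity), rieszConst_eq hn]
    field_simp
  have hA2 : Tendsto (fun x : E n => ‖x‖ ^ (Module.finrank ℝ (E n)) * |A x|) (Bornology.cobounded (E n)) (𝓝 0) := by
    have h1 : Tendsto (fun x : E n => rieszConst n * m * ‖x‖⁻¹) (Bornology.cobounded (E n)) (𝓝 0) := by
      simpa using (tendsto_norm_cobounded_atTop (E := E n)).inv_tendsto_atTop.const_mul (rieszConst n * m)
    refine squeeze_zero' (Eventually.of_forall fun x => by positivity) ?_ h1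
    filter_upwards [(tendsto_norm_cobounded_atTop (E := E n)).eventually_gt_atTop 0] with x hx
    rw [abs_of_nonneg (hAe x (norm_pos_iff.1 hx)), finrank_euclideanSpace_fin]
    have := inv_pow_sub_le (a := ‖x‖ ^ 2) (by positivity) zero_le_one m
    rw [← pow_mul, ← pow_mul] at this
    calc ‖x‖ ^ n * A x ≤ ‖x‖ ^ n * (rieszConst n * (m * 1 * (‖x‖ ^ (2 * (m + 1)))⁻¹)) := by
          rw [hA]; simp only; gcongr
      _ = rieszConst n * m * (‖x‖ ^ (2 * m + 1) * (‖x‖ ^ (2 * (m + 1)))⁻¹) := by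
          rw [show ‖x‖ ^ n = ‖x‖ ^ (2 * m + 1) by rw [← hn]]; ring
      _ = _ := by field_simp; ring
  have key := (tendsto_integral_comp_smul_smul_of_integrable' hA0 hA1 hA2 hψ hc).comp tendsto_inv_nhdsGT_zero
  refine key.congr' ?_
  filter_upwards [self_mem_nhdsWithin] with t ht
  have ht0 : 0 < t := ht
  simp only [Function.comp_apply, smul_eq_mul, finrank_euclideanSpace_fin]
  rw [← integral_const_mul, ← integral_const_mul]
  refine integral_congr_ae ?_
  filter_upwards [Measure.ae_ne volume x] with z hz
  have hz' : x - z ≠ 0 := sub_ne_zero.2 hz.symm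
  have hz0 : 0 < ‖x - z‖ := norm_pos_iff.2 hz'
  rw [abs_of_nonneg (hAe _ (smul_ne_zero (inv_ne_zero ht0.ne') hz'))]
  rw [hA]; simp only
  rw [norm_smul, norm_inv, Real.norm_of_nonneg ht0.le]
  have e : 1 + (t⁻¹ * ‖x - z‖) ^ 2 = (t ^ 2)⁻¹ * (t ^ 2 + ‖x - z‖ ^ 2) := by field_simp
  rw [e, mul_pow, mul_pow, show t⁻¹ ^ n = t⁻¹ ^ (2 * m) * t⁻¹ by rw [← pow_succ, ← hn]]
  have e2 : (t ^ 2)⁻¹ ^ m = t⁻¹ ^ (2 * m) := by rw [pow_mul, inv_pow, inv_pow, inv_pow]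
  rw [e2]
  have : t⁻¹ ^ (2 * m) ≠ 0 := by positivity
  generalize t⁻¹ ^ (2 * m) = b at this
  field_simp

theorem lintegral_poisson_mul_pot {m n : ℕ} [NeZero n] (hn : n = 2 * m + 1) {t : ℝ} (ht : 0 < t) (ν : Measure (E n)) [SFinite ν]
    (x : E n) :
    ∫⁻ y : E n, ENNReal.ofReal (t * ((t ^ 2 + ‖y‖ ^ 2) ^ (m + 1))⁻¹) * pot m ν (x - y) =
      ENNReal.ofReal (Real.pi ^ (m + 1) / m.factorial) * ∫⁻ z, ENNReal.ofReal (((t ^ 2 + ‖x - z‖ ^ 2) ^ m)⁻¹) ∂ν := by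
  unfold pot
  have h1 : ∀ y : E n, ENNReal.ofReal (t * ((t ^ 2 + ‖y‖ ^ 2) ^ (m + 1))⁻¹) * ∫⁻ z, ENNReal.ofReal ((‖x - y - z‖ ^ (2 * m))⁻¹) ∂ν =
      ∫⁻ z, ENNReal.ofReal (t * ((t ^ 2 + ‖y‖ ^ 2) ^ (m + 1))⁻¹) * ENNReal.ofReal ((‖x - z - y‖ ^ (2 * m))⁻¹) ∂ν := by
    intro y
    rw [← lintegral_const_mul _ (by fun_prop)]
    simp_rw [sub_right_comm]
  simp_rw [h1]
  rw [lintegral_lintegral_swap (by fun_prop), ← lintegral_const_mul _ (by fun_prop)]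
  refine lintegral_congr fun z => ?_
  rw [lintegral_poisson_mul_riesz hn ht, ENNReal.ofReal_mul (by positivity)]

/-- The increment of the Poisson semigroup on a potential. -/
theorem poisson_increment {m n : ℕ} [NeZero n] (hn : n = 2 * m + 1) {t : ℝ} (ht : 0 < t) (ν : Measure (E n)) [IsFiniteMeasure ν]
    {B : ℝ≥0} (hB : ∀ z, pot m ν z ≤ B) (x : E n) :
    Integrable (fun z => (‖x - z‖ ^ (2 * m))⁻¹ - ((t ^ 2 + ‖x - z‖ ^ 2) ^ m)⁻¹) ν ∧
    Integrable (fun y : E n => t * ((t ^ 2 + ‖y‖ ^ 2) ^ (m + 1))⁻¹ * (pot m ν (x - y)).toReal) ∧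
    (pot m ν x).toReal - halfConst n * ∫ y : E n, t * ((t ^ 2 + ‖y‖ ^ 2) ^ (m + 1))⁻¹ * (pot m ν (x - y)).toReal =
      ∫ z, ((‖x - z‖ ^ (2 * m))⁻¹ - ((t ^ 2 + ‖x - z‖ ^ 2) ^ m)⁻¹) ∂ν := by
  have hfin : ∀ z, pot m ν z ≠ ⊤ := fun z => ((hB z).trans_lt ENNReal.coe_lt_top).ne
  have hK : halfConst n * (Real.pi ^ (m + 1) / m.factorial) = 1 := by
    rw [halfConst_eq hn]; field_simp
  have i1 : Integrable (fun z => (‖x - z‖ ^ (2 * m))⁻¹) ν := by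
    refine ⟨by fun_prop, ?_⟩
    rw [hasFiniteIntegral_iff_ofReal (Eventually.of_forall fun y => by positivity)]
    exact (hfin x).lt_top
  have hcont : Continuous fun z : E n => ((t ^ 2 + ‖x - z‖ ^ 2) ^ m)⁻¹ :=
    Continuous.inv₀ (by fun_prop) fun z => by positivity
  have i2 : Integrable (fun z => ((t ^ 2 + ‖x - z‖ ^ 2) ^ m)⁻¹) ν := by
    refine Integrable.of_bound hcont.aestronglyMeasurable ((t ^ 2) ^ m)⁻¹ (Eventually.of_forall fun z => ?_)
    rw [Real.norm_of_nonneg (by positivity)]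
    gcongr
    nlinarith [sq_nonneg ‖x - z‖]
  have hmeas := measurable_pot m ν
  have e1 : (pot m ν x).toReal = ∫ z, (‖x - z‖ ^ (2 * m))⁻¹ ∂ν := by
    rw [integral_eq_lintegral_of_nonneg_ae (Eventually.of_forall fun y => by positivity) i1.1]; rfl
  have e2 := lintegral_poisson_mul_pot hn ht ν x
  have e2' : ∀ y : E n, ENNReal.ofReal (t * ((t ^ 2 + ‖y‖ ^ 2) ^ (m + 1))⁻¹) * pot m ν (x - y) =
      ENNReal.ofReal (t * ((t ^ 2 + ‖y‖ ^ 2) ^ (m + 1))⁻¹ * (pot m ν (x - y)).toReal) := by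
    intro y
    rw [ENNReal.ofReal_mul (p := t * ((t ^ 2 + ‖y‖ ^ 2) ^ (m + 1))⁻¹) (by positivity), ENNReal.ofReal_toReal (hfin _)]
  simp_rw [e2'] at e2
  rw [← ofReal_integral_eq_lintegral_ofReal i2 (Eventually.of_forall fun y => by positivity),
    ← ENNReal.ofReal_mul (by positivity)] at e2
  have hm3 : AEStronglyMeasurable (fun y : E n => t * ((t ^ 2 + ‖y‖ ^ 2) ^ (m + 1))⁻¹ * (pot m ν (x - y)).toReal) volume :=
    (Measurable.mul (by fun_prop) (hmeas.comp (by fun_prop)).ennreal_toReal).aestronglyMeasurable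
  have hnn : 0 ≤ᵐ[volume] fun y : E n => t * ((t ^ 2 + ‖y‖ ^ 2) ^ (m + 1))⁻¹ * (pot m ν (x - y)).toReal :=
    Eventually.of_forall fun y => by positivity
  have i3 : Integrable (fun y : E n => t * ((t ^ 2 + ‖y‖ ^ 2) ^ (m + 1))⁻¹ * (pot m ν (x - y)).toReal) := by
    refine ⟨hm3, ?_⟩
    rw [hasFiniteIntegral_iff_ofReal hnn, e2]
    exact ENNReal.ofReal_lt_top
  refine ⟨i1.sub i2, i3, ?_⟩
  rw [integral_sub i1 i2, ← e1, integral_eq_lintegral_of_nonneg_ae hnn hm3, e2, ENNReal.toReal_ofReal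
    (mul_nonneg (by positivity) (integral_nonneg fun z => by positivity)), ← mul_assoc, hK, one_mul]

/-- The half-Laplacian of a difference of potentials. -/
theorem halfLaplacian_potential {m n : ℕ} [NeZero n] (hn : n = 2 * m + 1) (hm : m ≠ 0) {ψ φ : E n → ℝ} {x : E n}
    (hψ : Integrable ψ) (hψ0 : ∀ z, 0 ≤ ψ z) (hψm : Measurable ψ) (hc : ContinuousAt ψ x) (ν : Measure (E n)) [IsFiniteMeasure ν]
    {B : ℝ≥0} (hB : ∀ z, pot m ν z ≤ B) (hB' : ∀ z, pot m (volume.withDensity fun z => ENNReal.ofReal (ψ z)) z ≤ B)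
    (hφ : ∀ z, φ z = rieszConst n * ((pot m (volume.withDensity fun z => ENNReal.ofReal (ψ z)) z).toReal - (pot m ν z).toReal))
    (h : ContDiffAt ℝ 2 φ x) {δ : ℝ} (hδ : 0 < δ) (hν : ∀ᵐ z ∂ν, δ ≤ ‖x - z‖) : halfLaplacian φ x = ψ x := by
  set ν₁ : Measure (E n) := volume.withDensity fun z => ENNReal.ofReal (ψ z) with hν₁
  have : IsFiniteMeasure ν₁ := isFiniteMeasure_withDensity_ofReal hψ.2
  have hr := rieszConst_pos hn hm
  have hφm : Measurable φ := by
    have : φ = fun z => rieszConst n * ((pot m ν₁ z).toReal - (pot m ν z).toReal) := funext hφ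
    rw [this]
    exact ((measurable_pot m ν₁).ennreal_toReal.sub (measurable_pot m ν).ennreal_toReal).const_mul _
  have hbd : ∀ z, |φ z| ≤ rieszConst n * B := by
    intro z
    rw [hφ, abs_mul, abs_of_pos hr]
    gcongr
    have h1 := ENNReal.toReal_mono ENNReal.coe_ne_top (hB z)
    have h2 := ENNReal.toReal_mono ENNReal.coe_ne_top (hB' z)
    have h3 : 0 ≤ (pot m ν z).toReal := ENNReal.toReal_nonneg
    have h4 : 0 ≤ (pot m ν₁ z).toReal := ENNReal.toReal_nonneg
    rw [ENNReal.coe_toReal] at h1 h2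
    rw [abs_le]; constructor <;> linarith
  have l1 := tendsto_poisson_generator hn h hφm hbd
  have l2 := tendsto_approximate_identity hn hm hψ hc
  -- At distance at least δ from the mass of ν the increment is O(t²), so it disappears after
  -- division by t.
  have l3 : Tendsto (fun t : ℝ => t⁻¹ * (rieszConst n * ∫ z, ((‖x - z‖ ^ (2 * m))⁻¹ - ((t ^ 2 + ‖x - z‖ ^ 2) ^ m)⁻¹) ∂ν)) (𝓝[>] 0) (𝓝 0) := by
    have l4 : Tendsto (fun t : ℝ => t * (rieszConst n * (m * ((δ ^ 2) ^ (m + 1))⁻¹ * ν.real univ))) (𝓝[>] 0) (𝓝 0) := by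
      have : Continuous fun t : ℝ => t * (rieszConst n * (m * ((δ ^ 2) ^ (m + 1))⁻¹ * ν.real univ)) := by fun_prop
      simpa using this.tendsto 0 |>.mono_left (nhdsWithin_le_nhds (s := Ioi 0))
    refine squeeze_zero_norm' ?_ l4
    filter_upwards [self_mem_nhdsWithin] with t ht
    have ht0 : 0 < t := ht
    have hle : ‖∫ z, ((‖x - z‖ ^ (2 * m))⁻¹ - ((t ^ 2 + ‖x - z‖ ^ 2) ^ m)⁻¹) ∂ν‖ ≤ m * t ^ 2 * ((δ ^ 2) ^ (m + 1))⁻¹ * ν.real univ := by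
      refine norm_integral_le_of_norm_le_const ?_
      filter_upwards [hν] with z hz
      have hz0 : 0 < ‖x - z‖ := hδ.trans_le hz
      rw [pow_mul, Real.norm_of_nonneg (inv_pow_sub_nonneg (by positivity) (by positivity) m)]
      refine (inv_pow_sub_le (by positivity) (by positivity) m).trans ?_
      gcongr
    rw [norm_mul, norm_mul, Real.norm_of_nonneg (by positivity : 0 ≤ t⁻¹), Real.norm_of_nonneg hr.le]
    calc t⁻¹ * (rieszConst n * ‖∫ z, ((‖x - z‖ ^ (2 * m))⁻¹ - ((t ^ 2 + ‖x - z‖ ^ 2) ^ m)⁻¹) ∂ν‖) ≤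
        t⁻¹ * (rieszConst n * (m * t ^ 2 * ((δ ^ 2) ^ (m + 1))⁻¹ * ν.real univ)) := by gcongr
      _ = _ := by field_simp
  refine tendsto_nhds_unique l1 (((l2.sub l3).congr' ?_).trans (by rw [sub_zero]))
  filter_upwards [self_mem_nhdsWithin] with t ht
  have ht0 : 0 < t := ht
  obtain ⟨j1, i1, e1⟩ := poisson_increment hn ht0 ν₁ hB' x
  obtain ⟨j2, i2, e2⟩ := poisson_increment hn ht0 ν hB x
  have e3 : ∫ z, ((‖x - z‖ ^ (2 * m))⁻¹ - ((t ^ 2 + ‖x - z‖ ^ 2) ^ m)⁻¹) ∂ν₁ = 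
      ∫ z, ((‖x - z‖ ^ (2 * m))⁻¹ - ((t ^ 2 + ‖x - z‖ ^ 2) ^ m)⁻¹) * ψ z := by
    rw [hν₁, integral_withDensity_eq_integral_toReal_smul (by fun_prop) (Eventually.of_forall fun z => ENNReal.ofReal_lt_top)]
    refine integral_congr_ae (Eventually.of_forall fun z => ?_)
    simp only [smul_eq_mul, ENNReal.toReal_ofReal (hψ0 z), mul_comm]
  rw [← e3, ← e1, ← e2, hφ x]
  have e4 : ∫ y : E n, t * ((t ^ 2 + ‖y‖ ^ 2) ^ (m + 1))⁻¹ * φ (x - y) = rieszConst n * 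
      ((∫ y : E n, t * ((t ^ 2 + ‖y‖ ^ 2) ^ (m + 1))⁻¹ * (pot m ν₁ (x - y)).toReal) - 
        ∫ y : E n, t * ((t ^ 2 + ‖y‖ ^ 2) ^ (m + 1))⁻¹ * (pot m ν (x - y)).toReal) := by
    rw [← integral_sub i1 i2, ← integral_const_mul]
    refine integral_congr_ae (Eventually.of_forall fun y => ?_)
    simp only [hφ]; ring
  rw [e4]; ring

/-! ### Anti-inversion, balayage and the Green function of the ball. -/

/-- The point that corresponds to `w` under the anti-inversion with centre `y` that preserves the
sphere of radius `R`. -/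
def reflPt {n : ℕ} (R : ℝ) (y w : E n) : E n :=
  y - ((R ^ 2 - ‖y‖ ^ 2) * (‖w - y‖ ^ 2)⁻¹) • (w - y)

/-- The polynomial `‖w - y‖ ^ 2 * ‖x - reflPt R y w‖ ^ 2`. -/
def kap {n : ℕ} (R : ℝ) (x y w : E n) : ℝ :=
  ‖x - y‖ ^ 2 * ‖w - y‖ ^ 2 + 2 * (R ^ 2 - ‖y‖ ^ 2) * inner ℝ (w - y) (x - y) + (R ^ 2 - ‖y‖ ^ 2) ^ 2

/-- Writing T for `reflPt R y`, this symmetry means |w-y| |x-Tw| = |x-y| |w-Tx|. It moves T from the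
integration variable to the point of evaluation. -/
theorem kap_symm {n : ℕ} (R : ℝ) (x y w : E n) : kap R x y w = kap R w y x := by
  unfold kap; rw [real_inner_comm]; ring

theorem kap_eq {n : ℕ} {R : ℝ} {x y w : E n} (h : w ≠ y) :
    kap R x y w = ‖w - y‖ ^ 2 * ‖x - reflPt R y w‖ ^ 2 := by
  have h0 : 0 < ‖w - y‖ := norm_pos_iff.2 (sub_ne_zero.2 h)
  have h1 : x - reflPt R y w = (x - y) + ((R ^ 2 - ‖y‖ ^ 2) * (‖w - y‖ ^ 2)⁻¹) • (w - y) := by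
    unfold reflPt; abel
  rw [h1, norm_add_sq_real, norm_smul, mul_pow, Real.norm_eq_abs, sq_abs, inner_smul_right, real_inner_comm, kap]
  field_simp

/-- For y in the open ball, the sign of the right-hand side shows that the map exchanges the inside
and the outside of the sphere. -/
theorem norm_reflPt_sq {n : ℕ} {R : ℝ} {y w : E n} (h : w ≠ y) :
    ‖reflPt R y w‖ ^ 2 - R ^ 2 = (R ^ 2 - ‖y‖ ^ 2) * (R ^ 2 - ‖w‖ ^ 2) / ‖w - y‖ ^ 2 := by
  have h0 : 0 < ‖w - y‖ := norm_pos_iff.2 (sub_ne_zero.2 h)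
  have h2 : ‖w‖ ^ 2 = ‖y‖ ^ 2 + 2 * inner ℝ y (w - y) + ‖w - y‖ ^ 2 := by
    rw [← norm_add_sq_real]; simp
  rw [h2, reflPt, norm_sub_sq_real, norm_smul, mul_pow, Real.norm_eq_abs, sq_abs, inner_smul_right]
  field_simp
  ring

theorem le_norm_reflPt {n : ℕ} {R : ℝ} (hR : 0 < R) {y w : E n} (h : w ≠ y) (hy : ‖y‖ < R) (hw : ‖w‖ ≤ R) :
    R ≤ ‖reflPt R y w‖ := by
  have h1 := norm_reflPt_sq (R := R) h
  have h2 : 0 ≤ (R ^ 2 - ‖y‖ ^ 2) * (R ^ 2 - ‖w‖ ^ 2) / ‖w - y‖ ^ 2 := by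
    refine div_nonneg (mul_nonneg ?_ ?_) (by positivity) <;> nlinarith [norm_nonneg y, norm_nonneg w]
  exact le_of_sq_le_sq (by linarith) (norm_nonneg _)

theorem norm_reflPt_le {n : ℕ} {R : ℝ} (hR : 0 < R) {y w : E n} (h : w ≠ y) (hy : ‖y‖ < R) (hw : R ≤ ‖w‖) :
    ‖reflPt R y w‖ ≤ R := by
  have h1 := norm_reflPt_sq (R := R) h
  have h2 : (R ^ 2 - ‖y‖ ^ 2) * (R ^ 2 - ‖w‖ ^ 2) / ‖w - y‖ ^ 2 ≤ 0 := by
    refine div_nonpos_of_nonpos_of_nonneg (mul_nonpos_of_nonneg_of_nonpos ?_ ?_) (by positivity) <;> nlinarith [norm_nonneg y, norm_nonneg w]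
  exact le_of_sq_le_sq (by linarith) hR.le

/-- The image of a point w ≠ y of the closed ball lies outside the open ball, away from x. Being a
polynomial, `kap` is also positive at w = y, where `reflPt` degenerates. So `kap⁻ᵐ` is a smooth
kernel. -/
theorem kap_pos {n : ℕ} {R : ℝ} (hR : 0 < R) {x y w : E n} (hx : ‖x‖ < R) (hy : ‖y‖ < R) (hw : ‖w‖ ≤ R) :
    0 < kap R x y w := by
  rcases eq_or_ne w y with rfl | h
  · simp only [kap, sub_self, norm_zero, inner_zero_left]
    have : 0 < R ^ 2 - ‖w‖ ^ 2 := by nlinarith [norm_nonneg w]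
    positivity
  · rw [kap_eq h]
    have h0 : 0 < ‖w - y‖ := norm_pos_iff.2 (sub_ne_zero.2 h)
    have h1 : 0 < ‖x - reflPt R y w‖ := by
      rw [norm_pos_iff, sub_ne_zero]
      rintro rfl
      linarith [le_norm_reflPt hR h hy hw]
    positivity

/-- The area of the unit sphere. -/
abbrev sphArea (n : ℕ) : ℝ := (sphMeas n).real univ

theorem sphArea_pos (n : ℕ) [NeZero n] : 0 < sphArea n := by
  have : NeZero (sphMeas n) := ⟨Measure.toSphere_ne_zero _⟩
  exact measureReal_univ_pos

theorem sphMeas_univ_eq (n : ℕ) : sphMeas n univ = ENNReal.ofReal (sphArea n) :=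
  (ofReal_measureReal (measure_ne_top _ _)).symm

theorem missing_zero (n : ℕ) [NeZero n] : missing n 0 = 0 := by
  obtain ⟨C, -, h⟩ := exists_missing_le n
  exact le_antisymm (by simpa using h 0 le_rfl) (missing_nonneg 0)

/-- The ratio of the Green function of the half-Laplacian on the ball to the fundamental solution. -/
def greenRatio {n : ℕ} [NeZero n] (R : ℝ) (x y : E n) : ℝ :=
  missing n (max (R ^ 2 - ‖x‖ ^ 2) 0 * (R ^ 2 - ‖y‖ ^ 2) / (R ^ 2 * ‖x - y‖ ^ 2)) / sphArea n

theorem missing_le (n : ℕ) [NeZero n] (q : ℝ) : missing n q ≤ sphArea n := by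
  unfold missing sphArea
  rw [Measure.toSphere_real_apply_univ, finrank_euclideanSpace_fin]
  gcongr
  · exact measure_ball_lt_top.ne
  · intro w hw; simpa using hw.1

theorem greenRatio_nonneg {n : ℕ} [NeZero n] (R : ℝ) (x y : E n) : 0 ≤ greenRatio R x y :=
  div_nonneg (missing_nonneg _) (sphArea_pos n).le

theorem greenRatio_le_one {n : ℕ} [NeZero n] (R : ℝ) (x y : E n) : greenRatio R x y ≤ 1 :=
  (div_le_one (sphArea_pos n)).2 (missing_le n _)

theorem greenRatio_of_le {n : ℕ} [NeZero n] {R : ℝ} (hR : 0 < R) {x : E n} (hx : R ≤ ‖x‖) (y : E n) : greenRatio R x y = 0 := by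
  have : max (R ^ 2 - ‖x‖ ^ 2) 0 = 0 := max_eq_right (by nlinarith)
  simp [greenRatio, this, missing_zero]

/-- The total mass of the equilibrium density, in the normalisation of `lintegral_equilibrium`. -/
def eqMass (n : ℕ) : ℝ := Real.pi / 2 * sphArea n

theorem eqMass_pos (n : ℕ) [NeZero n] : 0 < eqMass n := mul_pos (by positivity) (sphArea_pos n)

theorem two_inv_mul_ofReal (a : ℝ) : (2 : ℝ≥0∞)⁻¹ * ENNReal.ofReal a = ENNReal.ofReal (2⁻¹ * a) := by
  rw [ENNReal.ofReal_mul (by norm_num), ENNReal.ofReal_inv_of_pos (by norm_num), ENNReal.ofReal_ofNat]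

/-- If x lies outside the open ball, its image lies in the closed ball and the potential is full. If
x lies inside, the image lies outside the open ball and the lines that miss it account for
`greenRatio`. -/
theorem lintegral_equilibrium_reflPt {m n : ℕ} [NeZero n] (hn : n = 2 * m + 1) {R : ℝ} (hR : 0 < R) {x y : E n} (hy : ‖y‖ < R)
    (hxy : x ≠ y) :
    ∫⁻ w, ENNReal.ofReal ((‖w - reflPt R y x‖ ^ (2 * m))⁻¹) * ENNReal.ofReal (√(R ^ 2 - ‖w‖ ^ 2))⁻¹ =
      ENNReal.ofReal (eqMass n * (1 - greenRatio R x y)) := by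
  have hm : 2 * m = n - 1 := by omega
  have hσ := sphArea_pos n
  rw [hm]
  rcases le_or_gt R ‖x‖ with hx | hx
  · rw [lintegral_equilibrium_of_mem hR (norm_reflPt_le hR hxy hy hx), greenRatio_of_le hR hx, sphMeas_univ_eq,
      ← ENNReal.ofReal_mul (by positivity), two_inv_mul_ofReal, eqMass]
    congr 1; ring
  · have hT := le_norm_reflPt hR hxy hy hx.le
    rw [lintegral_equilibrium]
    have hmeas : MeasurableSet {θ : Metric.sphere (0 : E n) 1 | ¬ 0 < R ^ 2 - ‖reflPt R y x‖ ^ 2 + inner ℝ (reflPt R y x) (θ : E n) ^ 2} := by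
      refine MeasurableSet.compl (s := {θ : Metric.sphere (0 : E n) 1 | 0 < R ^ 2 - ‖reflPt R y x‖ ^ 2 + inner ℝ (reflPt R y x) (θ : E n) ^ 2}) ?_
      exact measurableSet_lt (by fun_prop) (by fun_prop)
    have h1 := measure_compl hmeas (measure_ne_top (sphMeas n) _)
    rw [sphMeas_missing hR _ hT, sphMeas_univ_eq, ← ENNReal.ofReal_sub _ (missing_nonneg _)] at h1
    have h2 : {θ : Metric.sphere (0 : E n) 1 | ¬ 0 < R ^ 2 - ‖reflPt R y x‖ ^ 2 + inner ℝ (reflPt R y x) (θ : E n) ^ 2}ᶜ =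
      {θ : Metric.sphere (0 : E n) 1 | 0 < R ^ 2 - ‖reflPt R y x‖ ^ 2 + inner ℝ (reflPt R y x) (θ : E n) ^ 2} := by
      ext θ; simp
    have h0 : 0 < ‖x - y‖ := norm_pos_iff.2 (sub_ne_zero.2 hxy)
    have h3 : (‖reflPt R y x‖ ^ 2 - R ^ 2) / R ^ 2 = max (R ^ 2 - ‖x‖ ^ 2) 0 * (R ^ 2 - ‖y‖ ^ 2) / (R ^ 2 * ‖x - y‖ ^ 2) := by
      rw [norm_reflPt_sq hxy, max_eq_left (by nlinarith [norm_nonneg x])]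
      field_simp
    have h4 := missing_le n ((‖reflPt R y x‖ ^ 2 - R ^ 2) / R ^ 2)
    rw [h2] at h1
    rw [h1, ← ENNReal.ofReal_mul (by positivity), two_inv_mul_ofReal, eqMass, greenRatio, h3]
    congr 1; field_simp

theorem pow_mul_inv_eq_kap {n m : ℕ} {R : ℝ} {x y w : E n} (h : w ≠ y) :
    (‖w - y‖ ^ (2 * m))⁻¹ * (‖x - reflPt R y w‖ ^ (2 * m))⁻¹ = (kap R x y w ^ m)⁻¹ := by
  rw [kap_eq h, mul_pow, mul_inv, ← pow_mul, ← pow_mul]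

/-- The balayage onto the complement of the ball of the measure with density `ψ`. -/
def balayage {n : ℕ} (m : ℕ) (R : ℝ) (ψ : E n → ℝ) : Measure (E n) :=
  Measure.map (fun p : E n × E n => reflPt R p.1 p.2)
    ((volume.prod volume).withDensity fun p => ENNReal.ofReal (ψ p.1) * (ENNReal.ofReal (eqMass n)⁻¹ *
      (ENNReal.ofReal ((‖p.2 - p.1‖ ^ (2 * m))⁻¹) * ENNReal.ofReal (√(R ^ 2 - ‖p.2‖ ^ 2))⁻¹)))

theorem measurable_reflPt {n : ℕ} (R : ℝ) : Measurable fun p : E n × E n => reflPt R p.1 p.2 := by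
  unfold reflPt; fun_prop

theorem lintegral_balayage {n : ℕ} (m : ℕ) (R : ℝ) {ψ : E n → ℝ} (hψ : Measurable ψ) {f : E n → ℝ≥0∞} (hf : Measurable f) :
    ∫⁻ z, f z ∂(balayage m R ψ) = ∫⁻ y, ENNReal.ofReal (ψ y) * (ENNReal.ofReal (eqMass n)⁻¹ *
      ∫⁻ w, ENNReal.ofReal ((‖w - y‖ ^ (2 * m))⁻¹) * ENNReal.ofReal (√(R ^ 2 - ‖w‖ ^ 2))⁻¹ * f (reflPt R y w)) := by
  have hT := measurable_reflPt (n := n) R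
  have hfT : Measurable fun p : E n × E n => f (reflPt R p.1 p.2) := hf.comp hT
  rw [balayage, lintegral_map hf hT, lintegral_withDensity_eq_lintegral_mul _ (by fun_prop) hfT, lintegral_prod _ (by fun_prop)]
  refine lintegral_congr fun y => ?_
  have h1 : Measurable fun w : E n => f (reflPt R y w) := hfT.comp measurable_prodMk_left
  rw [← lintegral_const_mul _ (by fun_prop), ← lintegral_const_mul _ (by fun_prop)]
  refine lintegral_congr fun w => ?_
  simp only [Pi.mul_apply, mul_assoc]

/-- Sweeping preserves mass because the equilibrium potential at any y in the ball equals `eqMass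
n`, the normalising constant. -/
theorem balayage_univ {m n : ℕ} [NeZero n] (hn : n = 2 * m + 1) {R : ℝ} (hR : 0 < R) {ψ : E n → ℝ} (hψ : Measurable ψ)
    (hs : ∀ y, R ≤ ‖y‖ → ψ y = 0) : balayage m R ψ univ = ∫⁻ y, ENNReal.ofReal (ψ y) := by
  have h := lintegral_balayage m R hψ (f := fun _ => 1) (by fun_prop)
  rw [lintegral_one] at h
  rw [h]
  refine lintegral_congr fun y => ?_
  rcases le_or_gt R ‖y‖ with hy | hy
  · simp [hs y hy]
  · simp only [mul_one]
    rw [show 2 * m = n - 1 by omega, lintegral_equilibrium_of_mem hR hy.le, sphMeas_univ_eq]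
    have := eqMass_pos n
    rw [← ENNReal.ofReal_mul (by positivity), two_inv_mul_ofReal,
      ← ENNReal.ofReal_mul (by positivity), show 2⁻¹ * (Real.pi * sphArea n) = eqMass n by unfold eqMass; ring, inv_mul_cancel₀ this.ne']
    simp

/-- By the symmetry of `kap` the potential at x of the swept point mass is |x-y|^{-2m} times the
normalised equilibrium potential at the image of x. -/
theorem pot_balayage_aux {m n : ℕ} [NeZero n] (hn : n = 2 * m + 1) {R : ℝ} (hR : 0 < R) {x y : E n} (hy : ‖y‖ < R) (hxy : x ≠ y) :
    ENNReal.ofReal (eqMass n)⁻¹ * ∫⁻ w, ENNReal.ofReal ((‖w - y‖ ^ (2 * m))⁻¹) * ENNReal.ofReal (√(R ^ 2 - ‖w‖ ^ 2))⁻¹ *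
      ENNReal.ofReal ((‖x - reflPt R y w‖ ^ (2 * m))⁻¹) = ENNReal.ofReal ((‖x - y‖ ^ (2 * m))⁻¹ * (1 - greenRatio R x y)) := by
  have h1 : ∀ᵐ w : E n, ENNReal.ofReal ((‖w - y‖ ^ (2 * m))⁻¹) * ENNReal.ofReal (√(R ^ 2 - ‖w‖ ^ 2))⁻¹ *
      ENNReal.ofReal ((‖x - reflPt R y w‖ ^ (2 * m))⁻¹) = ENNReal.ofReal ((‖x - y‖ ^ (2 * m))⁻¹) * 
      (ENNReal.ofReal ((‖w - reflPt R y x‖ ^ (2 * m))⁻¹) * ENNReal.ofReal (√(R ^ 2 - ‖w‖ ^ 2))⁻¹) := by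
    filter_upwards [Measure.ae_ne volume y] with w hw
    rw [mul_right_comm, ← ENNReal.ofReal_mul (by positivity), pow_mul_inv_eq_kap hw, kap_symm, ← pow_mul_inv_eq_kap hxy,
      ENNReal.ofReal_mul (by positivity), mul_assoc]
  have hE := eqMass_pos n
  rw [lintegral_congr_ae h1, lintegral_const_mul _ (by fun_prop), lintegral_equilibrium_reflPt hn hR hy hxy, ← ENNReal.ofReal_mul (by positivity),
    ← ENNReal.ofReal_mul (by positivity)]
  congr 1
  field_simp

theorem pot_balayage {m n : ℕ} [NeZero n] (hn : n = 2 * m + 1) {R : ℝ} (hR : 0 < R) {ψ : E n → ℝ} (hψ : Measurable ψ)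
    (hs : ∀ y, R ≤ ‖y‖ → ψ y = 0) (x : E n) :
    pot m (balayage m R ψ) x = ∫⁻ y, ENNReal.ofReal (ψ y) * ENNReal.ofReal ((‖x - y‖ ^ (2 * m))⁻¹ * (1 - greenRatio R x y)) := by
  rw [pot, lintegral_balayage m R hψ (by fun_prop)]
  refine lintegral_congr_ae ?_
  filter_upwards [Measure.ae_ne volume x] with y hy
  rcases le_or_gt R ‖y‖ with hyR | hyR
  · simp [hs y hyR]
  · rw [pot_balayage_aux hn hR hyR hy.symm]

theorem pot_withDensity {m n : ℕ} {ψ : E n → ℝ} (hψ : Measurable ψ) (x : E n) :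
    pot m (volume.withDensity fun z => ENNReal.ofReal (ψ z)) x = ∫⁻ y, ENNReal.ofReal (ψ y) * ENNReal.ofReal ((‖x - y‖ ^ (2 * m))⁻¹) := by
  rw [pot, lintegral_withDensity_eq_lintegral_mul _ (by fun_prop) (by fun_prop)]
  rfl

/-! ### Smoothness, bounds and half-Laplacian of the Green potential. -/

/-- There is a smooth function equal to `1` on a given compact set and supported in a given
neighbourhood. -/
theorem exists_smooth_cutoff {G : Type*} [NormedAddCommGroup G] [NormedSpace ℝ G] [FiniteDimensional ℝ G]
    {K V : Set G} (hK : IsCompact K) (hV : IsOpen V) (hKV : K ⊆ V) :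
    ∃ χ : G → ℝ, ContDiff ℝ ∞ χ ∧ HasCompactSupport χ ∧ tsupport χ ⊆ V ∧ EqOn χ 1 K ∧ ∀ x, χ x ∈ Icc (0 : ℝ) 1 := by
  obtain ⟨U, hU, hKU, hUV, hUc⟩ := exists_open_between_and_isCompact_closure hK hV hKV
  obtain ⟨f, hf0, hf1, hf⟩ := exists_contMDiffMap_zero_one_of_isClosed (n := (⊤ : ℕ∞)) (modelWithCornersSelf ℝ G) hU.isClosed_compl hK.isClosed
    (disjoint_compl_left_iff_subset.2 hKU)
  have hsup : tsupport f ⊆ closure U := closure_mono fun x hx => by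
    by_contra h; exact hx (hf0 h)
  exact ⟨f, f.contMDiff.contDiff, hUc.of_isClosed_subset (isClosed_tsupport _) hsup, hsup.trans hUV, hf1, hf⟩

/-- Smoothness of an integral that depends on a parameter, the integration being over a compact
set. -/
theorem contDiffAt_integral_param {P G : Type*} [NormedAddCommGroup P] [NormedSpace ℝ P] [NormedAddCommGroup G] [NormedSpace ℝ G]
    [FiniteDimensional ℝ G] [MeasurableSpace G] [BorelSpace G] {μ : Measure G} {f : G → ℝ} (hf : LocallyIntegrable f μ)
    {K : Set G} (hK : IsCompact K) (hfK : ∀ t ∉ K, f t = 0) {k : P × G → ℝ} {O : Set (P × G)} (hO : IsOpen O)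
    (hk : ContDiffOn ℝ ∞ k O) {x₀ : P} (hx : ∀ t ∈ K, (x₀, t) ∈ O) :
    ContDiffAt ℝ ∞ (fun x => ∫ t, f t * k (x, t) ∂μ) x₀ := by
  obtain ⟨U, V, hU, hV, hxU, hKV, hUV⟩ := generalized_tube_lemma (isCompact_singleton (x := x₀)) hK hO
    (by rintro ⟨p, t⟩ ⟨rfl, ht⟩; exact hx t ht)
  obtain ⟨χ, hχ, hχc, hχV, hχ1, -⟩ := exists_smooth_cutoff hK hV hKV
  -- With the sign reversed, the integral is the convolution of f with g(x, ·) evaluated at 0. The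
  -- cutoff gives g compact support in u and changes nothing on K, outside which f vanishes.
  set g : P → G → ℝ := fun p u => χ (-u) * k (p, -u) with hg
  have hcomp : IsCompact (-tsupport χ) := hχc.isCompact.neg
  have hsm : ContDiffOn ℝ ∞ (Function.uncurry g) (U ×ˢ univ) := by
    rintro ⟨p, u⟩ ⟨hp, -⟩
    refine ContDiffAt.contDiffWithinAt ?_
    have hneg : ContDiffAt ℝ ∞ (fun q : P × G => (q.1, -q.2)) (p, u) := by fun_prop
    by_cases hu : -u ∈ V
    · have h1 : ContDiffAt ℝ ∞ k (p, -u) := hk.contDiffAt (hO.mem_nhds (hUV ⟨hp, hu⟩))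
      exact ContDiffAt.mul (hχ.contDiffAt.comp (p, u) (by fun_prop : ContDiffAt ℝ ∞ (fun q : P × G => -q.2) (p, u))) (h1.comp (p, u) hneg)
    · have h1 : ∀ᶠ q : P × G in 𝓝 (p, u), χ (-q.2) = 0 := by
        have h2 : ∀ᶠ z in 𝓝 (-u), χ z = 0 := by
          have : (tsupport χ)ᶜ ∈ 𝓝 (-u) := (isClosed_tsupport χ).isOpen_compl.mem_nhds fun h => hu (hχV h)
          filter_upwards [this] with z hz using image_eq_zero_of_notMem_tsupport hz
        exact (continuous_snd.neg.tendsto (p, u)).eventually h2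
      refine (contDiffAt_const (c := (0 : ℝ))).congr_of_eventuallyEq ?_
      filter_upwards [h1] with q hq
      simp [Function.uncurry, hg, hq]
  have h1 := contDiffOn_convolution_right_with_param (μ := μ) (ContinuousLinearMap.mul ℝ ℝ) hU hcomp (f := f) (g := g)
    (fun p u _ hu => by
      have : χ (-u) = 0 := image_eq_zero_of_notMem_tsupport fun h => hu (by simpa using h)
      simp [hg, this]) hf hsm
  have h2 : ContDiffAt ℝ ∞ (fun x : P => (x, (0 : G))) x₀ := by fun_prop
  have h3 := (h1.contDiffAt ((hU.prod isOpen_univ).mem_nhds ⟨hxU (mem_singleton _), mem_univ _⟩)).comp x₀ h2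
  refine h3.congr_of_eventuallyEq (Eventually.of_forall fun x => ?_)
  simp only [Function.comp_apply, convolution_def, hg, ContinuousLinearMap.mul_apply']
  refine integral_congr_ae (Eventually.of_forall fun t => ?_)
  by_cases ht : t ∈ K
  · simp [hχ1 ht]
  · simp [hfK t ht]

theorem kap_nonneg {n : ℕ} (R : ℝ) (x y w : E n) : 0 ≤ kap R x y w := by
  rcases eq_or_ne w y with rfl | h
  · have : kap R x w w = (R ^ 2 - ‖w‖ ^ 2) ^ 2 := by simp [kap]
    rw [this]; positivity
  · rw [kap_eq h]; positivity

theorem integrable_inv_sqrt {n : ℕ} [NeZero n] {R : ℝ} (hR : 0 < R) :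
    Integrable fun w : E n => (√(R ^ 2 - ‖w‖ ^ 2))⁻¹ := by
  have h := lintegral_equilibrium_of_mem (n := n) hR (x := 0) (by simpa using hR.le)
  have hi : Integrable fun w : E n => (‖w‖ ^ (n - 1))⁻¹ * (√(R ^ 2 - ‖w‖ ^ 2))⁻¹ := by
    refine ⟨by fun_prop, ?_⟩
    rw [hasFiniteIntegral_iff_ofReal (Eventually.of_forall fun y => by positivity)]
    simp_rw [ENNReal.ofReal_mul (inv_nonneg.2 (pow_nonneg (norm_nonneg _) _))]
    simp only [sub_zero] at h
    rw [h, sphMeas_univ_eq]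
    exact ENNReal.mul_lt_top (by simp) (ENNReal.mul_lt_top ENNReal.ofReal_lt_top ENNReal.ofReal_lt_top)
  refine (hi.const_mul (R ^ (n - 1))).mono' (by fun_prop) ?_
  filter_upwards [Measure.ae_ne volume (0 : E n)] with w hw
  have hw0 : 0 < ‖w‖ := norm_pos_iff.2 hw
  rw [Real.norm_of_nonneg (by positivity), ← mul_assoc]
  rcases le_or_gt R ‖w‖ with h1 | h1
  · rw [Real.sqrt_eq_zero_of_nonpos (by nlinarith)]; simp
  · refine le_mul_of_one_le_left (by positivity) ?_
    rw [← div_eq_mul_inv, one_le_div (by positivity)]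
    gcongr

/-- The difference of the potentials of a density and of its balayage onto the complement of the
ball, normalised to be the solution of the Dirichlet problem for the half-Laplacian. -/
def greenPot {n : ℕ} [NeZero n] (m : ℕ) (R : ℝ) (ψ : E n → ℝ) (x : E n) : ℝ :=
  rieszConst n * ((pot m (volume.withDensity fun z => ENNReal.ofReal (ψ z)) x).toReal - (pot m (balayage m R ψ) x).toReal)

theorem toReal_pot_withDensity {m n : ℕ} {ψ : E n → ℝ} (hψ : Measurable ψ) (hψ0 : ∀ x, 0 ≤ ψ x) (x : E n) :
    (pot m (volume.withDensity fun z => ENNReal.ofReal (ψ z)) x).toReal = ∫ y, ψ y * (‖x - y‖ ^ (2 * m))⁻¹ := by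
  rw [pot_withDensity hψ, integral_eq_lintegral_of_nonneg_ae (Eventually.of_forall fun y => mul_nonneg (hψ0 y) (by positivity)) (by fun_prop)]
  congr 1
  refine lintegral_congr fun y => ?_
  rw [ENNReal.ofReal_mul (hψ0 y)]

theorem toReal_pot_balayage {m n : ℕ} [NeZero n] (R : ℝ) {ψ : E n → ℝ} (hψ : Measurable ψ) (hψ0 : ∀ x, 0 ≤ ψ x)
    (x : E n) : (pot m (balayage m R ψ) x).toReal =
      ∫ p : E n × E n, ψ p.1 * ((eqMass n)⁻¹ * (√(R ^ 2 - ‖p.2‖ ^ 2))⁻¹) * (kap R x p.1 p.2 ^ m)⁻¹ := by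
  have hE := eqMass_pos n
  have hk : Continuous fun p : E n × E n => kap R x p.1 p.2 := by unfold kap; fun_prop
  have hkm : Measurable fun p : E n × E n => kap R x p.1 p.2 := hk.measurable
  rw [pot, lintegral_balayage m R hψ (by fun_prop), integral_eq_lintegral_of_nonneg_ae (Eventually.of_forall fun p => by
    have := kap_nonneg R x p.1 p.2
    have := hψ0 p.1
    simp only [Pi.zero_apply]
    positivity) (by fun_prop), Measure.volume_eq_prod, lintegral_prod _ (by fun_prop)]
  congr 1
  refine lintegral_congr fun y => ?_
  have h1 : Measurable fun w : E n => reflPt R y w := (measurable_reflPt R).comp measurable_prodMk_left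
  have h2 : Measurable fun w : E n => (‖x - reflPt R y w‖ ^ (2 * m))⁻¹ := by fun_prop
  rw [← lintegral_const_mul _ (by fun_prop), ← lintegral_const_mul _ (by fun_prop)]
  refine lintegral_congr_ae ?_
  filter_upwards [Measure.ae_ne volume y] with w hw
  rw [mul_right_comm (ENNReal.ofReal _), ← ENNReal.ofReal_mul (by positivity), pow_mul_inv_eq_kap hw, ← ENNReal.ofReal_mul (by
    have := kap_nonneg R x y w; positivity), ← ENNReal.ofReal_mul (by positivity), ← ENNReal.ofReal_mul (hψ0 y)]
  congr 1; ring

theorem locallyIntegrable_riesz {m n : ℕ} [NeZero n] (hn : n = 2 * m + 1) :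
    LocallyIntegrable fun x : E n => (‖x‖ ^ (2 * m))⁻¹ := by
  rw [locallyIntegrable_iff]
  intro k hk
  obtain ⟨r, hr⟩ := hk.isBounded.subset_ball (0 : E n)
  refine IntegrableOn.mono_set ?_ hr
  have h := integrableOn_ball_norm_rpow (n := n) (a := (2 * m : ℕ)) (by rw [hn]; push_cast; linarith) r
  refine h.congr (Eventually.of_forall fun x => ?_)
  simp only
  rw [Real.rpow_neg (norm_nonneg _), Real.rpow_natCast]

/-- The free potential is a convolution with a smooth compactly supported function. The balayage
potential is an integral over the compact set tsupport ψ × closed ball of the kernel `kap⁻ᵐ`, smooth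
where `kap` is positive. The integrable singularities of the density do not involve x. -/
theorem contDiffOn_greenPot {m n : ℕ} [NeZero n] (hn : n = 2 * m + 1) {R : ℝ} (hR : 0 < R) {ψ : E n → ℝ} (hψ : ContDiff ℝ ∞ ψ)
    (hψ0 : ∀ x, 0 ≤ ψ x) (hc : HasCompactSupport ψ) (hs : tsupport ψ ⊆ Metric.ball 0 R) :
    ContDiffOn ℝ ∞ (greenPot m R ψ) (Metric.ball 0 R) := by
  have h1 : ContDiff ℝ ∞ fun x => (pot m (volume.withDensity fun z => ENNReal.ofReal (ψ z)) x).toReal := by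
    have := hc.contDiff_convolution_left (ContinuousLinearMap.mul ℝ ℝ) hψ (locallyIntegrable_riesz (n := n) hn)
    convert! this using 1
    ext x
    rw [toReal_pot_withDensity hψ.continuous.measurable hψ0]; rfl
  have h2 : ContDiffOn ℝ ∞ (fun x => (pot m (balayage m R ψ) x).toReal) (Metric.ball 0 R) := by
    intro x hx
    refine ContDiffAt.contDiffWithinAt ?_
    simp_rw [toReal_pot_balayage R hψ.continuous.measurable hψ0]
    have hkc : ContDiff ℝ ∞ fun q : E n × (E n × E n) => kap R q.1 q.2.1 q.2.2 := by
      unfold kap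
      simp_rw [← real_inner_self_eq_norm_sq]
      have h1 : ContDiff ℝ ∞ fun q : E n × (E n × E n) => q.1 - q.2.1 := by fun_prop
      have h2 : ContDiff ℝ ∞ fun q : E n × (E n × E n) => q.2.2 - q.2.1 := by fun_prop
      have h3 : ContDiff ℝ ∞ fun q : E n × (E n × E n) => R ^ 2 - inner ℝ q.2.1 q.2.1 :=
        contDiff_const.sub (ContDiff.inner ℝ (by fun_prop) (by fun_prop))
      exact (((h1.inner ℝ h1).mul (h2.inner ℝ h2)).add ((contDiff_const.mul h3).mul (h2.inner ℝ h1))).add (h3.pow 2)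
    refine contDiffAt_integral_param (K := tsupport ψ ×ˢ Metric.closedBall 0 R) (O := {q : E n × (E n × E n) | 0 < kap R q.1 q.2.1 q.2.2})
      (k := fun q : E n × (E n × E n) => (kap R q.1 q.2.1 q.2.2 ^ m)⁻¹)
      ?_ (hc.isCompact.prod (isCompact_closedBall _ _)) ?_ (isOpen_lt continuous_const hkc.continuous) ?_ ?_
    · exact (Integrable.mul_prod (hψ.continuous.integrable_of_hasCompactSupport hc) ((integrable_inv_sqrt hR).const_mul _)).locallyIntegrable
    · rintro ⟨y, w⟩ h
      simp only [mem_prod, not_and_or, mem_closedBall_zero_iff, not_le] at h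
      rcases h with h | h
      · simp [image_eq_zero_of_notMem_tsupport h]
      · simp only
        rw [Real.sqrt_eq_zero_of_nonpos (by nlinarith)]; simp
    · exact ContDiffOn.inv (hkc.pow m).contDiffOn fun q hq => pow_ne_zero _ (ne_of_gt hq)
    · rintro ⟨y, w⟩ ⟨hy, hw⟩
      exact kap_pos hR (by simpa using hx) (by simpa using hs hy) (by simpa using hw)
  exact contDiffOn_const.mul (h1.contDiffOn.sub h2)

/-- Within distance one the density is bounded by M and the kernel is integrable; beyond it the
kernel is at most one and the total mass suffices. -/
theorem exists_pot_le {m n : ℕ} [NeZero n] (hn : n = 2 * m + 1) {ψ : E n → ℝ} (hψ : Measurable ψ) (hi : Integrable ψ) {M : ℝ}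
    (hM : ∀ x, ψ x ≤ M) : ∃ B : ℝ≥0, ∀ x, pot m (volume.withDensity fun z => ENNReal.ofReal (ψ z)) x ≤ B := by
  set I := ∫⁻ y in Metric.ball (0 : E n) 1, ENNReal.ofReal ((‖y‖ ^ (2 * m))⁻¹) with hI
  have hIfin : I < ⊤ := by
    have h := ((locallyIntegrable_riesz (n := n) hn).integrableOn_isCompact (isCompact_closedBall 0 1)).mono_set Metric.ball_subset_closedBall
    exact (hasFiniteIntegral_iff_ofReal (Eventually.of_forall fun y => by positivity)).1 h.2
  have hfin : ENNReal.ofReal M * I + ∫⁻ y, ENNReal.ofReal (ψ y) < ⊤ := by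
    refine ENNReal.add_lt_top.2 ⟨ENNReal.mul_lt_top ENNReal.ofReal_lt_top hIfin, ?_⟩
    exact hi.lintegral_lt_top
  refine ⟨(ENNReal.ofReal M * I + ∫⁻ y, ENNReal.ofReal (ψ y)).toNNReal, fun x => ?_⟩
  rw [ENNReal.coe_toNNReal hfin.ne, pot_withDensity hψ]
  have h1 : I = ∫⁻ y, (Metric.ball (0 : E n) 1).indicator (fun y => ENNReal.ofReal ((‖y‖ ^ (2 * m))⁻¹)) (x - y) := by
    rw [hI, ← lintegral_indicator measurableSet_ball, lintegral_sub_left_eq_self]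
  have h2 : Measurable fun y => (Metric.ball (0 : E n) 1).indicator (fun y => ENNReal.ofReal ((‖y‖ ^ (2 * m))⁻¹)) (x - y) :=
    Measurable.comp (Measurable.indicator (by fun_prop) measurableSet_ball) (by fun_prop)
  rw [h1, ← lintegral_const_mul _ h2, ← lintegral_add_left (h2.const_mul _)]
  refine lintegral_mono fun y => ?_
  simp only
  by_cases hy : x - y ∈ Metric.ball (0 : E n) 1
  · rw [indicator_of_mem hy]
    refine le_add_right ?_
    gcongr
    exact hM y
  · rw [indicator_of_notMem hy, mul_zero, zero_add]
    rw [mem_ball_zero_iff, not_lt] at hy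
    refine mul_le_of_le_one_right' ?_
    rw [ENNReal.ofReal_le_one]
    exact inv_le_one_of_one_le₀ (one_le_pow₀ hy)

theorem measurable_greenRatio {n : ℕ} [NeZero n] (R : ℝ) (x : E n) : Measurable (greenRatio R x) := by
  unfold greenRatio
  have : Measurable (missing n) := Monotone.measurable fun a b h => missing_mono h
  exact (this.comp (Measurable.div (by fun_prop) (by fun_prop))).div_const _

theorem pot_balayage_le {m n : ℕ} [NeZero n] (hn : n = 2 * m + 1) {R : ℝ} (hR : 0 < R) {ψ : E n → ℝ} (hψ : Measurable ψ)
    (hs : ∀ y, R ≤ ‖y‖ → ψ y = 0) (x : E n) :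
    pot m (balayage m R ψ) x ≤ pot m (volume.withDensity fun z => ENNReal.ofReal (ψ z)) x := by
  rw [pot_balayage hn hR hψ hs, pot_withDensity hψ]
  refine lintegral_mono fun y => ?_
  have := greenRatio_nonneg R x y
  gcongr
  exact mul_le_of_le_one_right (by positivity) (by linarith)

/-- Hypotheses on the right-hand side of the Dirichlet problem. -/
structure IsDensity {n : ℕ} (R : ℝ) (ψ : E n → ℝ) : Prop where
  smooth : ContDiff ℝ ∞ ψ
  nonneg : ∀ x, 0 ≤ ψ x
  compact : HasCompactSupport ψ
  supp : tsupport ψ ⊆ Metric.ball 0 R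

namespace IsDensity

variable {n : ℕ} {R : ℝ} {ψ : E n → ℝ}

theorem measurable (h : IsDensity R ψ) : Measurable ψ := h.smooth.continuous.measurable

theorem integrable (h : IsDensity R ψ) : Integrable ψ := h.smooth.continuous.integrable_of_hasCompactSupport h.compact

theorem eq_zero (h : IsDensity R ψ) (y : E n) (hy : R ≤ ‖y‖) : ψ y = 0 :=
  image_eq_zero_of_notMem_tsupport fun hm => by
    have := h.supp hm
    rw [mem_ball_zero_iff] at this; linarith

theorem exists_pot_le [NeZero n] {m : ℕ} (hn : n = 2 * m + 1) (h : IsDensity R ψ) :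
    ∃ B : ℝ≥0, ∀ x, pot m (volume.withDensity fun z => ENNReal.ofReal (ψ z)) x ≤ B := by
  obtain ⟨M, hM⟩ := h.compact.exists_bound_of_continuous h.smooth.continuous
  exact FracBM.exists_pot_le hn h.measurable h.integrable fun x => (le_abs_self _).trans (hM x)

theorem integrable_riesz [NeZero n] {m : ℕ} (hn : n = 2 * m + 1) (h : IsDensity R ψ) (x : E n) :
    Integrable fun y => ψ y * (‖x - y‖ ^ (2 * m))⁻¹ := by
  obtain ⟨B, hB⟩ := h.exists_pot_le hn
  have hm := h.measurable
  refine ⟨by fun_prop, ?_⟩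
  rw [hasFiniteIntegral_iff_ofReal (Eventually.of_forall fun y => mul_nonneg (h.nonneg y) (by positivity))]
  refine lt_of_eq_of_lt ?_ ((hB x).trans_lt ENNReal.coe_lt_top)
  rw [pot_withDensity hm]
  exact lintegral_congr fun y => ENNReal.ofReal_mul (h.nonneg y)

theorem integrable_green [NeZero n] {m : ℕ} (hn : n = 2 * m + 1) (h : IsDensity R ψ) (x : E n) :
    Integrable fun y => ψ y * ((‖x - y‖ ^ (2 * m))⁻¹ * greenRatio R x y) := by
  have hm := h.measurable
  have hg := measurable_greenRatio R x
  refine (h.integrable_riesz hn x).mono' (by fun_prop) (Eventually.of_forall fun y => ?_)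
  have h1 := greenRatio_nonneg R x y
  have h2 := greenRatio_le_one R x y
  have h3 := h.nonneg y
  rw [Real.norm_of_nonneg (by positivity)]
  gcongr
  exact mul_le_of_le_one_right (by positivity) h2

theorem greenPot_eq [NeZero n] {m : ℕ} (hn : n = 2 * m + 1) (hR : 0 < R) (h : IsDensity R ψ) (x : E n) :
    greenPot m R ψ x = rieszConst n * ∫ y, ψ y * ((‖x - y‖ ^ (2 * m))⁻¹ * greenRatio R x y) := by
  have hm := h.measurable
  have hg := measurable_greenRatio R x
  rw [greenPot, toReal_pot_withDensity h.measurable h.nonneg, pot_balayage hn hR h.measurable h.eq_zero]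
  have h1 : (∫⁻ y, ENNReal.ofReal (ψ y) * ENNReal.ofReal ((‖x - y‖ ^ (2 * m))⁻¹ * (1 - greenRatio R x y))).toReal =
      ∫ y, ψ y * ((‖x - y‖ ^ (2 * m))⁻¹ * (1 - greenRatio R x y)) := by
    rw [integral_eq_lintegral_of_nonneg_ae (Eventually.of_forall fun y => mul_nonneg (h.nonneg y) (mul_nonneg (by positivity) (by
      linarith [greenRatio_le_one R x y]))) (by fun_prop)]
    congr 1
    exact lintegral_congr fun y => (ENNReal.ofReal_mul (h.nonneg y)).symm
  have h2 : ∀ y, ψ y * ((‖x - y‖ ^ (2 * m))⁻¹ * (1 - greenRatio R x y)) =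
    ψ y * (‖x - y‖ ^ (2 * m))⁻¹ - ψ y * ((‖x - y‖ ^ (2 * m))⁻¹ * greenRatio R x y) := fun y => by ring
  rw [h1]
  simp_rw [h2]
  rw [integral_sub (h.integrable_riesz hn x) (h.integrable_green hn x)]
  ring

theorem greenPot_nonneg [NeZero n] {m : ℕ} (hn : n = 2 * m + 1) (hm : m ≠ 0) (hR : 0 < R) (h : IsDensity R ψ) (x : E n) :
    0 ≤ greenPot m R ψ x := by
  rw [h.greenPot_eq hn hR]
  refine mul_nonneg (rieszConst_pos hn hm).le (integral_nonneg fun y => ?_)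
  exact mul_nonneg (h.nonneg y) (mul_nonneg (by positivity) (greenRatio_nonneg _ _ _))

theorem greenPot_le [NeZero n] {m : ℕ} (hn : n = 2 * m + 1) (hm : m ≠ 0) (h : IsDensity R ψ) (x : E n) :
    greenPot m R ψ x ≤ rieszConst n * ∫ y, ψ y * (‖x - y‖ ^ (2 * m))⁻¹ := by
  rw [greenPot, toReal_pot_withDensity h.measurable h.nonneg]
  refine mul_le_mul_of_nonneg_left ?_ (rieszConst_pos hn hm).le
  linarith [ENNReal.toReal_nonneg (a := pot m (balayage m R ψ) x)]

theorem greenPot_eq_zero [NeZero n] {m : ℕ} (hn : n = 2 * m + 1) (hR : 0 < R) (h : IsDensity R ψ) (x : E n) (hx : R ≤ ‖x‖) :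
    greenPot m R ψ x = 0 := by
  rw [h.greenPot_eq hn hR]
  simp [greenRatio_of_le hR hx]

theorem exists_greenPot_le [NeZero n] {m : ℕ} (hn : n = 2 * m + 1) (hm : m ≠ 0) (h : IsDensity R ψ) :
    ∃ B : ℝ, ∀ x, greenPot m R ψ x ≤ B := by
  obtain ⟨B, hB⟩ := h.exists_pot_le hn
  refine ⟨rieszConst n * B, fun x => (h.greenPot_le hn hm x).trans ?_⟩
  refine mul_le_mul_of_nonneg_left ?_ (rieszConst_pos hn hm).le
  rw [← toReal_pot_withDensity h.measurable h.nonneg]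
  exact ENNReal.toReal_mono ENNReal.coe_ne_top (hB x)

/-- The swept mass lies outside the open ball, at distance at least R - |x| from x, so only the
density ψ contributes. -/
theorem halfLaplacian_greenPot [NeZero n] {m : ℕ} (hn : n = 2 * m + 1) (hm : m ≠ 0) (hR : 0 < R) (h : IsDensity R ψ) {x : E n} (hx : ‖x‖ < R) :
    halfLaplacian (greenPot m R ψ) x = ψ x := by
  obtain ⟨B, hB⟩ := h.exists_pot_le hn
  have : IsFiniteMeasure (balayage m R ψ) := ⟨by
    rw [balayage_univ hn hR h.measurable h.eq_zero]
    exact h.integrable.lintegral_lt_top⟩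
  refine halfLaplacian_potential hn hm h.integrable h.nonneg h.measurable h.smooth.continuous.continuousAt (balayage m R ψ)
    (fun z => (pot_balayage_le hn hR h.measurable h.eq_zero z).trans (hB z)) hB (fun z => rfl) ?_ (sub_pos.2 hx) ?_
  · have := (contDiffOn_greenPot hn hR h.smooth h.nonneg h.compact h.supp).contDiffAt (Metric.isOpen_ball.mem_nhds (by simpa using hx))
    exact contDiffAt_infty.1 this 2
  · have hms : MeasurableSet {z : E n | R - ‖x‖ ≤ ‖x - z‖} := measurableSet_le (by fun_prop) (by fun_prop)
    rw [ae_iff]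
    have h1 := lintegral_balayage m R h.measurable (f := {z : E n | ¬ (R - ‖x‖ ≤ ‖x - z‖)}.indicator 1) (measurable_one.indicator hms.compl)
    rw [lintegral_indicator_one (show MeasurableSet {z : E n | ¬ (R - ‖x‖ ≤ ‖x - z‖)} from hms.compl)] at h1
    rw [h1, ← lintegral_zero (μ := (volume : Measure (E n)))]
    refine lintegral_congr fun y => ?_
    rcases le_or_gt R ‖y‖ with hy | hy
    · simp [h.eq_zero y hy]
    have h2 : ∫⁻ w, ENNReal.ofReal ((‖w - y‖ ^ (2 * m))⁻¹) * ENNReal.ofReal (√(R ^ 2 - ‖w‖ ^ 2))⁻¹ *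
        {z : E n | ¬ (R - ‖x‖ ≤ ‖x - z‖)}.indicator 1 (reflPt R y w) = 0 := by
      rw [← lintegral_zero (μ := (volume : Measure (E n)))]
      refine lintegral_congr_ae ?_
      filter_upwards [Measure.ae_ne volume y] with w hw
      rcases le_or_gt ‖w‖ R with hwR | hwR
      · have h3 := le_norm_reflPt hR hw hy hwR
        rw [indicator_of_notMem, mul_zero]
        simp only [mem_ofPred_eq, not_not]
        have := norm_sub_norm_le (reflPt R y w) x
        rw [norm_sub_rev] at this
        linarith
      · rw [Real.sqrt_eq_zero_of_nonpos (by nlinarith)]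
        simp
    rw [h2]; simp

end IsDensity

/-! ### Hölder continuity of the Green potential across the boundary. -/

theorem abs_inv_pow_sub_le {u v δ : ℝ} (hδ : 0 < δ) (hu : δ ≤ u) (hv : δ ≤ v) (k : ℕ) :
    |(u ^ k)⁻¹ - (v ^ k)⁻¹| ≤ k * |u - v| * (δ ^ (k + 1))⁻¹ := by
  wlog huv : u ≤ v generalizing u v
  · rw [abs_sub_comm, abs_sub_comm u]
    exact this hv hu (le_of_not_ge huv)
  have hu0 := hδ.trans_le hu
  have h1 := inv_pow_sub_le hu0 (sub_nonneg.2 huv) k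
  have h2 := inv_pow_sub_nonneg hu0 (sub_nonneg.2 huv) k
  rw [sub_add_cancel] at h1 h2
  rw [abs_of_nonneg h2, abs_sub_comm, abs_of_nonneg (sub_nonneg.2 huv)]
  refine h1.trans ?_
  gcongr

theorem abs_greenRatio_arg_sub_le {n : ℕ} {R δ : ℝ} (hR : 0 < R) (hδ : 0 < δ) {x x' y : E n} (hy : ‖y‖ ≤ R)
    (hx : δ ≤ ‖x - y‖) (hx' : δ ≤ ‖x' - y‖) :
    |max (R ^ 2 - ‖x‖ ^ 2) 0 * (R ^ 2 - ‖y‖ ^ 2) / (R ^ 2 * ‖x - y‖ ^ 2) -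
      max (R ^ 2 - ‖x'‖ ^ 2) 0 * (R ^ 2 - ‖y‖ ^ 2) / (R ^ 2 * ‖x' - y‖ ^ 2)| ≤
    (2 * R * (δ ^ 2)⁻¹ + 2 * R ^ 2 * (δ ^ 3)⁻¹) * ‖x - x'‖ := by
  -- In this form the truncated defining function is visibly Lipschitz with constant 2R, on both
  -- sides of the sphere at once.
  have hP : ∀ z : E n, max (R ^ 2 - ‖z‖ ^ 2) 0 = R ^ 2 - min ‖z‖ R ^ 2 := by
    intro z
    rcases le_total ‖z‖ R with h | h
    · rw [min_eq_left h, max_eq_left]; nlinarith [norm_nonneg z]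
    · rw [min_eq_right h, max_eq_right] <;> nlinarith
  have hmin : |min ‖x‖ R - min ‖x'‖ R| ≤ ‖x - x'‖ :=
    (abs_min_sub_min_le_max _ _ _ _).trans (by simpa using abs_norm_sub_norm_le x x')
  have h1 : |max (R ^ 2 - ‖x‖ ^ 2) 0 - max (R ^ 2 - ‖x'‖ ^ 2) 0| ≤ 2 * R * ‖x - x'‖ := by
    rw [hP, hP, show R ^ 2 - min ‖x‖ R ^ 2 - (R ^ 2 - min ‖x'‖ R ^ 2) = -((min ‖x‖ R + min ‖x'‖ R) * (min ‖x‖ R - min ‖x'‖ R)) by ring,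
      abs_neg, abs_mul]
    have : |min ‖x‖ R + min ‖x'‖ R| ≤ 2 * R := by
      have a1 := min_le_right ‖x‖ R
      have a2 := min_le_right ‖x'‖ R
      have a3 : 0 ≤ min ‖x‖ R := le_min (norm_nonneg _) hR.le
      have a4 : 0 ≤ min ‖x'‖ R := le_min (norm_nonneg _) hR.le
      rw [abs_of_nonneg (by positivity)]; linarith
    gcongr
  have h2 := abs_inv_pow_sub_le hδ hx hx' 2
  have h3 : |‖x - y‖ - ‖x' - y‖| ≤ ‖x - x'‖ := by simpa using abs_norm_sub_norm_le (x - y) (x' - y)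
  have h4 : 0 ≤ max (R ^ 2 - ‖x'‖ ^ 2) 0 := le_max_right _ _
  have h5 : max (R ^ 2 - ‖x'‖ ^ 2) 0 ≤ R ^ 2 := max_le (by nlinarith [norm_nonneg x']) (by positivity)
  have h6 : 0 ≤ (R ^ 2 - ‖y‖ ^ 2) / R ^ 2 := div_nonneg (by nlinarith [norm_nonneg y]) (by positivity)
  have h7 : (R ^ 2 - ‖y‖ ^ 2) / R ^ 2 ≤ 1 := by rw [div_le_one (by positivity)]; nlinarith [norm_nonneg y]
  have hu0 : 0 < ‖x - y‖ := hδ.trans_le hx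
  have hv0 : 0 < ‖x' - y‖ := hδ.trans_le hx'
  have h8 : (‖x - y‖ ^ 2)⁻¹ ≤ (δ ^ 2)⁻¹ := by gcongr
  generalize max (R ^ 2 - ‖x‖ ^ 2) 0 = P at *
  generalize max (R ^ 2 - ‖x'‖ ^ 2) 0 = P' at *
  have e : P * (R ^ 2 - ‖y‖ ^ 2) / (R ^ 2 * ‖x - y‖ ^ 2) - P' * (R ^ 2 - ‖y‖ ^ 2) / (R ^ 2 * ‖x' - y‖ ^ 2) =
      (R ^ 2 - ‖y‖ ^ 2) / R ^ 2 * ((P - P') * (‖x - y‖ ^ 2)⁻¹ + P' * ((‖x - y‖ ^ 2)⁻¹ - (‖x' - y‖ ^ 2)⁻¹)) := by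
    field_simp; ring
  rw [e, abs_mul, abs_of_nonneg h6]
  refine (mul_le_of_le_one_left (abs_nonneg _) h7).trans ((abs_add_le _ _).trans ?_)
  rw [abs_mul, abs_mul, abs_of_nonneg h4, abs_of_nonneg (by positivity : 0 ≤ (‖x - y‖ ^ 2)⁻¹)]
  calc |P - P'| * (‖x - y‖ ^ 2)⁻¹ + P' * |(‖x - y‖ ^ 2)⁻¹ - (‖x' - y‖ ^ 2)⁻¹| ≤
      2 * R * ‖x - x'‖ * (δ ^ 2)⁻¹ + R ^ 2 * ((2 : ℕ) * ‖x - x'‖ * (δ ^ (2 + 1))⁻¹) := by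
        gcongr
        refine h2.trans ?_
        gcongr
    _ = _ := by push_cast; ring

/-- Away from the pole the power and the argument of `missing` are Lipschitz in x. The exponent 1/2
comes only from `exists_missing_holder`. -/
theorem exists_green_holder {n : ℕ} [NeZero n] {R δ : ℝ} (hR : 0 < R) (hδ : 0 < δ) (k : ℕ) : ∃ C : ℝ, 0 ≤ C ∧
    ∀ x x' y : E n, ‖y‖ ≤ R → δ ≤ ‖x - y‖ → δ ≤ ‖x' - y‖ → ‖x - x'‖ ≤ 1 →
      |(‖x - y‖ ^ k)⁻¹ * greenRatio R x y - (‖x' - y‖ ^ k)⁻¹ * greenRatio R x' y| ≤ C * √‖x - x'‖ := by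
  obtain ⟨C, hC, hh⟩ := exists_missing_holder n
  have hσ := sphArea_pos n
  set L := 2 * R * (δ ^ 2)⁻¹ + 2 * R ^ 2 * (δ ^ 3)⁻¹ with hL
  have hL0 : 0 ≤ L := by positivity
  refine ⟨k * (δ ^ (k + 1))⁻¹ + (δ ^ k)⁻¹ * (C * √L / sphArea n), by positivity, fun x x' y hy hx hx' hxx => ?_⟩
  have h1 := abs_inv_pow_sub_le hδ hx hx' k
  have h3 : |‖x - y‖ - ‖x' - y‖| ≤ ‖x - x'‖ := by simpa using abs_norm_sub_norm_le (x - y) (x' - y)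
  have h4 : ‖x - x'‖ ≤ √‖x - x'‖ := Real.le_sqrt_of_sq_le (by nlinarith [norm_nonneg (x - x')])
  have hq : ∀ z : E n, 0 ≤ max (R ^ 2 - ‖z‖ ^ 2) 0 * (R ^ 2 - ‖y‖ ^ 2) / (R ^ 2 * ‖z - y‖ ^ 2) := fun z =>
    div_nonneg (mul_nonneg (le_max_right _ _) (by nlinarith [norm_nonneg y])) (by positivity)
  have h5 : |greenRatio R x y - greenRatio R x' y| ≤ C * √L / sphArea n * √‖x - x'‖ := by
    unfold greenRatio
    rw [← sub_div, abs_div, abs_of_pos hσ, div_mul_eq_mul_div, div_le_div_iff_of_pos_right hσ]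
    refine (hh _ _ (hq x) (hq x')).trans ?_
    rw [mul_assoc, ← Real.sqrt_mul hL0]
    exact mul_le_mul_of_nonneg_left (Real.sqrt_le_sqrt (abs_greenRatio_arg_sub_le hR hδ hy hx hx')) hC
  have h6 := greenRatio_nonneg R x y
  have h7 := greenRatio_le_one R x y
  have hv0 : 0 < ‖x' - y‖ := hδ.trans_le hx'
  rw [show (‖x - y‖ ^ k)⁻¹ * greenRatio R x y - (‖x' - y‖ ^ k)⁻¹ * greenRatio R x' y =
    ((‖x - y‖ ^ k)⁻¹ - (‖x' - y‖ ^ k)⁻¹) * greenRatio R x y + (‖x' - y‖ ^ k)⁻¹ * (greenRatio R x y - greenRatio R x' y) by ring]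
  refine (abs_add_le _ _).trans ?_
  rw [abs_mul, abs_mul, abs_of_nonneg h6, abs_of_pos (by positivity : 0 < (‖x' - y‖ ^ k)⁻¹), add_mul]
  refine add_le_add ?_ ?_
  · refine (mul_le_of_le_one_right (abs_nonneg _) h7).trans (h1.trans ?_)
    rw [mul_right_comm]
    gcongr
    exact h3.trans h4
  · rw [mul_assoc]
    gcongr

theorem holderWith_half_of_abs_sub_le {n : ℕ} {f : E n → ℝ} {C : ℝ} (h : ∀ x y, |f x - f y| ≤ C * √‖x - y‖) :
    ∃ K : ℝ≥0, HolderWith K (1 / 2) f := by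
  refine ⟨C.toNNReal, fun x y => ?_⟩
  have h1 : ((1 / 2 : ℝ≥0) : ℝ) = 1 / 2 := by norm_num
  rw [edist_dist, edist_dist, h1, ENNReal.ofReal_rpow_of_nonneg dist_nonneg (by norm_num), ← Real.sqrt_eq_rpow, dist_eq_norm, dist_eq_norm,
    ← ENNReal.ofReal_coe_nnreal, ← ENNReal.ofReal_mul (by positivity), Real.norm_eq_abs]
  refine ENNReal.ofReal_le_ofReal ((h x y).trans ?_)
  gcongr
  exact Real.le_coe_toNNReal C

namespace IsDensity

variable {n : ℕ} {R : ℝ} {ψ : E n → ℝ}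

theorem exists_support_radius (hR : 0 < R) (h : IsDensity R ψ) : ∃ r, 0 ≤ r ∧ r < R ∧ ∀ y, r < ‖y‖ → ψ y = 0 := by
  obtain ⟨r, hr, hsub⟩ : ∃ r, r < R ∧ tsupport ψ ⊆ Metric.closedBall 0 r := by
    rcases (tsupport ψ).eq_empty_or_nonempty with he | hne
    · exact ⟨0, hR, by simp [he]⟩
    · obtain ⟨z, hz, hmax⟩ := h.compact.isCompact.exists_isMaxOn hne continuous_norm.continuousOn
      exact ⟨‖z‖, by simpa using h.supp hz, fun y hy => by simpa using hmax hy⟩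
  refine ⟨max r 0, le_max_right _ _, max_lt hr hR, fun y hy => image_eq_zero_of_notMem_tsupport fun hm => ?_⟩
  have h1 := hsub hm
  rw [mem_closedBall_zero_iff] at h1
  linarith [le_max_left r 0]

theorem exists_holderWith [NeZero n] {m : ℕ} (hn : n = 2 * m + 1) (hm : m ≠ 0) (hR : 0 < R) (h : IsDensity R ψ) :
    ∃ K : ℝ≥0, HolderWith K (1 / 2) (greenPot m R ψ) := by
  obtain ⟨r, hr0, hr, hs⟩ := h.exists_support_radius hR
  obtain ⟨B, hB⟩ := h.exists_greenPot_le hn hm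
  have hB0 : 0 ≤ B := (h.greenPot_nonneg hn hm hR 0).trans (hB 0)
  -- Pairs at distance at least δ are handled by boundedness. Otherwise, if |x| ≤ r + 2δ both points
  -- lie in the closed ball of radius r + 3δ < R, where the gradient is bounded. If |x| > r + 2δ
  -- both stay at distance at least δ from {‖y‖ ≤ r}, outside which ψ vanishes.
  set δ := min ((R - r) / 4) 1 with hδ
  have hδ0 : 0 < δ := lt_min (by linarith) one_pos
  have hδ1 : δ ≤ 1 := min_le_right _ _
  have hδ2 : 4 * δ ≤ R - r := by have := min_le_left ((R - r) / 4) 1; linarith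
  have hrc := rieszConst_pos hn hm
  obtain ⟨C, hC, hF⟩ := exists_green_holder (n := n) hR hδ0 (2 * m)
  have hsm := contDiffOn_greenPot hn hR h.smooth h.nonneg h.compact h.supp
  obtain ⟨L, hL⟩ : ∃ L : ℝ, ∀ x ∈ Metric.closedBall (0 : E n) (r + 3 * δ), ‖fderiv ℝ (greenPot m R ψ) x‖ ≤ L := by
    refine (isCompact_closedBall _ _).exists_bound_of_continuousOn ?_
    refine (hsm.continuousOn_fderiv_of_isOpen Metric.isOpen_ball (by simp)).mono ?_
    exact Metric.closedBall_subset_ball (by linarith)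
  have hL0 : 0 ≤ L := (norm_nonneg _).trans (hL 0 (by simp; positivity))
  set I := ∫ y, ψ y with hI
  have hI0 : 0 ≤ I := integral_nonneg h.nonneg
  have hδs : 0 < √δ := Real.sqrt_pos.2 hδ0
  refine holderWith_half_of_abs_sub_le (C := B / √δ + L + rieszConst n * (C * I)) fun x x' => ?_
  have c1 : 0 ≤ B / √δ * √‖x - x'‖ := by positivity
  have c2 : 0 ≤ L * √‖x - x'‖ := by positivity
  have c3 : 0 ≤ rieszConst n * (C * I) * √‖x - x'‖ := by positivity
  rw [add_mul, add_mul]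
  rcases le_or_gt δ ‖x - x'‖ with hd | hd
  · have h1 : |greenPot m R ψ x - greenPot m R ψ x'| ≤ B := by
      have a1 := h.greenPot_nonneg hn hm hR x
      have a2 := h.greenPot_nonneg hn hm hR x'
      have a3 := hB x
      have a4 := hB x'
      rw [abs_le]; constructor <;> linarith
    have h2 : B ≤ B / √δ * √‖x - x'‖ := by
      rw [div_mul_eq_mul_div, le_div_iff₀ hδs]
      exact mul_le_mul_of_nonneg_left (Real.sqrt_le_sqrt hd) hB0
    linarith
  have h4 : ‖x - x'‖ ≤ √‖x - x'‖ := Real.le_sqrt_of_sq_le (by nlinarith [norm_nonneg (x - x')])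
  have htri := abs_le.1 (abs_norm_sub_norm_le x x')
  rcases le_or_gt ‖x‖ (r + 2 * δ) with hx | hx
  · have hx2 : x' ∈ Metric.closedBall (0 : E n) (r + 3 * δ) := by
      rw [mem_closedBall_zero_iff]; linarith [htri.1]
    have hx1 : x ∈ Metric.closedBall (0 : E n) (r + 3 * δ) := by
      rw [mem_closedBall_zero_iff]; linarith
    have h1 := (convex_closedBall (0 : E n) (r + 3 * δ)).norm_image_sub_le_of_norm_fderiv_le (𝕜 := ℝ) (f := greenPot m R ψ) (fun z hz => ?_) hL hx2 hx1
    · rw [Real.norm_eq_abs] at h1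
      have := mul_le_mul_of_nonneg_left h4 hL0
      linarith
    · refine (hsm.contDiffAt (Metric.isOpen_ball.mem_nhds ?_)).differentiableAt (by simp)
      exact Metric.closedBall_subset_ball (by linarith) hz
  · have key : |greenPot m R ψ x - greenPot m R ψ x'| ≤ rieszConst n * (C * I) * √‖x - x'‖ := by
      rw [h.greenPot_eq hn hR, h.greenPot_eq hn hR, ← mul_sub, ← integral_sub (h.integrable_green hn x) (h.integrable_green hn x'),
        abs_mul, abs_of_pos hrc, mul_assoc]
      refine mul_le_mul_of_nonneg_left ?_ hrc.le
      rw [hI, mul_comm C, mul_assoc, ← integral_mul_const, ← Real.norm_eq_abs]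
      refine norm_integral_le_of_norm_le (h.integrable.mul_const _) (Eventually.of_forall fun y => ?_)
      rcases le_or_gt ‖y‖ r with hy | hy
      · rw [← mul_sub, norm_mul, Real.norm_of_nonneg (h.nonneg y)]
        refine mul_le_mul_of_nonneg_left ?_ (h.nonneg y)
        refine hF x x' y (hy.trans hr.le) ?_ ?_ (hd.le.trans hδ1)
        · linarith [norm_sub_norm_le x y]
        · linarith [norm_sub_norm_le x' y, htri.2]
      · simp [hs y hy]
    linarith

theorem isTest₁_greenPot [NeZero n] {m : ℕ} (hn : n = 2 * m + 1) (hm : m ≠ 0) (hR : 0 < R) (h : IsDensity R ψ) :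
    IsTest₁ (Metric.ball 0 R) (greenPot m R ψ) :=
  ⟨contDiffOn_greenPot hn hR h.smooth h.nonneg h.compact h.supp, h.exists_holderWith hn hm hR,
    fun x hx => h.greenPot_eq_zero hn hR x (by simpa using hx), ψ, h.smooth, h.compact, h.supp,
    fun x hx => h.halfLaplacian_greenPot hn hm hR (by simpa using hx)⟩

end IsDensity

/-! ### Laplacians of radial functions and the maximum principle. -/

section Laplacian

open InnerProductSpace Laplacian

theorem laplacian_eq_sum_fderiv {n : ℕ} (f : E n → ℝ) (x : E n) :
    laplacian f x = ∑ i, fderiv ℝ (fderiv ℝ f) x (EuclideanSpace.basisFun (Fin n) ℝ i) (EuclideanSpace.basisFun (Fin n) ℝ i) := by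
  rw [laplacian_eq_iteratedFDeriv_orthonormalBasis f (EuclideanSpace.basisFun (Fin n) ℝ)]
  simp [iteratedFDeriv_two_apply]

/-- Along the line in direction e, a negative second derivative would make the minimum a local
maximum too. The restriction would then be locally constant, with second derivative zero. -/
theorem fderiv_fderiv_nonneg_of_isLocalMin {V : Type*} [NormedAddCommGroup V] [NormedSpace ℝ V] {f : V → ℝ} {x : V}
    (hf : ContDiffAt ℝ 2 f x) (h : IsLocalMin f x) (e : V) : 0 ≤ fderiv ℝ (fderiv ℝ f) x e e := by
  by_contra! hneg
  have hline : ∀ s : ℝ, HasDerivAt (fun s : ℝ => x + s • e) e s := fun s => by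
    simpa using ((hasDerivAt_id s).smul_const e).const_add x
  have hcont : ContinuousAt (fun s : ℝ => x + s • e) 0 := (hline 0).continuousAt
  have ht : Tendsto (fun s : ℝ => x + s • e) (𝓝 0) (𝓝 x) := by simpa [ContinuousAt] using hcont
  have h1 : ∀ᶠ s : ℝ in 𝓝 0, deriv (fun s : ℝ => f (x + s • e)) s = fderiv ℝ f (x + s • e) e := by
    have : ∀ᶠ y in 𝓝 x, ContDiffAt ℝ 2 f y := hf.eventually (by simp)
    filter_upwards [ht.eventually this] with s hs
    exact HasDerivAt.deriv (HasFDerivAt.comp_hasDerivAt s (l := f) (hs.differentiableAt (by simp)).hasFDerivAt (hline s))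
  have h2 : HasDerivAt (fun s : ℝ => fderiv ℝ f (x + s • e) e) (fderiv ℝ (fderiv ℝ f) x e e) 0 := by
    have hd : DifferentiableAt ℝ (fderiv ℝ f) (x + (0 : ℝ) • e) := by
      rw [zero_smul, add_zero]
      exact (hf.fderiv_right (m := 1) (by norm_num)).differentiableAt (by simp)
    have h0 := HasFDerivAt.comp_hasDerivAt (0 : ℝ) (l := fderiv ℝ f) hd.hasFDerivAt (hline 0)
    rw [zero_smul, add_zero] at h0
    exact (ContinuousLinearMap.apply ℝ ℝ e).hasFDerivAt.comp_hasDerivAt (0 : ℝ) h0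
  have h3 : deriv (deriv fun s : ℝ => f (x + s • e)) 0 = fderiv ℝ (fderiv ℝ f) x e e :=
    (h2.congr_of_eventuallyEq h1).deriv
  have h4 : IsLocalMin (fun s : ℝ => f (x + s • e)) 0 := by
    have h5 := ht.eventually h
    filter_upwards [h5] with s hs
    simpa using hs
  have h6 : IsLocalMax (fun s : ℝ => f (x + s • e)) 0 :=
    isLocalMax_of_deriv_deriv_neg (h3.trans_lt hneg) h4.deriv_eq_zero (hf.continuousAt.comp_of_eq hcont (by simp))
  have h8 : (fun s : ℝ => f (x + s • e)) =ᶠ[𝓝 0] fun _ => f (x + (0 : ℝ) • e) := by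
    filter_upwards [h4, h6] with s a b
    exact le_antisymm b a
  have h9 : deriv (fun s : ℝ => f (x + s • e)) =ᶠ[𝓝 0] fun _ => 0 := by
    simpa using h8.deriv
  rw [h9.deriv_eq] at h3
  simp at h3
  linarith

theorem laplacian_nonneg_of_isLocalMin {n : ℕ} {f : E n → ℝ} {x : E n} (hf : ContDiffAt ℝ 2 f x) (h : IsLocalMin f x) :
    0 ≤ laplacian f x := by
  rw [laplacian_eq_sum_fderiv]
  exact Finset.sum_nonneg fun i _ => fderiv_fderiv_nonneg_of_isLocalMin hf h _

/-- The Laplacian of a radial function `h (‖x‖ ^ 2)`. -/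
theorem laplacian_comp_norm_sq {n : ℕ} {h h' : ℝ → ℝ} {h'' : ℝ} {x : E n} (h1 : ∀ s, 0 ≤ s → HasDerivAt h (h' s) s)
    (h2 : HasDerivAt h' h'' (‖x‖ ^ 2)) :
    laplacian (fun y : E n => h (‖y‖ ^ 2)) x = 4 * ‖x‖ ^ 2 * h'' + 2 * n * h' (‖x‖ ^ 2) := by
  have hsq : ∀ y : E n, HasFDerivAt (fun y : E n => ‖y‖ ^ 2) (2 • innerSL ℝ y) y := fun y => (hasStrictFDerivAt_norm_sq y).hasFDerivAt
  have e1 : fderiv ℝ (fun y : E n => h (‖y‖ ^ 2)) = fun y => h' (‖y‖ ^ 2) • (2 • innerSL ℝ y) := by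
    funext y
    exact ((h1 _ (by positivity)).comp_hasFDerivAt y (hsq y)).fderiv
  have e2 : HasFDerivAt (fun y : E n => h' (‖y‖ ^ 2) • (2 • innerSL ℝ y : E n →L[ℝ] ℝ))
      (h' (‖x‖ ^ 2) • (2 • (innerSL ℝ : E n →L[ℝ] E n →L[ℝ] ℝ)) + (h'' • (2 • innerSL ℝ x)).smulRight (2 • innerSL ℝ x : E n →L[ℝ] ℝ)) x :=
    (h2.comp_hasFDerivAt x (hsq x)).smul ((2 • (innerSL ℝ : E n →L[ℝ] E n →L[ℝ] ℝ)).hasFDerivAt)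
  rw [laplacian_eq_sum_fderiv, e1, e2.fderiv]
  have e3 : ∀ i, inner ℝ x (EuclideanSpace.basisFun (Fin n) ℝ i) = x i := fun i => by
    rw [EuclideanSpace.basisFun_apply, EuclideanSpace.inner_single_right]; simp
  have e4 : ∀ i, inner ℝ (EuclideanSpace.basisFun (Fin n) ℝ i) (EuclideanSpace.basisFun (Fin n) ℝ i) = (1 : ℝ) := fun i => by
    rw [real_inner_self_eq_norm_sq]; simp
  simp only [add_apply, smul_apply, ContinuousLinearMap.smulRight_apply, innerSL_apply_apply, e3, nsmul_eq_mul, smul_eq_mul]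
  rw [Finset.sum_add_distrib, EuclideanSpace.norm_sq_eq, Finset.mul_sum, Finset.sum_mul, add_comm]
  congr 1
  · refine Finset.sum_congr rfl fun i _ => ?_
    rw [Real.norm_eq_abs, sq_abs]; push_cast; ring
  · refine (Finset.sum_congr rfl fun i _ => congrArg (fun z => h' (∑ i, ‖x i‖ ^ 2) * ((2 : ℕ) * z)) (e4 i)).trans ?_
    simp; ring

theorem contDiff_norm_sq' {n : ℕ} {k : WithTop ℕ∞} : ContDiff ℝ k fun x : E n => ‖x‖ ^ 2 := contDiff_norm_sq ℝ

/-- Adding ε(R² - |x|²) makes the Laplacian strictly negative without changing boundary values,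
which excludes an interior minimum; then ε → 0. -/
theorem nonneg_of_laplacian_nonpos {n : ℕ} (hn : n ≠ 0) {R : ℝ} {g : E n → ℝ} (hg : ContDiff ℝ 2 g)
    (hΔ : ∀ x, ‖x‖ < R → laplacian g x ≤ 0) (hb : ∀ x, ‖x‖ = R → 0 ≤ g x) {x : E n} (hx : ‖x‖ ≤ R) : 0 ≤ g x := by
  have hsq : ∀ y : E n, laplacian (fun y : E n => ‖y‖ ^ 2) y = 2 * n := fun y => by
    rw [laplacian_comp_norm_sq (h := fun s => s) (h' := fun _ => 1) (h'' := 0) (fun s _ => hasDerivAt_id s) (hasDerivAt_const _ _)]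
    ring
  have key : ∀ ε > 0, 0 ≤ g x + ε * (R ^ 2 - ‖x‖ ^ 2) := by
    intro ε hε
    set G : E n → ℝ := fun y => g y + ε * (R ^ 2 - ‖y‖ ^ 2) with hG
    have hGs : ContDiff ℝ 2 G := hg.add (contDiff_const.mul (contDiff_const.sub contDiff_norm_sq'))
    obtain ⟨z, hz, hmin⟩ := (isCompact_closedBall (0 : E n) R).exists_isMinOn ⟨x, by simpa using hx⟩ hGs.continuous.continuousOn
    refine le_trans ?_ (hmin (by simpa using hx : x ∈ Metric.closedBall (0 : E n) R))
    rw [mem_closedBall_zero_iff] at hz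
    rcases hz.eq_or_lt with h | h
    · simp only [hG, h, sub_self, mul_zero, add_zero]; exact hb z h
    · exfalso
      have h1 : IsLocalMin G z := hmin.isLocalMin (mem_of_superset (Metric.isOpen_ball.mem_nhds (by simpa using h)) Metric.ball_subset_closedBall)
      have h2 := laplacian_nonneg_of_isLocalMin hGs.contDiffAt h1
      have h3 : laplacian G z = laplacian g z - ε * (2 * n) := by
        have e : G = (fun y => g y + ε * R ^ 2) - ε • fun y : E n => ‖y‖ ^ 2 := by
          funext y; simp [hG]; ring
        have e' : (fun y => g y + ε * R ^ 2) = g + fun _ => ε * R ^ 2 := rfl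
        rw [e, e', ContDiffAt.laplacian_sub (f₁ := g + fun _ => ε * R ^ 2) (f₂ := ε • fun y : E n => ‖y‖ ^ 2) (hg.add contDiff_const).contDiffAt (contDiff_norm_sq'.const_smul ε).contDiffAt, laplacian_smul ε contDiff_norm_sq'.contDiffAt, hsq,
          hg.contDiffAt.laplacian_add contDiff_const.contDiffAt]
        simp
      have h4 := hΔ z h
      have h5 : (0 : ℝ) < n := by positivity
      have : 0 < ε * (2 * n) := by positivity
      linarith
  have ht : Tendsto (fun ε : ℝ => g x + ε * (R ^ 2 - ‖x‖ ^ 2)) (𝓝[>] 0) (𝓝 (g x)) := by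
    have : Continuous fun ε : ℝ => g x + ε * (R ^ 2 - ‖x‖ ^ 2) := by fun_prop
    simpa using (this.tendsto 0).mono_left nhdsWithin_le_nhds
  exact ge_of_tendsto ht (by filter_upwards [self_mem_nhdsWithin] with ε hε using key ε hε)

end Laplacian

/-! ### Polynomial solutions of the Navier problem on the ball. -/

section Polynomials

open MvPolynomial InnerProductSpace Laplacian

/-- Evaluation of a polynomial at a point of Euclidean space. -/
def evalE {n : ℕ} (p : MvPolynomial (Fin n) ℝ) (x : E n) : ℝ := eval (fun i => x i) p

theorem hasFDerivAt_evalE {n : ℕ} (p : MvPolynomial (Fin n) ℝ) (x : E n) :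
    HasFDerivAt (evalE p) (∑ i, evalE (pderiv i p) x • (EuclideanSpace.proj i : E n →L[ℝ] ℝ)) x := by
  induction p using MvPolynomial.induction_on with
  | C a =>
    have : (evalE (C a) : E n → ℝ) = fun _ => a := by funext y; simp [evalE]
    rw [this]; simpa [evalE] using hasFDerivAt_const (𝕜 := ℝ) a x
  | add p q hp hq =>
    refine (hp.add hq).congr_fderiv ?_ |>.congr_of_eventuallyEq (Eventually.of_forall fun y => by simp [evalE])
    simp [evalE, add_smul, Finset.sum_add_distrib]
  | mul_X p i hp =>
    have h1 : HasFDerivAt (fun y : E n => y i) (EuclideanSpace.proj i : E n →L[ℝ] ℝ) x := (EuclideanSpace.proj i : E n →L[ℝ] ℝ).hasFDerivAt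
    refine (hp.mul h1).congr_fderiv ?_ |>.congr_of_eventuallyEq (Eventually.of_forall fun y => by simp [evalE])
    ext v
    have h2 : ∀ j, evalE (pderiv j (p * X i)) x = x i * evalE (pderiv j p) x + evalE p x * (if i = j then 1 else 0) := by
      intro j
      rw [evalE, Derivation.leibniz, pderiv_X]
      simp only [evalE, smul_eq_mul, map_add, map_mul, eval_X, Pi.single_apply]
      split_ifs <;> simp <;> ring
    simp_rw [h2]
    simp [Finset.mul_sum, add_mul, Finset.sum_add_distrib, mul_assoc]
    ring

theorem contDiff_evalE {n : ℕ} (p : MvPolynomial (Fin n) ℝ) {k : WithTop ℕ∞} : ContDiff ℝ k (evalE p : E n → ℝ) := by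
  induction p using MvPolynomial.induction_on with
  | C a =>
    have : (evalE (C a) : E n → ℝ) = fun _ => a := by funext y; simp [evalE]
    rw [this]; exact contDiff_const
  | add p q hp hq =>
    have : (evalE (p + q) : E n → ℝ) = fun y => evalE p y + evalE q y := by funext y; simp [evalE]
    rw [this]; exact hp.add hq
  | mul_X p i hp =>
    have h1 : ContDiff ℝ k (fun y : E n => y i) := (EuclideanSpace.proj i : E n →L[ℝ] ℝ).contDiff
    have : (evalE (p * X i) : E n → ℝ) = fun y => evalE p y * y i := by funext y; simp [evalE]
    rw [this]; exact hp.mul h1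

/-- The Laplacian on polynomials. -/
def polyLap (n : ℕ) : MvPolynomial (Fin n) ℝ →ₗ[ℝ] MvPolynomial (Fin n) ℝ :=
  ∑ i, (pderiv i).toLinearMap ∘ₗ (pderiv i).toLinearMap

theorem laplacian_evalE {n : ℕ} (p : MvPolynomial (Fin n) ℝ) (x : E n) :
    laplacian (evalE p) x = evalE (polyLap n p) x := by
  have e1 : ∀ q : MvPolynomial (Fin n) ℝ, fderiv ℝ (evalE q) = fun x => ∑ i, evalE (pderiv i q) x • (EuclideanSpace.proj i : E n →L[ℝ] ℝ) :=
    fun q => funext fun x => (hasFDerivAt_evalE q x).fderiv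
  have e2 : HasFDerivAt (fun x => ∑ i, evalE (pderiv i p) x • (EuclideanSpace.proj i : E n →L[ℝ] ℝ))
      (∑ i, (fderiv ℝ (evalE (pderiv i p)) x).smulRight (EuclideanSpace.proj i : E n →L[ℝ] ℝ)) x := by
    refine HasFDerivAt.fun_sum fun i _ => ?_
    exact HasFDerivAt.smul_const (𝕜 := ℝ) (F := E n →L[ℝ] ℝ) ((hasFDerivAt_evalE (pderiv i p) x).differentiableAt.hasFDerivAt) _
  rw [laplacian_eq_sum_fderiv, e1, e2.fderiv]
  simp only [e1]
  simp [polyLap, evalE, Finset.sum_apply]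

theorem totalDegree_pderiv_le {n : ℕ} (i : Fin n) (p : MvPolynomial (Fin n) ℝ) : (pderiv i p).totalDegree ≤ p.totalDegree - 1 := by
  conv_lhs => rw [p.as_sum, map_sum]
  refine totalDegree_finsetSum_le fun s hs => ?_
  rw [pderiv_monomial]
  by_cases h : s i = 0
  · simp [h]
  refine (totalDegree_monomial_le _ _).trans ?_
  have h1 := le_totalDegree hs
  have h2 : (s - Finsupp.single i 1) + Finsupp.single i 1 = s := by
    refine tsub_add_cancel_of_le ?_
    simp; omega
  have h3 : (s.sum fun _ e => e) = ((s - Finsupp.single i 1).sum fun _ e => e) + 1 := by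
    conv_lhs => rw [← h2]
    rw [Finsupp.sum_add_index' (by simp) (by simp)]
    simp
  change ((s - Finsupp.single i 1).sum fun _ e => e) ≤ _
  omega

theorem totalDegree_polyLap_le {n : ℕ} (p : MvPolynomial (Fin n) ℝ) : (polyLap n p).totalDegree ≤ p.totalDegree - 2 := by
  simp only [polyLap, LinearMap.sum_apply, LinearMap.comp_apply]
  refine totalDegree_finsetSum_le fun i _ => ?_
  have h1 := totalDegree_pderiv_le i p
  have h2 := totalDegree_pderiv_le i (pderiv i p)
  change (pderiv i (pderiv i p)).totalDegree ≤ _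
  omega

/-- The polynomial `R ^ 2 - |x| ^ 2`. -/
def ballPoly (n : ℕ) (R : ℝ) : MvPolynomial (Fin n) ℝ := C (R ^ 2) - ∑ i, X i ^ 2

theorem evalE_ballPoly {n : ℕ} (R : ℝ) (x : E n) : evalE (ballPoly n R) x = R ^ 2 - ‖x‖ ^ 2 := by
  simp [evalE, ballPoly, EuclideanSpace.norm_sq_eq]

theorem totalDegree_ballPoly_le (n : ℕ) (R : ℝ) : (ballPoly n R).totalDegree ≤ 2 := by
  refine (totalDegree_sub _ _).trans (max_le (by rw [totalDegree_C]; omega) (totalDegree_finsetSum_le fun i _ => by simp))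

/-- A cube of half-side R/(n+1) fits in the ball, and a polynomial that vanishes on a product of
infinite sets is zero. -/
theorem eq_zero_of_evalE_eq_zero {n : ℕ} {R : ℝ} (hR : 0 < R) {p : MvPolynomial (Fin n) ℝ}
    (h : ∀ x : E n, ‖x‖ < R → evalE p x = 0) : p = 0 := by
  refine funext_set (fun _ => Ioo (-(R / (n + 1))) (R / (n + 1))) (fun i => Ioo_infinite (by
    have : 0 < R / (n + 1) := by positivity
    linarith)) fun x hx => ?_
  rw [map_zero]
  refine h (WithLp.toLp 2 x) ?_
  have hn : (0 : ℝ) < n + 1 := by positivity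
  have h0 : 0 < R / (n + 1) := by positivity
  rw [← sq_lt_sq₀ (norm_nonneg _) hR.le, EuclideanSpace.norm_sq_eq]
  calc ∑ i, ‖x i‖ ^ 2 ≤ ∑ i : Fin n, (R / (n + 1)) ^ 2 := by
        refine Finset.sum_le_sum fun i _ => ?_
        have := hx i (mem_univ i)
        rw [Real.norm_eq_abs]
        exact pow_le_pow_left₀ (abs_nonneg _) (abs_le.2 ⟨this.1.le, this.2.le⟩) 2
    _ = n * (R / (n + 1)) ^ 2 := by simp
    _ < R ^ 2 := by
        rw [div_pow, mul_div_assoc', div_lt_iff₀ (by positivity)]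
        have : (0 : ℝ) ≤ n := by positivity
        have : 0 < R ^ 2 := by positivity
        have : (n : ℝ) < (n + 1) ^ 2 := by nlinarith
        rw [mul_comm]
        gcongr

/-- The Dirichlet problem on a ball is solvable in polynomials. -/
theorem exists_polyLap_eq {n : ℕ} (hn : n ≠ 0) {R : ℝ} (hR : 0 < R) (q : MvPolynomial (Fin n) ℝ) :
    ∃ p : MvPolynomial (Fin n) ℝ, polyLap n p = q ∧ ∀ x : E n, ‖x‖ = R → evalE p x = 0 := by
  set V := restrictTotalDegree (Fin n) ℝ q.totalDegree
  -- The map p ↦ Δ((R² - |x|²)p) does not raise the degree bound. It is injective by the maximum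
  -- principle, hence surjective on the finite-dimensional space V.
  let L : V →ₗ[ℝ] V := ((polyLap n ∘ₗ LinearMap.mulLeft ℝ (ballPoly n R)).domRestrict V).codRestrict V (by
    rintro ⟨p, hp⟩
    rw [mem_restrictTotalDegree] at hp ⊢
    simp only [LinearMap.domRestrict_apply, LinearMap.comp_apply, LinearMap.mulLeft_apply]
    have h1 := totalDegree_polyLap_le (ballPoly n R * p)
    have h2 := totalDegree_mul (ballPoly n R) p
    have h3 := totalDegree_ballPoly_le n R
    omega)
  have hzero : ∀ (p : MvPolynomial (Fin n) ℝ) (x : E n), ‖x‖ = R → evalE (ballPoly n R * p) x = 0 := fun p x hx => by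
    have := evalE_ballPoly R x
    simp only [evalE, map_mul] at *
    rw [this, hx]; ring
  have hinj : Function.Injective L := by
    rw [injective_iff_map_eq_zero]
    rintro ⟨p, hp⟩ h
    have h1 : polyLap n (ballPoly n R * p) = 0 := congrArg Subtype.val h
    have h2 : ∀ x : E n, ‖x‖ ≤ R → evalE (ballPoly n R * p) x = 0 := by
      intro x hx
      refine le_antisymm ?_ ?_
      · have := nonneg_of_laplacian_nonpos hn (R := R) (contDiff_evalE (-(ballPoly n R * p))) (fun y _ => ?_) (fun y hy => ?_) hx
        · simpa [evalE] using this
        · rw [laplacian_evalE, map_neg, h1]; simp [evalE]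
        · have := hzero p y hy
          simp only [evalE, map_neg] at this ⊢; linarith
      · refine nonneg_of_laplacian_nonpos hn (contDiff_evalE _) (fun y _ => ?_) (fun y hy => (hzero p y hy).ge) hx
        rw [laplacian_evalE, h1]; simp [evalE]
    refine Subtype.ext (eq_zero_of_evalE_eq_zero hR fun x hx => ?_)
    have h3 := h2 x hx.le
    have h4 := evalE_ballPoly R x
    simp only [evalE, map_mul] at h3 h4 ⊢
    rw [h4] at h3
    exact (mul_eq_zero.1 h3).resolve_left (by nlinarith [norm_nonneg x])
  obtain ⟨p, hp⟩ := LinearMap.injective_iff_surjective.1 hinj ⟨q, by rw [mem_restrictTotalDegree]⟩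
  exact ⟨ballPoly n R * p, congrArg Subtype.val hp, hzero p⟩

/-- Polynomials are uniformly dense on closed balls. -/
theorem exists_evalE_near {n : ℕ} (R : ℝ) {g : E n → ℝ} (hg : Continuous g) {ε : ℝ} (hε : 0 < ε) :
    ∃ p : MvPolynomial (Fin n) ℝ, ∀ x : E n, ‖x‖ ≤ R → |evalE p x - g x| < ε := by
  set K := Metric.closedBall (0 : E n) R
  let c : Fin n → C(K, ℝ) := fun i => ⟨fun x => (x : E n) i, by fun_prop⟩
  have hsep : (aeval (R := ℝ) c).range.SeparatesPoints := by
    intro x y hxy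
    obtain ⟨i, hi⟩ : ∃ i, (x : E n) i ≠ (y : E n) i := by
      by_contra! h
      exact hxy (Subtype.ext (PiLp.ext h))
    exact ⟨c i, ⟨c i, ⟨X i, by simp⟩, rfl⟩, hi⟩
  have : CompactSpace K := isCompact_iff_compactSpace.1 (isCompact_closedBall _ _)
  obtain ⟨⟨_, p, rfl⟩, hp⟩ := ContinuousMap.exists_mem_subalgebra_near_continuousMap_of_separatesPoints _ hsep ⟨fun x : K => g x, by fun_prop⟩ ε hε
  refine ⟨p, fun x hx => ?_⟩
  have h1 := (ContinuousMap.norm_coe_le_norm _ (⟨x, by simpa [K] using hx⟩ : K)).trans_lt hp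
  have h2 : ∀ (p : MvPolynomial (Fin n) ℝ) (y : K), (aeval (R := ℝ) c p) y = evalE p (y : E n) := by
    intro p y
    induction p using MvPolynomial.induction_on with
    | C a => simp [evalE]
    | add p q hp hq => rw [map_add, ContinuousMap.add_apply, hp, hq]; simp [evalE]
    | mul_X p i hp => rw [map_mul, ContinuousMap.mul_apply, hp, aeval_X]; simp [evalE, c]
  simpa [h2] using h1

/-- Polynomial solutions of the iterated problem with Navier boundary values. -/
theorem exists_polyLap_seq {n : ℕ} (hn : n ≠ 0) {R : ℝ} (hR : 0 < R) (q : MvPolynomial (Fin n) ℝ) :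
    ∃ u : ℕ → MvPolynomial (Fin n) ℝ, u 0 = q ∧ ∀ j, polyLap n (u (j + 1)) = -u j ∧ ∀ x : E n, ‖x‖ = R → evalE (u (j + 1)) x = 0 := by
  choose F hF using fun q => exists_polyLap_eq hn hR (-q)
  exact ⟨fun j => F^[j] q, rfl, fun j => by simp only [Function.iterate_succ_apply']; exact hF _⟩

/-- Agreement on the closed ball alone is assumed, since that is all that is known of the iterates
inside `negLaplacianPow`. Derivatives within a convex set with interior points are unique, so
boundary points cause no trouble. -/
theorem laplacianWithin_evalE {n : ℕ} {R : ℝ} (hR : 0 < R) (p : MvPolynomial (Fin n) ℝ) {g : E n → ℝ}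
    (hg : ∀ x ∈ Metric.closedBall (0 : E n) R, g x = evalE p x) {x : E n} (hx : x ∈ Metric.closedBall (0 : E n) R) :
    laplacianWithin g (Metric.closedBall 0 R) x = evalE (polyLap n p) x := by
  have hU : UniqueDiffOn ℝ (Metric.closedBall (0 : E n) R) := uniqueDiffOn_convex (convex_closedBall _ _) (by
    rw [interior_closedBall _ hR.ne']; exact ⟨0, by simpa⟩)
  rw [← laplacian_evalE, laplacian_eq_iteratedFDeriv_orthonormalBasis _ (EuclideanSpace.basisFun (Fin n) ℝ),
    laplacianWithin_eq_iteratedFDerivWithin_orthonormalBasis _ hU hx (EuclideanSpace.basisFun (Fin n) ℝ)]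
  refine Finset.sum_congr rfl fun i _ => ?_
  rw [iteratedFDerivWithin_congr hg hx, iteratedFDerivWithin_eq_iteratedFDeriv hU (contDiff_evalE p).contDiffAt hx]

theorem negLaplacianPow_evalE {n : ℕ} {R : ℝ} (hR : 0 < R) {u : ℕ → MvPolynomial (Fin n) ℝ} (hu : ∀ j, polyLap n (u (j + 1)) = -u j)
    (j k : ℕ) {x : E n} (hx : x ∈ Metric.closedBall (0 : E n) R) :
    negLaplacianPow (closure (Metric.ball 0 R)) j (evalE (u (k + j))) x = evalE (u k) x := by
  rw [closure_ball _ hR.ne', negLaplacianPow]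
  induction j generalizing k x with
  | zero => rfl
  | succ j ih =>
    rw [Function.iterate_succ_apply', laplacianWithin_evalE hR (u (k + 1)) (fun y hy => ?_) hx, hu]
    · simp [evalE]
    · rw [show k + (j + 1) = k + 1 + j by ring]
      exact ih (k + 1) hy

theorem isTest₂_evalE {m n : ℕ} (hn : n = 2 * m + 1) {R : ℝ} (hR : 0 < R) {u : ℕ → MvPolynomial (Fin n) ℝ}
    (hu : ∀ j, polyLap n (u (j + 1)) = -u j ∧ ∀ x : E n, ‖x‖ = R → evalE (u (j + 1)) x = 0) :
    IsTest₂ (Metric.ball 0 R) (evalE (u m) : E n → ℝ) := by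
  refine ⟨(contDiff_evalE _).contDiffOn, fun j hj x hx => ?_⟩
  rw [frontier_ball _ hR.ne'] at hx
  have hj' : j < m := by omega
  -- For j < m the j-th iterate of u m is u (k+1). The index is at least one, and only those terms
  -- vanish on the sphere.
  obtain ⟨k, rfl⟩ : ∃ k, m = (k + 1) + j := ⟨m - j - 1, by omega⟩
  rw [negLaplacianPow_evalE hR (fun j => (hu j).1) j (k + 1) (Metric.sphere_subset_closedBall hx)]
  exact (hu k).2 x (by simpa using hx)

theorem IsNavierSolution.integral_mul_evalE {m n : ℕ} (hn : n = 2 * m + 1) {R : ℝ} (hR : 0 < R) {f W : E n → ℝ}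
    (h : IsNavierSolution (Metric.ball 0 R) f W) {u : ℕ → MvPolynomial (Fin n) ℝ}
    (hu : ∀ j, polyLap n (u (j + 1)) = -u j ∧ ∀ x : E n, ‖x‖ = R → evalE (u (j + 1)) x = 0) :
    ∫ x in Metric.ball 0 R, W x * evalE (u 0) x = ∫ x in Metric.ball 0 R, f x * evalE (u m) x := by
  rw [← h.2 _ (isTest₂_evalE hn hR hu)]
  refine setIntegral_congr_fun measurableSet_ball fun x hx => ?_
  have := negLaplacianPow_evalE hR (fun j => (hu j).1) m 0 (Metric.ball_subset_closedBall hx)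
  rw [zero_add] at this
  rw [show (n - 1) / 2 = m by omega]
  exact congrArg (W x * ·) this.symm

end Polynomials

/-! ### Regularised fundamental solutions and comparison for the Navier problem. -/

section SmoothKernel

open InnerProductSpace Laplacian

theorem hasFDerivAt_integral_mul_sub {n : ℕ} {k : E n → ℝ}
    (hk : ContDiff ℝ 1 k) {η : E n → ℝ} (hη : Continuous η) (hc : HasCompactSupport η) (x : E n) :
    HasFDerivAt (fun x => ∫ y, η y * k (x - y)) (∫ y, η y • fderiv ℝ k (x - y)) x := by
  have hd : Continuous (fderiv ℝ k) := hk.continuous_fderiv (by simp)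
  obtain ⟨r, hr⟩ := hc.isCompact.isBounded.subset_closedBall 0
  obtain ⟨C, hC⟩ := (isCompact_closedBall (0 : E n) (‖x‖ + 1 + r)).exists_bound_of_continuousOn hd.continuousOn
  refine hasFDerivAt_integral_of_dominated_of_fderiv_le (𝕜 := ℝ) (F' := fun x y => η y • fderiv ℝ k (x - y)) (bound := fun y => |η y| * C) (Metric.ball_mem_nhds x one_pos) ?_ ?_ ?_ ?_ ?_ ?_
  · refine Eventually.of_forall fun z => Continuous.aestronglyMeasurable (by fun_prop)
  · exact Continuous.integrable_of_hasCompactSupport (by fun_prop) hc.mul_right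
  · exact Continuous.aestronglyMeasurable (by fun_prop)
  · refine Eventually.of_forall fun y z hz => ?_
    rw [norm_smul, Real.norm_eq_abs]
    by_cases hy : y ∈ tsupport η
    · refine mul_le_mul_of_nonneg_left (hC _ ?_) (abs_nonneg _)
      have h1 := hr hy
      rw [mem_closedBall_zero_iff] at h1 ⊢
      rw [mem_ball_iff_norm] at hz
      have h2 := norm_sub_norm_le z x
      have h3 := norm_sub_le z y
      linarith
    · simp [image_eq_zero_of_notMem_tsupport hy]
  · exact (hη.integrable_of_hasCompactSupport hc).abs.mul_const C
  · refine Eventually.of_forall fun y z _ => ?_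
    have h1 : HasFDerivAt (fun z => k (z - y)) (fderiv ℝ k (z - y)) z := by
      simpa [Function.comp_def] using (hk.differentiable (by simp) (z - y)).hasFDerivAt.comp z ((hasFDerivAt_id z).sub_const y)
    exact h1.const_mul (η y)

theorem contDiff_integral_mul_sub {n : ℕ} {k : E n → ℝ} (hk : ContDiff ℝ ∞ k) {η : E n → ℝ} (hη : Continuous η) (hc : HasCompactSupport η) :
    ContDiff ℝ ∞ fun x => ∫ y, η y * k (x - y) := by
  rw [contDiff_iff_contDiffAt]
  intro x
  exact contDiffAt_integral_param (P := E n) (G := E n) hη.locallyIntegrable hc.isCompact (fun t ht => image_eq_zero_of_notMem_tsupport ht) isOpen_univ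
    (k := fun q : E n × E n => k (q.1 - q.2)) (ContDiff.contDiffOn (by fun_prop)) fun t _ => mem_univ _

theorem laplacian_integral_mul_sub {n : ℕ} {k : E n → ℝ} (hk : ContDiff ℝ ∞ k) {η : E n → ℝ} (hη : Continuous η) (hc : HasCompactSupport η) (x : E n) :
    laplacian (fun x => ∫ y, η y * k (x - y)) x = ∫ y, η y * laplacian k (x - y) := by
  have hdd : ∀ {f : E n → ℝ}, ContDiff ℝ ∞ f → ∀ x e, fderiv ℝ (fderiv ℝ f) x e e = fderiv ℝ (fun y => fderiv ℝ f y e) x e := by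
    intro f hf x e
    have h1 : DifferentiableAt ℝ (fderiv ℝ f) x := (hf.fderiv_right (m := ∞) (by simp)).differentiable (by simp) x
    have h2 := (ContinuousLinearMap.apply ℝ ℝ e).hasFDerivAt.comp x h1.hasFDerivAt
    exact (DFunLike.congr_fun h2.fderiv e).symm
  have hk' : ∀ e, ContDiff ℝ ∞ fun y => fderiv ℝ k y e := fun e => (hk.fderiv_right (m := ∞) (by simp)).clm_apply contDiff_const
  have key : ∀ {k : E n → ℝ}, ContDiff ℝ ∞ k → ∀ x e, fderiv ℝ (fun x => ∫ y, η y * k (x - y)) x e = ∫ y, η y * fderiv ℝ k (x - y) e := by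
    intro k hk x e
    have hd : Continuous (fderiv ℝ k) := hk.continuous_fderiv (by simp)
    have hi : Integrable fun y => η y • fderiv ℝ k (x - y) := Continuous.integrable_of_hasCompactSupport (by fun_prop) hc.smul_right
    rw [(hasFDerivAt_integral_mul_sub (hk.of_le (by simp)) hη hc x).fderiv, ContinuousLinearMap.integral_apply hi]
    rfl
  simp_rw [laplacian_eq_sum_fderiv, Finset.mul_sum]
  rw [integral_finsetSum]
  · refine Finset.sum_congr rfl fun i _ => ?_
    rw [hdd (contDiff_integral_mul_sub hk hη hc)]
    simp_rw [key hk, hdd hk]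
    exact key (hk' _) x _
  · intro i _
    simp_rw [hdd hk]
    have hd := (hk' (EuclideanSpace.basisFun (Fin n) ℝ i)).continuous_fderiv (by simp)
    exact Continuous.integrable_of_hasCompactSupport (by fun_prop) hc.mul_right

/-- Regularised power kernel `(‖x‖ ^ 2 + t ^ 2) ^ (-c)`. -/
def regKernel {n : ℕ} (c t : ℝ) (x : E n) : ℝ := (‖x‖ ^ 2 + t ^ 2) ^ (-c)

theorem regKernel_nonneg {n : ℕ} (c t : ℝ) (x : E n) : 0 ≤ regKernel c t x := by unfold regKernel; positivity

theorem contDiff_regKernel {n : ℕ} (c : ℝ) {t : ℝ} (ht : 0 < t) : ContDiff ℝ ∞ (regKernel c t : E n → ℝ) :=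
  (contDiff_norm_sq'.add contDiff_const).rpow_const_of_ne fun x => by positivity

theorem laplacian_regKernel {n : ℕ} (c : ℝ) {t : ℝ} (ht : 0 < t) (x : E n) :
    laplacian (regKernel c t : E n → ℝ) x =
      -(2 * c * (n - 2 * c - 2) * regKernel (c + 1) t x + 2 * c * (2 * c + 2) * t ^ 2 * regKernel (c + 2) t x) := by
  have hpos : ∀ s : ℝ, 0 ≤ s → 0 < s + t ^ 2 := fun s hs => by positivity
  have hd : ∀ (a s : ℝ), 0 ≤ s → HasDerivAt (fun s : ℝ => (s + t ^ 2) ^ a) (a * (s + t ^ 2) ^ (a - 1)) s := fun a s hs => by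
    have := ((hasDerivAt_id s).add_const (t ^ 2)).rpow_const (p := a) (Or.inl (hpos s hs).ne')
    simpa using this
  have h := laplacian_comp_norm_sq (n := n) (x := x) (h := fun s => (s + t ^ 2) ^ (-c)) (h' := fun s => -c * (s + t ^ 2) ^ (-c - 1))
    (fun s hs => hd _ s hs) ((hd (-c - 1) _ (by positivity)).const_mul (-c))
  have hX : 0 < ‖x‖ ^ 2 + t ^ 2 := by positivity
  have e1 : (‖x‖ ^ 2 + t ^ 2) ^ (-c - 1) = (‖x‖ ^ 2 + t ^ 2) * (‖x‖ ^ 2 + t ^ 2) ^ (-(c + 2)) := by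
    rw [mul_comm, ← Real.rpow_add_one hX.ne']; congr 1; ring
  have e0 : (regKernel c t : E n → ℝ) = fun y => (‖y‖ ^ 2 + t ^ 2) ^ (-c) := rfl
  rw [e0, h, regKernel, regKernel, show -c - 1 - 1 = -(c + 2) by ring, show -(c + 1) = -c - 1 by ring, e1]
  ring

/-- The normalised approximate identity obtained from the Laplacian of the regularised fundamental solution. -/
def newtonKernel {n : ℕ} (t : ℝ) (x : E n) : ℝ := n / sphArea n * (t ^ 2 * regKernel (n / 2 + 1) t x)

/-- The integrand is the derivative of r^n (r²+t²)^{-n/2}, which goes from 0 to 1. -/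
theorem radial_antideriv (n : ℕ) (hn : n ≠ 0) {t : ℝ} (ht : 0 < t) :
    IntegrableOn (fun r : ℝ => r ^ (n - 1) * (n * t ^ 2 * (r ^ 2 + t ^ 2) ^ (-((n : ℝ) / 2 + 1)))) (Ioi 0) ∧
    ∫ r in Ioi (0 : ℝ), r ^ (n - 1) * (n * t ^ 2 * (r ^ 2 + t ^ 2) ^ (-((n : ℝ) / 2 + 1))) = 1 := by
  have hpos : ∀ r : ℝ, 0 < r ^ 2 + t ^ 2 := fun r => by positivity
  have hd : ∀ r : ℝ, HasDerivAt (fun r : ℝ => r ^ n * (r ^ 2 + t ^ 2) ^ (-((n : ℝ) / 2)))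
      (r ^ (n - 1) * (n * t ^ 2 * (r ^ 2 + t ^ 2) ^ (-((n : ℝ) / 2 + 1)))) r := by
    intro r
    have h1 : HasDerivAt (fun r : ℝ => r ^ 2 + t ^ 2) (2 * r) r := by simpa using (hasDerivAt_pow 2 r).add_const (t ^ 2)
    have h2 := (hasDerivAt_pow n r).mul (h1.rpow_const (p := -((n : ℝ) / 2)) (Or.inl (hpos r).ne'))
    refine h2.congr_deriv ?_
    have e1 : (r ^ 2 + t ^ 2) ^ (-((n : ℝ) / 2)) = (r ^ 2 + t ^ 2) * (r ^ 2 + t ^ 2) ^ (-((n : ℝ) / 2 + 1)) := by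
      rw [mul_comm, ← Real.rpow_add_one (hpos r).ne']; congr 1; ring
    have e2 : r ^ n = r ^ (n - 1) * r := by rw [← pow_succ]; congr 1; omega
    rw [e1, show -((n : ℝ) / 2) - 1 = -((n : ℝ) / 2 + 1) by ring, e2]
    ring
  have hnn : ∀ r ∈ Ioi (0 : ℝ), 0 ≤ r ^ (n - 1) * (n * t ^ 2 * (r ^ 2 + t ^ 2) ^ (-((n : ℝ) / 2 + 1))) := fun r hr => by
    have := mem_Ioi.1 hr
    positivity
  have hlim : Tendsto (fun r : ℝ => r ^ n * (r ^ 2 + t ^ 2) ^ (-((n : ℝ) / 2))) atTop (𝓝 1) := by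
    have h1 : Tendsto (fun r : ℝ => (1 - t ^ 2 / (r ^ 2 + t ^ 2)) ^ ((n : ℝ) / 2)) atTop (𝓝 1) := by
      have h2 : Tendsto (fun r : ℝ => r ^ 2 + t ^ 2) atTop atTop := tendsto_atTop_add_const_right _ _ (tendsto_pow_atTop two_ne_zero)
      have h3 : Tendsto (fun r : ℝ => 1 - t ^ 2 / (r ^ 2 + t ^ 2)) atTop (𝓝 (1 - 0)) := tendsto_const_nhds.sub (h2.const_div_atTop _)
      rw [sub_zero] at h3
      simpa using h3.rpow_const (p := (n : ℝ) / 2) (Or.inl one_ne_zero)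
    refine h1.congr' ?_
    filter_upwards [eventually_gt_atTop 0] with r hr
    rw [show 1 - t ^ 2 / (r ^ 2 + t ^ 2) = r ^ 2 / (r ^ 2 + t ^ 2) by field_simp [(hpos r).ne']; ring, Real.div_rpow (by positivity) (hpos r).le,
      Real.rpow_neg (hpos r).le, div_eq_mul_inv]
    congr 1
    rw [← Real.rpow_natCast, ← Real.rpow_natCast, ← Real.rpow_mul hr.le]
    congr 1; push_cast; ring
  refine ⟨integrableOn_Ioi_deriv_of_nonneg' (fun r _ => hd r) hnn hlim, ?_⟩
  rw [integral_Ioi_of_hasDerivAt_of_nonneg' (fun r _ => hd r) hnn hlim]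
  simp [hn]

/-- With r^n ≤ (r²+t²)^{n/2} and (r+t)² ≤ 2(r²+t²) the integrand is at most 2nt²/(r+t)², which
integrates to 2nt. -/
theorem radial_first_moment (n : ℕ) (hn : n ≠ 0) {t : ℝ} (ht : 0 < t) :
    IntegrableOn (fun r : ℝ => r ^ (n - 1) * (n * t ^ 2 * (r ^ 2 + t ^ 2) ^ (-((n : ℝ) / 2 + 1)) * r)) (Ioi 0) ∧
    ∫ r in Ioi (0 : ℝ), r ^ (n - 1) * (n * t ^ 2 * (r ^ 2 + t ^ 2) ^ (-((n : ℝ) / 2 + 1)) * r) ≤ 2 * n * t := by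
  have hpos : ∀ r : ℝ, 0 < r ^ 2 + t ^ 2 := fun r => by positivity
  have hd : ∀ r ∈ Ici (0 : ℝ), HasDerivAt (fun r : ℝ => -(2 * n * t ^ 2) * (r + t)⁻¹) (2 * n * t ^ 2 * ((r + t) ^ 2)⁻¹) r := by
    intro r hr
    have hr' := mem_Ici.1 hr
    have h1 := (((hasDerivAt_id r).add_const t).inv (by simp only [id]; positivity)).const_mul (-(2 * n * t ^ 2))
    refine h1.congr_deriv ?_
    simp only [id]; ring
  have hnn : ∀ r ∈ Ioi (0 : ℝ), 0 ≤ 2 * n * t ^ 2 * ((r + t) ^ 2)⁻¹ := fun r _ => by positivity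
  have hlim : Tendsto (fun r : ℝ => -(2 * n * t ^ 2) * (r + t)⁻¹) atTop (𝓝 0) := by
    have : Tendsto (fun r : ℝ => (r + t)⁻¹) atTop (𝓝 0) := tendsto_inv_atTop_zero.comp (tendsto_atTop_add_const_right _ _ tendsto_id)
    simpa using this.const_mul (-(2 * n * t ^ 2))
  have hi := integrableOn_Ioi_deriv_of_nonneg' hd hnn hlim
  have hv := integral_Ioi_of_hasDerivAt_of_nonneg' hd hnn hlim
  have hle : ∀ r ∈ Ioi (0 : ℝ), r ^ (n - 1) * (n * t ^ 2 * (r ^ 2 + t ^ 2) ^ (-((n : ℝ) / 2 + 1)) * r) ≤ 2 * n * t ^ 2 * ((r + t) ^ 2)⁻¹ := by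
    intro r hr
    have hr' := mem_Ioi.1 hr
    have e2 : r ^ n = r ^ (n - 1) * r := by rw [← pow_succ]; congr 1; omega
    have e3 : r ^ n ≤ (r ^ 2 + t ^ 2) ^ ((n : ℝ) / 2) := by
      rw [show r ^ n = (r ^ 2) ^ ((n : ℝ) / 2) by
        rw [← Real.rpow_natCast, ← Real.rpow_natCast, ← Real.rpow_mul hr'.le]; congr 1; push_cast; ring]
      exact Real.rpow_le_rpow (by positivity) (by nlinarith) (by positivity)
    have e4 : (r ^ 2 + t ^ 2) ^ (-((n : ℝ) / 2 + 1)) = ((r ^ 2 + t ^ 2) ^ ((n : ℝ) / 2))⁻¹ * (r ^ 2 + t ^ 2)⁻¹ := by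
      rw [Real.rpow_neg (hpos r).le, Real.rpow_add_one (hpos r).ne', mul_inv]
    have e5 : (r ^ 2 + t ^ 2)⁻¹ ≤ 2 * ((r + t) ^ 2)⁻¹ := by
      rw [← div_eq_mul_inv, inv_eq_one_div, div_le_div_iff₀ (hpos r) (by positivity)]
      nlinarith [sq_nonneg (r - t)]
    rw [e4]
    have hq : 0 < (r ^ 2 + t ^ 2) ^ ((n : ℝ) / 2) := by positivity
    calc r ^ (n - 1) * (n * t ^ 2 * (((r ^ 2 + t ^ 2) ^ ((n : ℝ) / 2))⁻¹ * (r ^ 2 + t ^ 2)⁻¹) * r) =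
        n * t ^ 2 * (r ^ n * ((r ^ 2 + t ^ 2) ^ ((n : ℝ) / 2))⁻¹) * (r ^ 2 + t ^ 2)⁻¹ := by rw [e2]; ring
      _ ≤ n * t ^ 2 * 1 * (2 * ((r + t) ^ 2)⁻¹) := by
        gcongr
        rw [← div_eq_mul_inv, div_le_one hq]; exact e3
      _ = _ := by ring
  have hi' : IntegrableOn (fun r : ℝ => r ^ (n - 1) * (n * t ^ 2 * (r ^ 2 + t ^ 2) ^ (-((n : ℝ) / 2 + 1)) * r)) (Ioi 0) := by
    refine Integrable.mono' hi ?_ ((ae_restrict_iff' measurableSet_Ioi).2 (Eventually.of_forall fun r hr => ?_))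
    · fun_prop
    · have hr' := mem_Ioi.1 hr
      rw [Real.norm_of_nonneg (by positivity)]
      exact hle r hr
  refine ⟨hi', (setIntegral_mono_on hi' hi measurableSet_Ioi hle).trans ?_⟩
  rw [hv, zero_add]
  refine le_of_eq ?_
  field_simp; ring

theorem newtonKernel_spec {n : ℕ} [NeZero n] {t : ℝ} (ht : 0 < t) :
    Integrable (newtonKernel t : E n → ℝ) ∧ ∫ x : E n, newtonKernel t x = 1 ∧
    Integrable (fun x : E n => newtonKernel t x * ‖x‖) ∧ ∫ x : E n, newtonKernel t x * ‖x‖ ≤ 2 * n * t := by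
  have hn : n ≠ 0 := NeZero.ne n
  have hσ := sphArea_pos n
  have hσ' : (n : ℝ) * (volume : Measure (E n)).real (Metric.ball 0 1) = sphArea n := by
    rw [sphArea, sphMeas, Measure.toSphere_real_apply_univ]; simp
  obtain ⟨a1, a2⟩ := radial_antideriv n hn ht
  obtain ⟨b1, b2⟩ := radial_first_moment n hn ht
  have e1 : (newtonKernel t : E n → ℝ) = fun x => (fun r : ℝ => (sphArea n)⁻¹ * (n * t ^ 2 * (r ^ 2 + t ^ 2) ^ (-((n : ℝ) / 2 + 1)))) ‖x‖ := by
    funext x; simp only [newtonKernel, regKernel]; ring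
  have e2 : (fun x : E n => newtonKernel t x * ‖x‖) = fun x => (fun r : ℝ => (sphArea n)⁻¹ * (n * t ^ 2 * (r ^ 2 + t ^ 2) ^ (-((n : ℝ) / 2 + 1)) * r)) ‖x‖ := by
    funext x; simp only [newtonKernel, regKernel]; ring
  have c1 : ∀ (G : ℝ → ℝ), ∫ x : E n, (sphArea n)⁻¹ * G ‖x‖ = ∫ r in Ioi (0 : ℝ), r ^ (n - 1) * G r := by
    intro G
    rw [integral_const_mul, integral_fun_norm_addHaar volume G, finrank_euclideanSpace_fin]
    simp only [nsmul_eq_mul, smul_eq_mul]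
    rw [← mul_assoc (n : ℝ), hσ', inv_mul_cancel_left₀ hσ.ne']
  have c2 : ∀ (G : ℝ → ℝ), IntegrableOn (fun r => r ^ (n - 1) * G r) (Ioi 0) → Integrable fun x : E n => (sphArea n)⁻¹ * G ‖x‖ := by
    intro G hG
    refine Integrable.const_mul ?_ _
    rw [integrable_fun_norm_addHaar volume (f := G), finrank_euclideanSpace_fin]
    exact hG
  rw [e2, e1]
  refine ⟨c2 _ a1, ?_, c2 _ b1, ?_⟩
  · exact (c1 fun r => n * t ^ 2 * (r ^ 2 + t ^ 2) ^ (-((n : ℝ) / 2 + 1))).trans a2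
  · exact (c1 fun r => n * t ^ 2 * (r ^ 2 + t ^ 2) ^ (-((n : ℝ) / 2 + 1)) * r).trans_le b2

theorem newtonKernel_nonneg {n : ℕ} [NeZero n] (t : ℝ) (x : E n) : 0 ≤ newtonKernel t x := by
  have := sphArea_pos n
  have := regKernel_nonneg ((n : ℝ) / 2 + 1) t x
  unfold newtonKernel; positivity

/-- Averaging a Lipschitz function against a kernel of mass one loses at most L times the first
moment. -/
theorem le_integral_mul_newtonKernel {n : ℕ} [NeZero n] {t : ℝ} (ht : 0 < t) {η : E n → ℝ} {L : ℝ≥0} (hL : LipschitzWith L η)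
    (hc : HasCompactSupport η) (x : E n) :
    η x - L * (2 * n * t) ≤ ∫ y, η y * newtonKernel t (x - y) := by
  obtain ⟨h1, h2, h3, h4⟩ := newtonKernel_spec (n := n) ht
  rw [← integral_sub_left_eq_self (fun y => η y * newtonKernel t (x - y)) volume x]
  simp only [sub_sub_cancel]
  have hi : Integrable fun z : E n => η (x - z) * newtonKernel t z := by
    obtain ⟨C, hC⟩ := hc.exists_bound_of_continuous hL.continuous
    have hcont := hL.continuous
    refine h1.bdd_mul (c := C) (by fun_prop) (Eventually.of_forall fun z => hC _)
  calc η x - L * (2 * n * t) ≤ η x * (∫ z : E n, newtonKernel t z) - L * ∫ z : E n, newtonKernel t z * ‖z‖ := by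
        rw [h2, mul_one]; gcongr
    _ = ∫ z : E n, (η x * newtonKernel t z - L * (newtonKernel t z * ‖z‖)) := by
        rw [integral_sub (h1.const_mul _) (h3.const_mul _), integral_const_mul, integral_const_mul]
    _ ≤ _ := by
        refine integral_mono ((h1.const_mul _).sub (h3.const_mul _)) hi fun z => ?_
        have h5 := hL.dist_le_mul x (x - z)
        rw [Real.dist_eq, dist_eq_norm, sub_sub_cancel] at h5
        have h6 := (abs_le.1 h5).2
        have h7 := newtonKernel_nonneg t z
        simp only
        nlinarith

/-- Constants of the successive fundamental solutions of powers of the Laplacian. -/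
def navConst (n : ℕ) : ℕ → ℝ
  | 0 => 1 / ((n - 2) * sphArea n)
  | i + 1 => navConst n i / ((n - 4 - 2 * i) * (2 * i + 2))

theorem navConst_pos {n : ℕ} [NeZero n] (i : ℕ) (h : (2 : ℝ) + 2 * i < n) : 0 < navConst n i := by
  have hσ := sphArea_pos n
  induction i with
  | zero =>
    rw [navConst]
    have : (0 : ℝ) < n - 2 := by simp only [Nat.cast_zero, mul_zero, add_zero] at h; linarith
    positivity
  | succ i ih =>
    rw [navConst]
    push_cast at h
    have h1 : (0 : ℝ) < n - 4 - 2 * i := by linarith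
    have := ih (by linarith)
    positivity

/-- Writing the dimension as 2(i+l)+3 turns the recursion into trading a unit of l for one of i. At
l = 0 the truncated 2l - 1 is 0, and 0‼ = 1 stands for (-1)‼. -/
theorem navConst_mul (i l : ℕ) : navConst (2 * (i + l) + 3) i * (sphArea (2 * (i + l) + 3) * (2 * (i + l) + 1).doubleFactorial * (2 * i).doubleFactorial) =
    (2 * l - 1).doubleFactorial := by
  induction i generalizing l with
  | zero =>
    have hσ := sphArea_pos (2 * (0 + l) + 3)
    rw [navConst]
    rcases l with _ | l
    · generalize sphArea (2 * (0 + 0) + 3) = σ at *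
      norm_num
      field_simp
    · rw [show 2 * (0 + (l + 1)) + 1 = (2 * l + 1) + 2 by ring, Nat.doubleFactorial_add_two, show 2 * (l + 1) - 1 = 2 * l + 1 by omega]
      have h1 : ((2 * (0 + (l + 1)) + 3 : ℕ) : ℝ) - 2 = ((2 * l + 1 + 2 : ℕ) : ℝ) := by push_cast; ring
      rw [h1]
      have : (0 : ℝ) < ((2 * l + 1 + 2 : ℕ) : ℝ) := by positivity
      generalize sphArea (2 * (0 + (l + 1)) + 3) = σ at *
      push_cast at *
      simp only [Nat.doubleFactorial, Nat.cast_one, mul_one]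
      field_simp
  | succ i ih =>
    have h := ih (l + 1)
    have e : i + (l + 1) = i + 1 + l := by ring
    rw [e, show 2 * (l + 1) - 1 = 2 * l + 1 by omega] at h
    have h1 : (2 * l + 1).doubleFactorial = (2 * l + 1) * (2 * l - 1).doubleFactorial := by
      rcases l with _ | l
      · simp
      · rw [show 2 * (l + 1) + 1 = (2 * l + 1) + 2 by ring, Nat.doubleFactorial_add_two, show 2 * (l + 1) - 1 = 2 * l + 1 by omega]
    have h2 : ((2 * (i + 1 + l) + 3 : ℕ) : ℝ) - 4 - 2 * i = 2 * l + 1 := by push_cast; ring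
    rw [navConst, h2, show 2 * (i + 1) = 2 * i + 2 by ring, Nat.doubleFactorial_add_two]
    rw [h1] at h
    push_cast at h ⊢
    field_simp
    linarith

theorem navConst_last {m : ℕ} (k : ℕ) (hm : m = k + 1) : navConst (2 * m + 1) k = 1 / (sphArea (2 * m + 1) * (2 * m - 1).factorial) := by
  subst hm
  have h := navConst_mul k 0
  have hσ := sphArea_pos (2 * (k + 1) + 1)
  rw [show 2 * (k + 1) - 1 = 2 * k + 1 by omega, Nat.factorial_eq_mul_doubleFactorial]
  have e : 2 * (k + 0) + 3 = 2 * (k + 1) + 1 := by ring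
  rw [e] at h
  simp only [add_zero, mul_zero, Nat.zero_sub, Nat.doubleFactorial] at h
  have h1 : (0 : ℝ) < ((2 * k + 1).doubleFactorial : ℝ) := by exact_mod_cast Nat.doubleFactorial_pos _
  have h2 : (0 : ℝ) < ((2 * k).doubleFactorial : ℝ) := by exact_mod_cast Nat.doubleFactorial_pos _
  rw [eq_div_iff (by positivity)]
  push_cast at h ⊢
  rw [← mul_assoc] at h ⊢
  linarith

/-- Regularised fundamental solution of the power `i + 1` of the negative Laplacian. -/
def navKernel (n : ℕ) (t : ℝ) (i : ℕ) (x : E n) : ℝ := navConst n i * regKernel ((n - 2 - 2 * i) / 2) t x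

theorem contDiff_navKernel {n : ℕ} {t : ℝ} (ht : 0 < t) (i : ℕ) : ContDiff ℝ ∞ (navKernel n t i) :=
  contDiff_const.mul (contDiff_regKernel _ ht)

theorem laplacian_navKernel {n : ℕ} {t : ℝ} (ht : 0 < t) (i : ℕ) (x : E n) :
    laplacian (navKernel n t i) x = navConst n i * laplacian (regKernel ((n - 2 - 2 * i) / 2) t : E n → ℝ) x :=
  laplacian_smul (navConst n i) (contDiff_infty.1 (contDiff_regKernel _ ht) 2).contDiffAt

theorem laplacian_navKernel_zero {n : ℕ} [NeZero n] (hn : (2 : ℝ) < n) {t : ℝ} (ht : 0 < t) (x : E n) :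
    laplacian (navKernel n t 0) x = -newtonKernel t x := by
  have hσ := sphArea_pos n
  have h2 : (0 : ℝ) < n - 2 := by linarith
  rw [laplacian_navKernel ht, laplacian_regKernel _ ht, newtonKernel, navConst, show ((n : ℝ) - 2 - 2 * (0 : ℕ)) / 2 + 2 = n / 2 + 1 by push_cast; ring]
  push_cast
  field_simp
  ring

/-- The regularisation adds only a nonpositive term of order t². The regularised kernels are thus
supersolutions, which is the direction the comparison needs. -/
theorem laplacian_navKernel_succ {n : ℕ} [NeZero n] {i : ℕ} (hi : (4 : ℝ) + 2 * i < n) {t : ℝ} (ht : 0 < t) (x : E n) :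
    laplacian (navKernel n t (i + 1)) x ≤ -navKernel n t i x := by
  have h1 : (0 : ℝ) < n - 4 - 2 * i := by linarith
  have h2 := navConst_pos (n := n) i (by linarith)
  have h3 := regKernel_nonneg (((n : ℝ) - 2 - 2 * (i + 1 : ℕ)) / 2 + 2) t x
  rw [laplacian_navKernel ht, laplacian_regKernel _ ht, navKernel, navConst,
    show ((n : ℝ) - 2 - 2 * (i + 1 : ℕ)) / 2 + 1 = (n - 2 - 2 * i) / 2 by push_cast; ring]
  generalize regKernel (((n : ℝ) - 2 - 2 * (i + 1 : ℕ)) / 2 + 2) t x = A at *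
  generalize regKernel (((n : ℝ) - 2 - 2 * i) / 2) t x = B at *
  push_cast
  have e : navConst n i / ((n - 4 - 2 * i) * (2 * i + 2)) * -(2 * ((n - 2 - 2 * (i + 1)) / 2) * (n - 2 * ((n - 2 - 2 * (i + 1)) / 2) - 2) * B +
      2 * ((n - 2 - 2 * (i + 1)) / 2) * (2 * ((n - 2 - 2 * (i + 1)) / 2) + 2) * t ^ 2 * A) =
      -(navConst n i * B) - navConst n i / (2 * i + 2) * (n - 2 - 2 * i) * t ^ 2 * A := by
    field_simp; ring
  rw [e]
  have h4 : (0 : ℝ) ≤ n - 2 - 2 * i := by linarith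
  have : 0 ≤ navConst n i / (2 * i + 2) * (n - 2 - 2 * i) * t ^ 2 * A := by positivity
  linarith

/-- Induction on j, with the maximum principle applied to w ± u (j+1), where w is the convolution on
the right. For j = 0 the Laplacian of w is minus a mollification of η, and the slack in `h0` pays
for the mollification error; for larger j it is at most minus the previous bound. -/
theorem abs_evalE_le {n : ℕ} [NeZero n] {R t : ℝ} (ht : 0 < t) {u : ℕ → MvPolynomial (Fin n) ℝ}
    (hu : ∀ j, polyLap n (u (j + 1)) = -u j ∧ ∀ x : E n, ‖x‖ = R → evalE (u (j + 1)) x = 0) {η : E n → ℝ} (hη0 : ∀ x, 0 ≤ η x) {L : ℝ≥0}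
    (hL : LipschitzWith L η) (hc : HasCompactSupport η) (h0 : ∀ x : E n, ‖x‖ ≤ R → |evalE (u 0) x| ≤ η x - L * (2 * n * t))
    (j : ℕ) (hj : (2 : ℝ) + 2 * j < n) (x : E n) (hx : ‖x‖ ≤ R) :
    |evalE (u (j + 1)) x| ≤ ∫ y, η y * navKernel n t j (x - y) := by
  have hη := hL.continuous
  induction j using Nat.strong_induction_on generalizing x with
  | _ j ih =>
  suffices key : ∀ s : ℝ, |s| = 1 → 0 ≤ (∫ y, η y * navKernel n t j (x - y)) + s * evalE (u (j + 1)) x by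
    rw [abs_le]
    have a1 := key 1 (by simp)
    have a2 := key (-1) (by simp)
    constructor <;> linarith
  intro s hs
  set w : E n → ℝ := fun x => ∫ y, η y * navKernel n t j (x - y)
  have hw : ContDiff ℝ ∞ w := contDiff_integral_mul_sub (contDiff_navKernel ht j) hη hc
  have hint : ∀ (k : E n → ℝ) (z : E n), Continuous k → Integrable fun y => η y * k (z - y) := fun k z hk =>
    Continuous.integrable_of_hasCompactSupport (by fun_prop) hc.mul_right
  refine nonneg_of_laplacian_nonpos (NeZero.ne n) (R := R) (g := w + s • (evalE (u (j + 1)) : E n → ℝ))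
    ((contDiff_infty.1 hw 2).add ((contDiff_evalE _).const_smul s)) (fun z hz => ?_) (fun z hz => ?_) hx
  · rw [ContDiffAt.laplacian_add (f₁ := w) (f₂ := s • (evalE (u (j + 1)) : E n → ℝ)) (contDiff_infty.1 hw 2).contDiffAt ((contDiff_evalE _).const_smul s).contDiffAt, laplacian_smul s (contDiff_evalE _).contDiffAt,
      laplacian_evalE, (hu j).1, laplacian_integral_mul_sub (contDiff_navKernel ht j) hη hc]
    have hs1 : -|evalE (u j) z| ≤ s * evalE (u j) z := by
      have := neg_abs_le (s * evalE (u j) z)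
      rwa [abs_mul, hs, one_mul] at this
    have hneg : evalE (-u j) z = -evalE (u j) z := by simp [evalE]
    rw [hneg, smul_eq_mul]
    suffices h : ∫ y, η y * laplacian (navKernel n t j) (z - y) ≤ -|evalE (u j) z| by linarith
    rcases j with _ | j
    · have h1 := le_integral_mul_newtonKernel ht hL hc z
      have h2 := h0 z hz.le
      simp_rw [laplacian_navKernel_zero (by simpa using hj) ht, mul_neg]
      rw [integral_neg]
      linarith
    · push_cast at hj
      have h1 := ih j (Nat.lt_succ_self j) (by linarith) z hz.le
      refine le_trans ?_ (neg_le_neg h1)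
      rw [← integral_neg]
      have hΔc : Continuous (laplacian (navKernel n t (j + 1))) := by
        have h4 : laplacian (navKernel n t (j + 1)) = _ :=
          funext fun x => (laplacian_navKernel ht (j + 1) x).trans (congrArg _ (laplacian_regKernel _ ht x))
        rw [h4]
        have h5 := fun c => (contDiff_regKernel (n := n) c ht).continuous
        exact continuous_const.mul ((continuous_const.mul (h5 _)).add (continuous_const.mul (h5 _))).neg
      refine integral_mono (hint _ z hΔc) (hint _ z (contDiff_navKernel ht j).continuous).neg fun y => ?_
      have := laplacian_navKernel_succ (n := n) (i := j) (by linarith) ht (z - y)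
      have h3 := mul_le_mul_of_nonneg_left this (hη0 y)
      simp only
      linarith
  · have h1 : 0 ≤ w z := by
      refine integral_nonneg fun y => mul_nonneg (hη0 y) (mul_nonneg (navConst_pos j hj).le (regKernel_nonneg _ _ _))
    simp only [Pi.add_apply, Pi.smul_apply, (hu j).2 z hz, smul_zero, add_zero]
    exact h1

theorem locallyIntegrable_inv_norm {n : ℕ} [NeZero n] (hn : 2 ≤ n) : LocallyIntegrable fun x : E n => ‖x‖⁻¹ := by
  rw [locallyIntegrable_iff]
  intro k hk
  obtain ⟨r, hr⟩ := hk.isBounded.subset_ball (0 : E n)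
  refine IntegrableOn.mono_set ?_ hr
  have h := integrableOn_ball_norm_rpow (n := n) (a := 1) (by exact_mod_cast hn) r
  refine h.congr (Eventually.of_forall fun x => ?_)
  simp only
  rw [Real.rpow_neg_one]

theorem integrable_mul_inv_norm_sub {n : ℕ} [NeZero n] (hn : 2 ≤ n) {η : E n → ℝ} (hη : Continuous η) (hc : HasCompactSupport η) (x : E n) :
    Integrable fun y => η y * ‖x - y‖⁻¹ := by
  have h2 : Integrable fun z : E n => η (x - z) * ‖z‖⁻¹ :=
    (locallyIntegrable_inv_norm hn).integrable_smul_left_of_hasCompactSupport (g := fun z => η (x - z)) (by fun_prop)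
      (hc.comp_homeomorph (Homeomorph.subLeft x))
  have h3 := h2.comp_sub_left x
  simpa using h3

theorem continuous_integral_mul_inv_norm_sub {n : ℕ} [NeZero n] (hn : 2 ≤ n) {η : E n → ℝ} (hη : Continuous η) (hc : HasCompactSupport η) :
    Continuous fun x => ∫ y, η y * ‖x - y‖⁻¹ :=
  hc.continuous_convolution_left (ContinuousLinearMap.mul ℝ ℝ) hη (locallyIntegrable_inv_norm hn)

/-- Pairing the solution of the Navier problem with a bump is controlled by the fundamental solution of the operator. -/
theorem IsNavierSolution.abs_integral_le {m n : ℕ} [NeZero n] (hn : n = 2 * m + 1) (hm : m ≠ 0) {R : ℝ} (hR : 0 < R) {f W : E n → ℝ}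
    (hf : IntegrableOn f (Metric.ball 0 R))
    (h : IsNavierSolution (Metric.ball 0 R) f W) {ψ : E n → ℝ} (hψ : IsDensity R ψ) :
    |∫ x in Metric.ball 0 R, W x * ψ x| ≤
      ∫ x in Metric.ball 0 R, |f x| * (navConst n (m - 1) * ∫ y, ψ y * ‖x - y‖⁻¹) := by
  set B := Metric.ball (0 : E n) R with hB
  have hn2 : 2 ≤ n := by omega
  obtain ⟨χ, hχ, hχc, -, hχ1, hχ0⟩ := exists_smooth_cutoff (isCompact_closedBall (0 : E n) R) isOpen_univ (subset_univ _)
  have hcP := continuous_integral_mul_inv_norm_sub hn2 hψ.smooth.continuous hψ.compact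
  have hcX := continuous_integral_mul_inv_norm_sub hn2 hχ.continuous hχc
  set P : E n → ℝ := fun x => ∫ y, ψ y * ‖x - y‖⁻¹ with hP
  set X : E n → ℝ := fun x => ∫ y, χ y * ‖x - y‖⁻¹ with hX
  obtain ⟨D, hD⟩ := (isCompact_closedBall (0 : E n) R).exists_bound_of_continuousOn hcX.continuousOn
  obtain ⟨D', hD'⟩ := (isCompact_closedBall (0 : E n) R).exists_bound_of_continuousOn hcP.continuousOn
  have hm1 : (2 : ℝ) + 2 * (m - 1 : ℕ) < n := by
    have : 2 + 2 * (m - 1) < n := by omega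
    exact_mod_cast this
  have ha := navConst_pos (m - 1) hm1
  set a := navConst n (m - 1)
  have hfP : IntegrableOn (fun x => |f x| * (a * P x)) B := by
    refine Integrable.mul_bdd (c := a * D') hf.abs (by fun_prop) ((ae_restrict_iff' measurableSet_ball).2 (Eventually.of_forall fun x hx => ?_))
    rw [norm_mul, Real.norm_of_nonneg ha.le]
    exact mul_le_mul_of_nonneg_left (hD' x (Metric.ball_subset_closedBall hx)) ha.le
  have key : ∀ ε > 0, |∫ x in B, W x * ψ x| ≤ (∫ x in B, |f x| * (a * P x)) + ε * (3 * a * D * (∫ x in B, |f x|) + ∫ x in B, |W x|) := by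
    intro ε hε
    -- On the closed ball the added 3ε covers the error ε of the polynomial approximation and a
    -- mollification loss of at most ε.
    set η : E n → ℝ := fun x => ψ x + 3 * ε * χ x with hη
    have hηs : ContDiff ℝ ∞ η := hψ.smooth.add (contDiff_const.mul hχ)
    have hηc : HasCompactSupport η := hψ.compact.add hχc.mul_left
    have hη0 : ∀ x, 0 ≤ η x := fun x => add_nonneg (hψ.nonneg x) (mul_nonneg (by positivity) (hχ0 x).1)
    obtain ⟨L, hL⟩ := hηs.lipschitzWith_of_hasCompactSupport hηc (by simp)
    -- Makes L(2nt) ≤ ε; the added 1 covers L = 0.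
    set t := ε / (2 * n * L + 1) with ht
    have ht0 : 0 < t := by positivity
    have htL : L * (2 * n * t) ≤ ε := by
      rw [ht, mul_div_assoc', mul_div_assoc', div_le_iff₀ (by positivity)]
      nlinarith
    obtain ⟨p, hp⟩ := exists_evalE_near R hψ.smooth.continuous hε
    obtain ⟨u, rfl, hu⟩ := exists_polyLap_seq (NeZero.ne n) hR p
    have h0 : ∀ x : E n, ‖x‖ ≤ R → |evalE (u 0) x| ≤ η x - L * (2 * n * t) := by
      intro x hx
      have a1 := abs_lt.1 (hp x hx)
      have a2 := hψ.nonneg x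
      have a3 : χ x = 1 := hχ1 (by simpa using hx : x ∈ Metric.closedBall (0 : E n) R)
      simp only [hη, a3]
      rw [abs_le]
      constructor <;> linarith [a1.1, a1.2]
    have hbound : ∀ x ∈ B, |evalE (u m) x| ≤ a * P x + 3 * ε * a * D := by
      intro x hx
      have hx' : ‖x‖ ≤ R := by simpa using Metric.ball_subset_closedBall hx
      have h1 := abs_evalE_le ht0 hu hη0 hL hηc h0 (m - 1) hm1 x hx'
      rw [show m - 1 + 1 = m by omega] at h1
      have hi := integrable_mul_inv_norm_sub hn2 hηs.continuous hηc x
      have h2 : ∫ y, η y * navKernel n t (m - 1) (x - y) ≤ ∫ y, a * (η y * ‖x - y‖⁻¹) := by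
        refine integral_mono_ae ?_ (hi.const_mul a) ?_
        · have := (contDiff_navKernel (n := n) ht0 (m - 1)).continuous
          have := hηs.continuous
          exact Continuous.integrable_of_hasCompactSupport (by fun_prop) hηc.mul_right
        · filter_upwards [Measure.ae_ne volume x] with y hy
          have hxy : 0 < ‖x - y‖ := norm_pos_iff.2 (sub_ne_zero.2 hy.symm)
          have h3 : regKernel (((n : ℝ) - 2 - 2 * (m - 1 : ℕ)) / 2) t (x - y) ≤ ‖x - y‖⁻¹ := by
            -- At the last index the regularised kernel is (|x|²+t²)^{-1/2}, below |x|⁻¹ for every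
            -- t. The regularisation thus drops out of the final bound.
            have e : ((n : ℝ) - 2 - 2 * (m - 1 : ℕ)) / 2 = 1 / 2 := by
              rw [hn, Nat.cast_sub (by omega)]; push_cast; ring
            rw [e, regKernel, Real.rpow_neg (by positivity), ← Real.sqrt_eq_rpow]
            gcongr
            exact Real.le_sqrt_of_sq_le (by nlinarith)
          have h4 := mul_le_mul_of_nonneg_left h3 (mul_nonneg (hη0 y) ha.le)
          simp only [navKernel]
          linarith
      have h5 : ∫ y, η y * ‖x - y‖⁻¹ = P x + 3 * ε * X x := by
        have e : ∀ y, η y * ‖x - y‖⁻¹ = ψ y * ‖x - y‖⁻¹ + 3 * ε * (χ y * ‖x - y‖⁻¹) := fun y => by simp only [hη]; ring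
        simp_rw [e]
        rw [integral_add (integrable_mul_inv_norm_sub hn2 hψ.smooth.continuous hψ.compact x)
          ((integrable_mul_inv_norm_sub hn2 hχ.continuous hχc x).const_mul _), integral_const_mul]
      rw [integral_const_mul, h5] at h2
      have h6 := (le_abs_self _).trans (hD x (by simpa using hx'))
      have h7 : a * (3 * ε * X x) ≤ a * (3 * ε * D) := by gcongr
      linarith
    have hW := h.1
    have hWu : IntegrableOn (fun x => W x * evalE (u 0) x) B := by
      obtain ⟨c, hc⟩ := (isCompact_closedBall (0 : E n) R).exists_bound_of_continuousOn (contDiff_evalE (k := 0) (u 0)).continuous.continuousOn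
      exact Integrable.mul_bdd (c := c) hW ((contDiff_evalE (k := 0) (u 0)).continuous.aestronglyMeasurable)
        ((ae_restrict_iff' measurableSet_ball).2 (Eventually.of_forall fun x hx => hc x (Metric.ball_subset_closedBall hx)))
    have hWd : IntegrableOn (fun x => W x * (ψ x - evalE (u 0) x)) B := by
      refine Integrable.mul_bdd (c := ε) hW ((hψ.smooth.continuous.sub (contDiff_evalE (k := 0) (u 0)).continuous).aestronglyMeasurable)
        ((ae_restrict_iff' measurableSet_ball).2 (Eventually.of_forall fun x hx => ?_))
      rw [← norm_neg, neg_sub]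
      exact (hp x (by simpa using Metric.ball_subset_closedBall hx)).le
    have e1 : ∫ x in B, W x * ψ x = (∫ x in B, f x * evalE (u m) x) + ∫ x in B, W x * (ψ x - evalE (u 0) x) := by
      rw [← h.integral_mul_evalE hn hR hu, ← integral_add hWu hWd]
      congr 1; funext x; ring
    have e2 : |∫ x in B, f x * evalE (u m) x| ≤ ∫ x in B, (|f x| * (a * P x) + 3 * ε * a * D * |f x|) := by
      rw [← Real.norm_eq_abs]
      refine norm_integral_le_of_norm_le (hfP.add (hf.abs.const_mul _)) ((ae_restrict_iff' measurableSet_ball).2 (Eventually.of_forall fun x hx => ?_))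
      rw [norm_mul, Real.norm_eq_abs, Real.norm_eq_abs]
      have := mul_le_mul_of_nonneg_left (hbound x hx) (abs_nonneg (f x))
      linarith
    have e3 : |∫ x in B, W x * (ψ x - evalE (u 0) x)| ≤ ∫ x in B, ε * |W x| := by
      rw [← Real.norm_eq_abs]
      refine norm_integral_le_of_norm_le (hW.abs.const_mul _) ((ae_restrict_iff' measurableSet_ball).2 (Eventually.of_forall fun x hx => ?_))
      rw [norm_mul, Real.norm_eq_abs, Real.norm_eq_abs, mul_comm, abs_sub_comm]
      exact mul_le_mul_of_nonneg_right (hp x (by simpa using Metric.ball_subset_closedBall hx)).le (abs_nonneg _)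
    rw [integral_add hfP (hf.abs.const_mul _), integral_const_mul] at e2
    rw [integral_const_mul] at e3
    rw [e1]
    refine (abs_add_le _ _).trans ?_
    linarith
  have hlim : Tendsto (fun ε : ℝ => (∫ x in B, |f x| * (a * P x)) + ε * (3 * a * D * (∫ x in B, |f x|) + ∫ x in B, |W x|)) (𝓝[>] 0)
      (𝓝 (∫ x in B, |f x| * (a * P x))) := by
    have : Continuous fun ε : ℝ => (∫ x in B, |f x| * (a * P x)) + ε * (3 * a * D * (∫ x in B, |f x|) + ∫ x in B, |W x|) := by fun_prop
    simpa using (this.tendsto 0).mono_left nhdsWithin_le_nhds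
  exact ge_of_tendsto hlim (by filter_upwards [self_mem_nhdsWithin] with ε hε using key ε hε)

end SmoothKernel

/-! ### From pairings with bumps to pointwise kernel bounds. -/

/-- A normalised bump centred at x is an admissible density once its radius is below R - |x|. For
almost every x the pairings with shrinking bumps of bounded radius ratio converge to g x. -/
theorem ae_nonneg_of_forall_isDensity {n : ℕ} [NeZero n] {R : ℝ} {g : E n → ℝ} (hg : IntegrableOn g (Metric.ball 0 R))
    (h : ∀ ψ, IsDensity R ψ → 0 ≤ ∫ x in Metric.ball 0 R, g x * ψ x) : ∀ᵐ x : E n, x ∈ Metric.ball 0 R → 0 ≤ g x := by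
  set G := (Metric.ball (0 : E n) R).indicator g with hG
  have hGi : Integrable G := hg.integrable_indicator measurableSet_ball
  let φ : ℕ → ContDiffBump (0 : E n) := fun i => ⟨1 / (i + 1), 2 / (i + 1), by positivity, by gcongr; norm_num⟩
  have hlim : Tendsto (fun i => (φ i).rOut) atTop (𝓝 0) := by
    have := (tendsto_one_div_add_atTop_nhds_zero_nat (𝕜 := ℝ)).const_mul 2
    simpa [φ, div_eq_mul_inv] using this
  have hae := ContDiffBump.ae_convolution_tendsto_right_of_locallyIntegrable (μ := volume) (φ := φ) (K := 2) hlim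
    (Eventually.of_forall fun i => by simp only [φ]; rw [mul_one_div]) hGi.locallyIntegrable
  filter_upwards [hae] with x hx hxB
  have hGx : G x = g x := indicator_of_mem hxB g
  rw [← hGx]
  refine ge_of_tendsto hx ?_
  have hpos : 0 < R - ‖x‖ := by rw [mem_ball_zero_iff] at hxB; linarith
  filter_upwards [hlim.eventually (gt_mem_nhds hpos)] with i hi
  set ψ : E n → ℝ := fun y => (φ i).normed volume (x - y) with hψ
  have hden : IsDensity R ψ := by
    have hsupp : ∀ y, ψ y ≠ 0 → ‖x - y‖ < (φ i).rOut := fun y hy => by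
      have : x - y ∈ Function.support ((φ i).normed volume) := hy
      rw [ContDiffBump.support_normed_eq, mem_ball_zero_iff] at this
      exact this
    have hts : tsupport ψ ⊆ Metric.closedBall x (φ i).rOut := by
      refine closure_minimal (fun y hy => ?_) Metric.isClosed_closedBall
      rw [mem_closedBall_iff_norm, norm_sub_rev]
      exact (hsupp y hy).le
    refine ⟨?_, fun y => ContDiffBump.nonneg_normed _ _, ?_, fun y hy => ?_⟩
    · exact (ContDiffBump.contDiff_normed (φ i) (n := (⊤ : ℕ∞))).comp (contDiff_const.sub contDiff_id)
    · exact (isCompact_closedBall _ _).of_isClosed_subset (isClosed_tsupport _) hts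
    · have h1 := hts hy
      rw [mem_closedBall_iff_norm] at h1
      rw [mem_ball_zero_iff]
      linarith [norm_sub_norm_le y x]
  refine (h ψ hden).trans (le_of_eq ?_)
  rw [convolution_eq_swap, ← integral_indicator measurableSet_ball]
  congr 1
  funext y
  by_cases hy : y ∈ Metric.ball (0 : E n) R
  · simp [hG, hψ, hy, mul_comm]
  · simp [hG, hy]

section Kernel

variable {n : ℕ} {R : ℝ} {k f : E n → ℝ}

/-- Differences of points of the ball have norm below 2R. So k may be cut off there, and the
integrand comes from the convolution of two integrable functions. -/
theorem integrable_kernel_prod (hk : LocallyIntegrable k) (hf : IntegrableOn f (Metric.ball 0 R)) :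
    Integrable (fun p : E n × E n => f p.2 * k (p.1 - p.2)) ((volume.restrict (Metric.ball 0 R)).prod (volume.restrict (Metric.ball 0 R))) := by
  have h1 : Integrable ((Metric.ball (0 : E n) R).indicator f) := hf.integrable_indicator measurableSet_ball
  have h2 : Integrable ((Metric.ball (0 : E n) (2 * R)).indicator k) :=
    ((hk.integrableOn_isCompact (isCompact_closedBall 0 (2 * R))).mono_set Metric.ball_subset_closedBall).integrable_indicator measurableSet_ball
  have h3 := h1.convolution_integrand (ContinuousLinearMap.mul ℝ ℝ) h2
  rw [Measure.prod_restrict]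
  refine (h3.integrableOn (s := Metric.ball 0 R ×ˢ Metric.ball 0 R)).congr_fun ?_ (measurableSet_ball.prod measurableSet_ball)
  rintro ⟨y, x⟩ ⟨hy, hx⟩
  simp only [mem_ball_zero_iff] at hy hx
  have hxy : ‖y - x‖ < 2 * R := by linarith [norm_sub_le y x]
  simp [hx, hxy]

theorem integrableOn_integral_kernel (hk : LocallyIntegrable k) (hf : IntegrableOn f (Metric.ball 0 R)) :
    IntegrableOn (fun y => ∫ x in Metric.ball 0 R, f x * k (y - x)) (Metric.ball 0 R) :=
  (integrable_kernel_prod hk hf).integral_prod_left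

theorem integral_integral_kernel_mul (hk : LocallyIntegrable k) (hke : ∀ x, k (-x) = k x) (hf : IntegrableOn f (Metric.ball 0 R))
    {ψ : E n → ℝ} (hψ : IsDensity R ψ) :
    ∫ y in Metric.ball 0 R, (∫ x in Metric.ball 0 R, f x * k (y - x)) * ψ y =
      ∫ x in Metric.ball 0 R, f x * ∫ y, ψ y * k (x - y) := by
  obtain ⟨C, hC⟩ := hψ.compact.exists_bound_of_continuous hψ.smooth.continuous
  have h1 : Integrable (fun p : E n × E n => f p.2 * k (p.1 - p.2) * ψ p.1) ((volume.restrict (Metric.ball 0 R)).prod (volume.restrict (Metric.ball 0 R))) :=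
    (integrable_kernel_prod hk hf).mul_bdd (c := C) (by have := hψ.smooth.continuous; fun_prop) (Eventually.of_forall fun p => hC _)
  simp_rw [← integral_mul_const]
  rw [integral_integral_swap h1]
  refine integral_congr_ae (Eventually.of_forall fun x => ?_)
  simp only
  rw [← integral_const_mul, ← integral_indicator measurableSet_ball]
  congr 1
  funext y
  by_cases hy : y ∈ Metric.ball (0 : E n) R
  · rw [indicator_of_mem hy, ← neg_sub x y, hke]; ring
  · rw [indicator_of_notMem hy, hψ.eq_zero y (by simpa using hy)]; ring

/-- Comparison in duality with bumps gives pointwise domination by a potential. -/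
theorem ae_abs_le_of_forall_isDensity [NeZero n] {v : E n → ℝ} (hv : IntegrableOn v (Metric.ball 0 R)) (hk : LocallyIntegrable k) (hke : ∀ x, k (-x) = k x)
    (hf : IntegrableOn f (Metric.ball 0 R)) {c : ℝ}
    (h : ∀ ψ, IsDensity R ψ → |∫ x in Metric.ball 0 R, v x * ψ x| ≤ ∫ x in Metric.ball 0 R, |f x| * (c * ∫ y, ψ y * k (x - y))) :
    ∀ᵐ y : E n, y ∈ Metric.ball 0 R → |v y| ≤ c * ∫ x in Metric.ball 0 R, |f x| * k (y - x) := by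
  have hG := (integrableOn_integral_kernel hk hf.abs).const_mul c
  have key : ∀ s : ℝ, |s| = 1 → ∀ᵐ y : E n, y ∈ Metric.ball 0 R → 0 ≤ c * (∫ x in Metric.ball 0 R, |f x| * k (y - x)) + s * v y := by
    intro s hs
    refine ae_nonneg_of_forall_isDensity (hG.add (hv.const_mul s)) fun ψ hψ => ?_
    obtain ⟨C, hC⟩ := hψ.compact.exists_bound_of_continuous hψ.smooth.continuous
    have hi1 : IntegrableOn (fun y => c * (∫ x in Metric.ball 0 R, |f x| * k (y - x)) * ψ y) (Metric.ball 0 R) :=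
      Integrable.mul_bdd (c := C) hG hψ.smooth.continuous.aestronglyMeasurable (Eventually.of_forall hC)
    have hi2 : IntegrableOn (fun y => v y * ψ y) (Metric.ball 0 R) :=
      Integrable.mul_bdd (c := C) hv hψ.smooth.continuous.aestronglyMeasurable (Eventually.of_forall hC)
    have e : ∀ y, (c * (∫ x in Metric.ball 0 R, |f x| * k (y - x)) + s * v y) * ψ y =
      c * (∫ x in Metric.ball 0 R, |f x| * k (y - x)) * ψ y + s * (v y * ψ y) := fun y => by ring
    simp_rw [e]
    rw [integral_add hi1 (hi2.const_mul s), integral_const_mul]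
    simp_rw [mul_assoc c]
    rw [integral_const_mul, integral_integral_kernel_mul hk hke hf.abs hψ]
    have h1 := h ψ hψ
    simp_rw [mul_left_comm _ c] at h1
    rw [integral_const_mul] at h1
    have h2 := neg_abs_le (s * ∫ x in Metric.ball 0 R, v x * ψ x)
    rw [abs_mul, hs, one_mul] at h2
    linarith
  filter_upwards [key 1 (by simp), key (-1) (by simp)] with y h1 h2 hy
  rw [abs_le]
  constructor <;> linarith [h1 hy, h2 hy]

end Kernel

/-- The `W` of a very weak solution is controlled by a potential of the right-hand side. -/
theorem IsNavierSolution.ae_abs_le {m n : ℕ} [NeZero n] (hn : n = 2 * m + 1) (hm : m ≠ 0) {R : ℝ} (hR : 0 < R) {f W : E n → ℝ}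
    (hf : IntegrableOn f (Metric.ball 0 R)) (h : IsNavierSolution (Metric.ball 0 R) f W) :
    ∀ᵐ y : E n, y ∈ Metric.ball 0 R → |W y| ≤ navConst n (m - 1) * ∫ x in Metric.ball 0 R, |f x| * ‖y - x‖⁻¹ :=
  ae_abs_le_of_forall_isDensity (k := fun x => ‖x‖⁻¹) h.1 (locallyIntegrable_inv_norm (by omega)) (fun x => by rw [norm_neg]) hf
    fun _ hψ => h.abs_integral_le hn hm hR hf hψ

/-- The test function is `greenPot m R ψ`: its half-Laplacian is ψ in the ball, and its values
outside are irrelevant because u vanishes there. Only 0 ≤ `greenPot` ≤ Riesz potential is then used.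
-/
theorem ae_abs_le_of_dirichlet {m n : ℕ} [NeZero n] (hn : n = 2 * m + 1) (hm : m ≠ 0) {R : ℝ} (hR : 0 < R) {u W : E n → ℝ}
    (hu : IntegrableOn u (Metric.ball 0 R)) (hW : IntegrableOn W (Metric.ball 0 R)) (hu0 : ∀ᵐ x : E n, x ∉ Metric.ball 0 R → u x = 0)
    (h : ∀ φ : E n → ℝ, IsTest₁ (Metric.ball 0 R) φ → ∫ x, u x * halfLaplacian φ x = ∫ x in Metric.ball 0 R, W x * φ x) :
    ∀ᵐ y : E n, y ∈ Metric.ball 0 R → |u y| ≤ rieszConst n * ∫ x in Metric.ball 0 R, |W x| * (‖y - x‖ ^ (2 * m))⁻¹ := by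
  refine ae_abs_le_of_forall_isDensity (k := fun x => (‖x‖ ^ (2 * m))⁻¹) hu (locallyIntegrable_riesz hn) (fun x => by rw [norm_neg]) hW fun ψ hψ => ?_
  have h1 := h _ (hψ.isTest₁_greenPot hn hm hR)
  have h2 : ∫ x, u x * halfLaplacian (greenPot m R ψ) x = ∫ x in Metric.ball 0 R, u x * ψ x := by
    rw [← integral_indicator measurableSet_ball]
    refine integral_congr_ae ?_
    filter_upwards [hu0] with x hx
    by_cases hxB : x ∈ Metric.ball (0 : E n) R
    · rw [indicator_of_mem hxB, hψ.halfLaplacian_greenPot hn hm hR (by simpa using hxB)]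
    · rw [indicator_of_notMem hxB, hx hxB, zero_mul]
  rw [← h2, h1, ← Real.norm_eq_abs]
  have hcont : Continuous fun x => ∫ y, ψ y * (‖x - y‖ ^ (2 * m))⁻¹ :=
    hψ.compact.continuous_convolution_left (ContinuousLinearMap.mul ℝ ℝ) hψ.smooth.continuous (locallyIntegrable_riesz (n := n) hn)
  obtain ⟨C, hC⟩ := (isCompact_closedBall (0 : E n) R).exists_bound_of_continuousOn hcont.continuousOn
  have hr := rieszConst_pos hn hm
  refine norm_integral_le_of_norm_le ?_ ((ae_restrict_iff' measurableSet_ball).2 (Eventually.of_forall fun x hx => ?_))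
  · refine Integrable.mul_bdd (c := rieszConst n * C) hW.abs (continuous_const.mul hcont).aestronglyMeasurable ((ae_restrict_iff' measurableSet_ball).2 (Eventually.of_forall fun x hx => ?_))
    rw [norm_mul, Real.norm_of_nonneg hr.le]
    exact mul_le_mul_of_nonneg_left (hC x (Metric.ball_subset_closedBall hx)) hr.le
  · rw [norm_mul, Real.norm_eq_abs, Real.norm_of_nonneg (hψ.greenPot_nonneg hn hm hR x)]
    exact mul_le_mul_of_nonneg_left (hψ.greenPot_le hn hm x) (abs_nonneg _)

/-! ### The sharp constant and the composition of the two kernels. -/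

/-- The factors are m!/(2m π^{m+1}) and 1/(|S^{n-1}| (2m-1)!), so the product is m!/(π^{m+1} (2m)!).
This is 1/γₙ, since |Sⁿ| = 2π^{m+1}/m!. -/
theorem rieszConst_mul_navConst {m n : ℕ} [NeZero n] (hn : n = 2 * m + 1) (hm : m ≠ 0) :
    rieszConst n * navConst n (m - 1) * sphArea n = 1 / gammaConst n := by
  have h1 := rieszConst_eq (n := n) hn
  subst hn
  have hσ := sphArea_pos (2 * m + 1)
  have h2 := navConst_last (m := m) (m - 1) (by omega)
  have h3 : ((2 * m).factorial : ℝ) = 2 * m * (2 * m - 1).factorial := by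
    rw [← Nat.mul_factorial_pred (by omega : 2 * m ≠ 0)]; push_cast; ring
  have hm' : (0 : ℝ) < m := by positivity
  rw [h1, h2, gammaConst, toSphere_real_univ_even, show 2 * m + 1 - 1 = 2 * m by omega, h3]
  have := Real.pi_pos
  field_simp

theorem gammaConst_pos {m n : ℕ} (hn : n = 2 * m + 1) : 0 < gammaConst n := by
  subst hn
  have := Real.pi_pos
  rw [gammaConst, toSphere_real_univ_even]
  positivity

theorem lintegral_radial_sub {n : ℕ} [NeZero n] {f : ℝ → ℝ≥0∞} (hf : Measurable f) (y : E n) :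
    ∫⁻ x : E n, f ‖x - y‖ = ENNReal.ofReal (sphArea n) * ∫⁻ r in Ioi (0 : ℝ), ENNReal.ofReal (r ^ (n - 1)) * f r := by
  rw [lintegral_sub_right_eq_self (fun x => f ‖x‖) y, lintegral_radial hf, sphMeas_univ_eq]

/-- The antiderivative log r - 2d/r, taken between 2d and 2R, gives log(R/d) + 1 - d/R. The
logarithm has coefficient one. -/
theorem lintegral_log_kernel {d R : ℝ} (hd : 0 < d) (hdR : d < 2 * R) (m : ℕ) :
    ∫⁻ r in Ioi (0 : ℝ), ENNReal.ofReal (r ^ (2 * m)) * (Ico (2 * d) (2 * R)).indicator (fun r => ENNReal.ofReal ((r ^ (2 * m))⁻¹ * (r⁻¹ + 2 * d * (r ^ 2)⁻¹))) r ≤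
      ENNReal.ofReal (Real.log (R / d) + 1) := by
  have hR : 0 < R := by linarith
  have e : ∀ r ∈ Ioi (0 : ℝ), ENNReal.ofReal (r ^ (2 * m)) * (Ico (2 * d) (2 * R)).indicator (fun r => ENNReal.ofReal ((r ^ (2 * m))⁻¹ * (r⁻¹ + 2 * d * (r ^ 2)⁻¹))) r =
      (Ico (2 * d) (2 * R)).indicator (fun r => ENNReal.ofReal (r⁻¹ + 2 * d * (r ^ 2)⁻¹)) r := by
    intro r hr
    have hr' := mem_Ioi.1 hr
    by_cases h : r ∈ Ico (2 * d) (2 * R)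
    · rw [indicator_of_mem h, indicator_of_mem h, ← ENNReal.ofReal_mul (by positivity), mul_inv_cancel_left₀ (by positivity)]
    · rw [indicator_of_notMem h, indicator_of_notMem h, mul_zero]
  rw [setLIntegral_congr_fun measurableSet_Ioi e]
  refine (setLIntegral_le_lintegral _ _).trans ?_
  rw [lintegral_indicator measurableSet_Ico]
  rcases le_or_gt R d with h | h
  · rw [Ico_eq_empty (by linarith)]; simp
  have hab : 2 * d ≤ 2 * R := by linarith
  have hder : ∀ r ∈ uIcc (2 * d) (2 * R), HasDerivAt (fun r => Real.log r - 2 * d * r⁻¹) (r⁻¹ + 2 * d * (r ^ 2)⁻¹) r := by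
    intro r hr
    rw [uIcc_of_le hab] at hr
    have hr0 : r ≠ 0 := by have := hr.1; exact (by linarith : 0 < r).ne'
    refine ((Real.hasDerivAt_log hr0).sub ((hasDerivAt_inv hr0).const_mul (2 * d))).congr_deriv ?_
    ring
  have hcont : ContinuousOn (fun r : ℝ => r⁻¹ + 2 * d * (r ^ 2)⁻¹) (uIcc (2 * d) (2 * R)) := by
    rw [uIcc_of_le hab]
    intro r hr
    have hr0 : r ≠ 0 := by have := hr.1; exact (by linarith : 0 < r).ne'
    exact ContinuousAt.continuousWithinAt (by fun_prop (disch := positivity))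
  have hint := hcont.intervalIntegrable (μ := volume)
  have hval := intervalIntegral.integral_eq_sub_of_hasDerivAt hder hint
  rw [intervalIntegral.integral_of_le hab] at hval
  rw [restrict_Ico_eq_restrict_Ioc, ← ofReal_integral_eq_lintegral_ofReal hint.1 ?_, hval]
  · refine ENNReal.ofReal_le_ofReal ?_
    rw [Real.log_mul two_ne_zero hR.ne', Real.log_mul two_ne_zero hd.ne', Real.log_div hR.ne' hd.ne']
    have h1 : 2 * d * (2 * d)⁻¹ = 1 := mul_inv_cancel₀ (by positivity)
    have h2 : 0 ≤ 2 * d * (2 * R)⁻¹ := by positivity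
    linarith
  · refine (ae_restrict_iff' measurableSet_Ioc).2 (Eventually.of_forall fun r hr => ?_)
    have := hr.1
    have : 0 < r := by linarith
    simp only [Pi.zero_apply]; positivity

/-- With d = |y-z| the ball splits into |x-y| ≥ 2d, the part of |x-y| < 2d with |x-z| ≥ d/2, and the
part with |x-z| < d/2. These contribute at most log(R/d) + 1, 4 and 1 times the sphere area. Only
the first produces the logarithm, with the exact coefficient that the threshold γₙ requires. -/
theorem lintegral_kernel_le {m n : ℕ} [NeZero n] (hn : n = 2 * m + 1) (hm : m ≠ 0) {R : ℝ} {y z : E n} (hy : ‖y‖ < R) (hz : ‖z‖ < R) (hyz : y ≠ z) :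
    ∫⁻ x in Metric.ball (0 : E n) R, ENNReal.ofReal ((‖y - x‖ ^ (2 * m))⁻¹) * ENNReal.ofReal ‖x - z‖⁻¹ ≤
      ENNReal.ofReal (sphArea n * (Real.log (R / ‖y - z‖) + 6)) := by
  set d := ‖y - z‖ with hd
  have hd0 : 0 < d := norm_pos_iff.2 (sub_ne_zero.2 hyz)
  have hR : 0 < R := (norm_nonneg y).trans_lt hy
  have hd2 : d < 2 * R := by linarith [norm_sub_le y z]
  have hσ := sphArea_pos n
  set fA : ℝ → ℝ≥0∞ := (Ico (2 * d) (2 * R)).indicator fun r => ENNReal.ofReal ((r ^ (2 * m))⁻¹ * (r⁻¹ + 2 * d * (r ^ 2)⁻¹)) with hfA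
  set fB : ℝ → ℝ≥0∞ := (Iio (2 * d)).indicator fun r => ENNReal.ofReal ((r ^ (2 * m))⁻¹ * (2 / d)) with hfB
  set fC : ℝ → ℝ≥0∞ := (Iio (d / 2)).indicator fun r => ENNReal.ofReal (((d / 2) ^ (2 * m))⁻¹ * r⁻¹) with hfC
  have mA : Measurable fA := Measurable.indicator (by fun_prop) measurableSet_Ico
  have mB : Measurable fB := Measurable.indicator (by fun_prop) measurableSet_Iio
  have mC : Measurable fC := Measurable.indicator (by fun_prop) measurableSet_Iio
  have hpt : ∀ x ∈ Metric.ball (0 : E n) R, ENNReal.ofReal ((‖y - x‖ ^ (2 * m))⁻¹) * ENNReal.ofReal ‖x - z‖⁻¹ ≤ fA ‖x - y‖ + (fB ‖x - y‖ + fC ‖x - z‖) := by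
    intro x hx
    rw [mem_ball_zero_iff] at hx
    rw [← ENNReal.ofReal_mul (by positivity), norm_sub_rev y x]
    have t1 : ‖x - y‖ < 2 * R := by linarith [norm_sub_le x y]
    have t2 : ‖x - y‖ ≤ ‖x - z‖ + d := by
      have := norm_sub_le_norm_sub_add_norm_sub x z y
      rwa [norm_sub_rev z y] at this
    have t3 : d ≤ ‖x - y‖ + ‖x - z‖ := by
      have := norm_sub_le_norm_sub_add_norm_sub y x z
      rwa [norm_sub_rev y x] at this
    have p1 := norm_nonneg (x - y)
    have p2 := norm_nonneg (x - z)
    generalize ‖x - y‖ = r at *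
    generalize ‖x - z‖ = q at *
    rcases lt_or_ge r (2 * d) with h1 | h1
    · rcases lt_or_ge q (d / 2) with h2 | h2
      · refine le_add_left (le_add_left ?_)
        rw [hfC, indicator_of_mem (mem_Iio.2 h2)]
        refine ENNReal.ofReal_le_ofReal ?_
        have : d / 2 ≤ r := by linarith
        gcongr
      · refine le_add_left (le_add_right ?_)
        rw [hfB, indicator_of_mem (mem_Iio.2 h1)]
        refine ENNReal.ofReal_le_ofReal ?_
        rw [← inv_div]
        gcongr
    · refine le_add_right ?_
      rw [hfA, indicator_of_mem (mem_Ico.2 ⟨h1, t1⟩)]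
      refine ENNReal.ofReal_le_ofReal ?_
      refine mul_le_mul_of_nonneg_left ?_ (by positivity)
      have hr0 : 0 < r := by linarith
      have hq : r - d ≤ q := by linarith
      have hrd : 0 < r - d := by linarith
      -- A cruder bound such as 2/r would double the coefficient of the logarithm. The correction
      -- 2d/r² is integrable on r ≥ 2d and costs a constant.
      calc q⁻¹ ≤ (r - d)⁻¹ := by gcongr
        _ ≤ r⁻¹ + 2 * d * (r ^ 2)⁻¹ := by
          rw [inv_eq_one_div, div_le_iff₀ hrd]
          have : (r⁻¹ + 2 * d * (r ^ 2)⁻¹) * (r - d) = 1 + d * (r - 2 * d) * (r ^ 2)⁻¹ := by field_simp; ring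
          rw [this]
          have : 0 ≤ d * (r - 2 * d) * (r ^ 2)⁻¹ := mul_nonneg (mul_nonneg hd0.le (by linarith)) (by positivity)
          linarith
  have hlog : 0 ≤ Real.log (R / d) + 1 := by
    have h1 : Real.log (1 / 2) ≤ Real.log (R / d) := Real.log_le_log (by norm_num) (by rw [div_le_div_iff₀ (by norm_num) hd0]; linarith)
    have h2 := Real.log_two_lt_d9
    rw [one_div, Real.log_inv] at h1
    linarith
  have e2m : n - 1 = 2 * m := by omega
  have iB : ∫⁻ r in Ioi (0 : ℝ), ENNReal.ofReal (r ^ (2 * m)) * fB r ≤ ENNReal.ofReal 4 := by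
    have e : ∀ r ∈ Ioi (0 : ℝ), ENNReal.ofReal (r ^ (2 * m)) * fB r = (Iio (2 * d)).indicator (fun _ => ENNReal.ofReal (2 / d)) r := by
      intro r hr
      have hr' := mem_Ioi.1 hr
      by_cases h : r ∈ Iio (2 * d)
      · rw [hfB, indicator_of_mem h, indicator_of_mem h, ← ENNReal.ofReal_mul (by positivity), mul_inv_cancel_left₀ (by positivity)]
      · rw [hfB, indicator_of_notMem h, indicator_of_notMem h, mul_zero]
    rw [setLIntegral_congr_fun measurableSet_Ioi e, lintegral_indicator measurableSet_Iio, setLIntegral_const, Measure.restrict_apply measurableSet_Iio,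
      Iio_inter_Ioi, Real.volume_Ioo, ← ENNReal.ofReal_mul (by positivity)]
    refine ENNReal.ofReal_le_ofReal (le_of_eq ?_)
    field_simp; ring
  have iC : ∫⁻ r in Ioi (0 : ℝ), ENNReal.ofReal (r ^ (2 * m)) * fC r ≤ ENNReal.ofReal 1 := by
    have e : ∀ r ∈ Ioi (0 : ℝ), ENNReal.ofReal (r ^ (2 * m)) * fC r ≤ (Iio (d / 2)).indicator (fun _ => ENNReal.ofReal (d / 2)⁻¹) r := by
      intro r hr
      have hr' := mem_Ioi.1 hr
      by_cases h : r ∈ Iio (d / 2)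
      · rw [hfC, indicator_of_mem h, indicator_of_mem h, ← ENNReal.ofReal_mul (by positivity)]
        refine ENNReal.ofReal_le_ofReal ?_
        obtain ⟨k, rfl⟩ : ∃ k, m = k + 1 := ⟨m - 1, by omega⟩
        have h' : r ≤ d / 2 := (mem_Iio.1 h).le
        rw [show 2 * (k + 1) = 2 * k + 1 + 1 by ring]
        calc r ^ (2 * k + 1 + 1) * (((d / 2) ^ (2 * k + 1 + 1))⁻¹ * r⁻¹) = r ^ (2 * k + 1) * ((d / 2) ^ (2 * k + 1 + 1))⁻¹ := by
              rw [pow_succ r]; field_simp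
          _ ≤ (d / 2) ^ (2 * k + 1) * ((d / 2) ^ (2 * k + 1 + 1))⁻¹ := by gcongr
          _ = (d / 2)⁻¹ := by rw [pow_succ (d / 2) (2 * k + 1)]; field_simp
      · rw [hfC, indicator_of_notMem h, mul_zero]; exact zero_le
    refine (setLIntegral_mono (measurable_const.indicator measurableSet_Iio) e).trans ?_
    rw [lintegral_indicator measurableSet_Iio, setLIntegral_const, Measure.restrict_apply measurableSet_Iio,
      Iio_inter_Ioi, Real.volume_Ioo, ← ENNReal.ofReal_mul (by positivity)]
    refine ENNReal.ofReal_le_ofReal (le_of_eq ?_)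
    field_simp; ring
  calc ∫⁻ x in Metric.ball (0 : E n) R, ENNReal.ofReal ((‖y - x‖ ^ (2 * m))⁻¹) * ENNReal.ofReal ‖x - z‖⁻¹
      ≤ ∫⁻ x in Metric.ball (0 : E n) R, (fA ‖x - y‖ + (fB ‖x - y‖ + fC ‖x - z‖)) := setLIntegral_mono (by fun_prop) hpt
    _ ≤ ∫⁻ x, (fA ‖x - y‖ + (fB ‖x - y‖ + fC ‖x - z‖)) := setLIntegral_le_lintegral _ _
    _ = ENNReal.ofReal (sphArea n) * ((∫⁻ r in Ioi (0 : ℝ), ENNReal.ofReal (r ^ (2 * m)) * fA r) +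
        ((∫⁻ r in Ioi (0 : ℝ), ENNReal.ofReal (r ^ (2 * m)) * fB r) + ∫⁻ r in Ioi (0 : ℝ), ENNReal.ofReal (r ^ (2 * m)) * fC r)) := by
        rw [lintegral_add_left (by fun_prop), lintegral_add_left (by fun_prop), lintegral_radial_sub mA, lintegral_radial_sub mB, lintegral_radial_sub mC,
          e2m, mul_add, mul_add]
    _ ≤ ENNReal.ofReal (sphArea n) * (ENNReal.ofReal (Real.log (R / d) + 1) + (ENNReal.ofReal 4 + ENNReal.ofReal 1)) := by
        gcongr
        exact lintegral_log_kernel hd0 hd2 m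
    _ = _ := by
        rw [← ENNReal.ofReal_add (by norm_num) (by norm_num), ← ENNReal.ofReal_add hlog (by norm_num), ← ENNReal.ofReal_mul hσ.le]
        congr 1; ring

/-! ### Jensen's inequality, the logarithmic bound for solutions and the dominating density. -/

/-- Exponential integrability of logarithmic potentials of probability measures, by Jensen's inequality. -/
theorem lintegral_exp_le {n : ℕ} [NeZero n] {R D s : ℝ} (hs : 0 < s) (hD : 2 * R ≤ D) (hR : 0 < R) {μ : Measure (E n)} [IsProbabilityMeasure μ]
    (hμ : μ ≪ volume) (hμB : ∀ᵐ z ∂μ, ‖z‖ < R) {v : E n → ℝ}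
    (hv : ∀ᵐ y : E n, y ∈ Metric.ball 0 R → ENNReal.ofReal |v y| ≤ ∫⁻ z, ENNReal.ofReal (s * Real.log (D / ‖y - z‖)) ∂μ) :
    ∫⁻ y in Metric.ball (0 : E n) R, ENNReal.ofReal (Real.exp |v y|) ≤ ∫⁻ w in Metric.ball (0 : E n) (2 * R), ENNReal.ofReal ((D / ‖w‖) ^ s) := by
  have hD0 : 0 < D := by linarith
  have key : ∀ y ∈ Metric.ball (0 : E n) R, ENNReal.ofReal |v y| ≤ ∫⁻ z, ENNReal.ofReal (s * Real.log (D / ‖y - z‖)) ∂μ →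
      ENNReal.ofReal (Real.exp |v y|) ≤ ∫⁻ z, ENNReal.ofReal ((D / ‖y - z‖) ^ s) ∂μ := by
    intro y hy hle
    rw [mem_ball_zero_iff] at hy
    by_cases hfin : ∫⁻ z, ENNReal.ofReal ((D / ‖y - z‖) ^ s) ∂μ = ⊤
    · rw [hfin]; exact le_top
    have hgood : ∀ᵐ z ∂μ, 0 ≤ s * Real.log (D / ‖y - z‖) ∧ Real.exp (s * Real.log (D / ‖y - z‖)) = (D / ‖y - z‖) ^ s := by
      filter_upwards [hμB, hμ.ae_le (Measure.ae_ne volume y)] with z hz hzy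
      have h0 : 0 < ‖y - z‖ := norm_pos_iff.2 (sub_ne_zero.2 hzy.symm)
      have h1 : ‖y - z‖ ≤ D := by linarith [norm_sub_le y z]
      refine ⟨mul_nonneg hs.le (Real.log_nonneg ((one_le_div h0).2 h1)), ?_⟩
      rw [Real.rpow_def_of_pos (by positivity), mul_comm]
    have hi1 : Integrable (fun z => (D / ‖y - z‖) ^ s) μ := by
      refine ⟨Measurable.aestronglyMeasurable (Measurable.pow_const (by fun_prop) s), ?_⟩
      rw [hasFiniteIntegral_iff_ofReal (Eventually.of_forall fun z => by positivity)]
      exact lt_top_iff_ne_top.2 hfin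
    have hi2 : Integrable (fun z => Real.exp (s * Real.log (D / ‖y - z‖))) μ := hi1.congr (hgood.mono fun z hz => hz.2.symm)
    -- The nonnegative exponent lies below its exponential, so finiteness of the exponential mean
    -- supplies all that Jensen requires; the infinite case is trivial.
    have hi3 : Integrable (fun z => s * Real.log (D / ‖y - z‖)) μ := by
      refine hi2.mono' (((Real.measurable_log.comp (by fun_prop : Measurable fun z => D / ‖y - z‖)).const_mul s).aestronglyMeasurable) (hgood.mono fun z hz => ?_)
      rw [Real.norm_of_nonneg hz.1]
      linarith [Real.add_one_le_exp (s * Real.log (D / ‖y - z‖))]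
    have hJ := convexOn_exp.map_integral_le Real.continuous_exp.continuousOn isClosed_univ (Eventually.of_forall fun z => mem_univ _) hi3 hi2
    rw [← ofReal_integral_eq_lintegral_ofReal hi3 (hgood.mono fun z hz => hz.1)] at hle
    rw [← ofReal_integral_eq_lintegral_ofReal hi1 (Eventually.of_forall fun z => by simp only [Pi.zero_apply]; positivity)]
    refine ENNReal.ofReal_le_ofReal ?_
    have h0 : 0 ≤ ∫ z, s * Real.log (D / ‖y - z‖) ∂μ := integral_nonneg_of_ae (hgood.mono fun z hz => hz.1)
    rw [ENNReal.ofReal_le_ofReal_iff h0] at hle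
    refine (Real.exp_le_exp.2 hle).trans (hJ.trans (le_of_eq ?_))
    exact integral_congr_ae (hgood.mono fun z hz => hz.2)
  have hm : Measurable fun p : E n × E n => ENNReal.ofReal ((D / ‖p.1 - p.2‖) ^ s) := by fun_prop
  calc ∫⁻ y in Metric.ball (0 : E n) R, ENNReal.ofReal (Real.exp |v y|)
      ≤ ∫⁻ y in Metric.ball (0 : E n) R, ∫⁻ z, ENNReal.ofReal ((D / ‖y - z‖) ^ s) ∂μ := by
        refine lintegral_mono_ae ((ae_restrict_iff' measurableSet_ball).2 ?_)
        filter_upwards [hv] with y h1 hy using key y hy (h1 hy)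
    _ = ∫⁻ z, (∫⁻ y in Metric.ball (0 : E n) R, ENNReal.ofReal ((D / ‖y - z‖) ^ s)) ∂μ := lintegral_lintegral_swap hm.aemeasurable
    _ ≤ ∫⁻ z, (∫⁻ w in Metric.ball (0 : E n) (2 * R), ENNReal.ofReal ((D / ‖w‖) ^ s)) ∂μ := by
        refine lintegral_mono_ae (hμB.mono fun z hz => ?_)
        -- Translation by z sends the ball into the centred one of radius 2R, which makes the bound
        -- independent of z and hence of μ.
        rw [← lintegral_indicator measurableSet_ball, ← lintegral_indicator measurableSet_ball, ← lintegral_sub_right_eq_self (fun w => (Metric.ball (0 : E n) (2 * R)).indicator (fun w => ENNReal.ofReal ((D / ‖w‖) ^ s)) w) z]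
        refine lintegral_mono fun y => ?_
        by_cases hy : y ∈ Metric.ball (0 : E n) R
        · rw [indicator_of_mem hy, indicator_of_mem]
          rw [mem_ball_zero_iff] at hy ⊢
          linarith [norm_sub_le y z]
        · rw [indicator_of_notMem hy]; exact zero_le
    _ = _ := by simp

/-- Holds without integrability, because the Bochner integral is then 0. It moves the kernel bounds
to `ℝ≥0∞`, where Tonelli needs no finiteness. -/
theorem ofReal_integral_le_lintegral {α : Type*} [MeasurableSpace α] {μ : Measure α} {g : α → ℝ} (hg : ∀ x, 0 ≤ g x) :
    ENNReal.ofReal (∫ x, g x ∂μ) ≤ ∫⁻ x, ENNReal.ofReal (g x) ∂μ := by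
  by_cases h : Integrable g μ
  · rw [ofReal_integral_eq_lintegral_ofReal h (Eventually.of_forall hg)]
  · rw [integral_undef h]; simp

/-- Solutions vanishing outside the ball are dominated by a sharp logarithmic potential of the right-hand side. -/
theorem IsSolution.ae_le_log_potential {m n : ℕ} [NeZero n] (hn : n = 2 * m + 1) (hm : m ≠ 0) {R : ℝ} (hR : 0 < R) {f u : E n → ℝ}
    (hf : IntegrableOn f (Metric.ball 0 R)) (hu : IntegrableOn u (Metric.ball 0 R)) (h : IsSolution (Metric.ball 0 R) f u)
    (hu0 : ∀ᵐ x : E n, x ∉ Metric.ball 0 R → u x = 0) :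
    ∀ᵐ y : E n, y ∈ Metric.ball 0 R → ENNReal.ofReal |u y| ≤
      ∫⁻ z in Metric.ball 0 R, ENNReal.ofReal |f z| * ENNReal.ofReal (1 / gammaConst n * Real.log (R * Real.exp 6 / ‖y - z‖)) := by
  obtain ⟨-, -, W, h1, h2⟩ := h
  have hW := h2.ae_abs_le hn hm hR hf
  have hU := ae_abs_le_of_dirichlet hn hm hR hu h2.1 hu0 h1
  set a := navConst n (m - 1) with ha
  set c := rieszConst n with hc
  have hc0 : 0 < c := rieszConst_pos hn hm
  have ha0 : 0 < a := navConst_pos (m - 1) (by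
    have : 2 + 2 * (m - 1) < n := by omega
    exact_mod_cast this)
  have hac : c * a * sphArea n = 1 / gammaConst n := rieszConst_mul_navConst hn hm
  filter_upwards [hU] with y hy hyB
  have e1 : ENNReal.ofReal |u y| ≤ ENNReal.ofReal c * ∫⁻ x in Metric.ball (0 : E n) R,
      ENNReal.ofReal |W x| * ENNReal.ofReal ((‖y - x‖ ^ (2 * m))⁻¹) := by
    refine (ENNReal.ofReal_le_ofReal (hy hyB)).trans ?_
    rw [ENNReal.ofReal_mul hc0.le]
    gcongr
    refine (ofReal_integral_le_lintegral fun x => by positivity).trans (le_of_eq ?_)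
    exact lintegral_congr fun x => ENNReal.ofReal_mul (abs_nonneg _)
  have e2 : ∫⁻ x in Metric.ball (0 : E n) R, ENNReal.ofReal |W x| * ENNReal.ofReal ((‖y - x‖ ^ (2 * m))⁻¹) ≤
      ∫⁻ x in Metric.ball (0 : E n) R, ∫⁻ z in Metric.ball (0 : E n) R,
        ENNReal.ofReal a * (ENNReal.ofReal |f z| * (ENNReal.ofReal ((‖y - x‖ ^ (2 * m))⁻¹) * ENNReal.ofReal ‖x - z‖⁻¹)) := by
    refine lintegral_mono_ae ((ae_restrict_iff' measurableSet_ball).2 ?_)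
    filter_upwards [hW] with x hx hxB
    have h3 : ENNReal.ofReal |W x| ≤ ENNReal.ofReal a * ∫⁻ z in Metric.ball (0 : E n) R, ENNReal.ofReal |f z| * ENNReal.ofReal ‖x - z‖⁻¹ := by
      refine (ENNReal.ofReal_le_ofReal (hx hxB)).trans ?_
      rw [ENNReal.ofReal_mul ha0.le]
      gcongr
      refine (ofReal_integral_le_lintegral fun x => by positivity).trans (le_of_eq ?_)
      exact lintegral_congr fun x => ENNReal.ofReal_mul (abs_nonneg _)
    calc _ ≤ ENNReal.ofReal a * (∫⁻ z in Metric.ball (0 : E n) R, ENNReal.ofReal |f z| * ENNReal.ofReal ‖x - z‖⁻¹) * ENNReal.ofReal ((‖y - x‖ ^ (2 * m))⁻¹) := by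
          gcongr
      _ = _ := by
          rw [← lintegral_const_mul' _ _ ENNReal.ofReal_ne_top, ← lintegral_mul_const' _ _ ENNReal.ofReal_ne_top]
          exact lintegral_congr fun z => by ring
  refine e1.trans ((mul_le_mul_right e2 _).trans ?_)
  -- Integrating in x first exposes the composed kernel, to which `lintegral_kernel_le` applies for
  -- each z ≠ y.
  rw [lintegral_lintegral_swap]
  · rw [← lintegral_const_mul' _ _ ENNReal.ofReal_ne_top]
    refine lintegral_mono_ae ?_
    filter_upwards [ae_restrict_mem measurableSet_ball, ae_restrict_of_ae (Measure.ae_ne volume y)] with z hz hzy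
    have h4 := lintegral_kernel_le hn hm (by simpa using hyB) (by simpa using hz) hzy.symm
    have hd : 0 < ‖y - z‖ := norm_pos_iff.2 (sub_ne_zero.2 hzy.symm)
    rw [lintegral_const_mul' _ _ ENNReal.ofReal_ne_top, lintegral_const_mul' _ _ ENNReal.ofReal_ne_top]
    calc _ ≤ ENNReal.ofReal c * (ENNReal.ofReal a * (ENNReal.ofReal |f z| * ENNReal.ofReal (sphArea n * (Real.log (R / ‖y - z‖) + 6)))) := by gcongr
      _ = ENNReal.ofReal |f z| * (ENNReal.ofReal (c * a) * ENNReal.ofReal (sphArea n * (Real.log (R / ‖y - z‖) + 6))) := by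
          rw [ENNReal.ofReal_mul hc0.le]; ring
      _ = _ := by
          rw [← ENNReal.ofReal_mul (by positivity), ← mul_assoc (c * a), hac]
          congr 3
          rw [mul_div_right_comm, Real.log_mul (by positivity) (by positivity), Real.log_exp]
  · have hfm := hf.1.aemeasurable
    have : AEMeasurable (fun p : E n × E n => f p.2) ((volume.restrict (Metric.ball 0 R)).prod (volume.restrict (Metric.ball 0 R))) := hfm.comp_snd
    unfold Function.uncurry
    fun_prop

theorem lintegral_ball_rpow_lt_top {n : ℕ} [NeZero n] {s : ℝ} (hs : s < n) {D : ℝ} (hD : 0 < D) (ρ : ℝ) :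
    ∫⁻ w in Metric.ball (0 : E n) ρ, ENNReal.ofReal ((D / ‖w‖) ^ s) < ⊤ := by
  have h := (integrableOn_ball_norm_rpow (n := n) hs ρ).const_mul (D ^ s)
  refine lt_of_eq_of_lt ?_ h.lintegral_lt_top
  refine lintegral_congr fun w => ?_
  rw [Real.div_rpow hD.le (norm_nonneg _), Real.rpow_neg (norm_nonneg _), div_eq_mul_inv]

/-- Probability density on a ball dominating a given integrable function, up to normalisation. -/
theorem exists_dominating_density {n : ℕ} [NeZero n] {R M : ℝ} (hR : 0 < R) (hM : 0 < M) {f : E n → ℝ} (hf : IntegrableOn f (Metric.ball 0 R))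
    (hfM : ∫ x in Metric.ball 0 R, |f x| ≤ M) :
    ∃ κ : ℝ, 0 ≤ κ ∧ IsProbabilityMeasure ((volume.restrict (Metric.ball (0 : E n) R)).withDensity fun z => ENNReal.ofReal ((|f z| + κ) / M)) := by
  set V := (volume : Measure (E n)).real (Metric.ball 0 R) with hV
  have hV0 : 0 < V := ENNReal.toReal_pos (Metric.measure_ball_pos _ _ hR).ne' measure_ball_lt_top.ne
  -- κ spreads the missing mass M - ‖f‖₁ uniformly over the ball, so that the total is exactly M.
  refine ⟨(M - ∫ x in Metric.ball 0 R, |f x|) / V, div_nonneg (sub_nonneg.2 hfM) hV0.le, ⟨?_⟩⟩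
  set κ := (M - ∫ x in Metric.ball 0 R, |f x|) / V with hκ
  have hκ0 : 0 ≤ κ := div_nonneg (sub_nonneg.2 hfM) hV0.le
  have hc : IntegrableOn (fun _ : E n => κ) (Metric.ball 0 R) := integrableOn_const measure_ball_lt_top.ne
  have hi : IntegrableOn (fun z => (|f z| + κ) / M) (Metric.ball 0 R) := (hf.abs.add hc).div_const M
  rw [withDensity_apply _ MeasurableSet.univ, Measure.restrict_univ,
    ← ofReal_integral_eq_lintegral_ofReal hi (Eventually.of_forall fun z => by simp only [Pi.zero_apply]; positivity), integral_div,
    integral_add hf.abs hc, setIntegral_const, ← hV, smul_eq_mul, hκ]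
  rw [mul_div_cancel₀ _ hV0.ne', add_sub_cancel, div_self hM.ne', ENNReal.ofReal_one]

end FracBM

end

/-! ### The exponential bound. -/

theorem mainTheorem4 (n : ℕ) [NeZero n] (hn : Odd n) (hn3 : 3 ≤ n)
    (R : ℝ) (hR : 0 < R) (p : ℝ) (hp : 0 < p) (M : ℝ) (hM : p * M < FracBM.gammaConst n) :
    ∃ C : ℝ, ∀ f u : FracBM.E n → ℝ,
      IntegrableOn f (Metric.ball 0 R) →
      ∫ x in Metric.ball 0 R, |f x| ≤ M →
      IntegrableOn u (Metric.ball 0 R) →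
      FracBM.IsSolution (Metric.ball 0 R) f u →
      (∀ᵐ x : FracBM.E n, x ∉ Metric.ball 0 R → u x = 0) →
      IntegrableOn (fun x => Real.exp (n * p * |u x|)) (Metric.ball 0 R) ∧
        ∫ x in Metric.ball 0 R, Real.exp (n * p * |u x|) ≤ C := by
  obtain ⟨m, hm⟩ := hn
  have hm0 : m ≠ 0 := by omega
  set γ := FracBM.gammaConst n with hγ
  have hγ0 : 0 < γ := FracBM.gammaConst_pos hm
  have hn0 : (0 : ℝ) < n := by positivity
  -- M may be zero or negative; the maximum is positive and still satisfies p M' < γ.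
  set M' := max M (γ / (2 * p)) with hM'
  have hM'0 : 0 < M' := lt_max_of_lt_right (by positivity)
  have hpM : p * M' < γ := by
    rw [hM', mul_max_of_nonneg _ _ hp.le]
    refine max_lt hM ?_
    have : p * (γ / (2 * p)) = γ / 2 := by field_simp
    linarith
  set s := n * p * M' / γ with hs
  have hs0 : 0 < s := by positivity
  have hsn : s < n := by
    rw [hs, div_lt_iff₀ hγ0, mul_assoc]
    gcongr
  set D := R * Real.exp 6 with hD
  have hD0 : 0 < D := by positivity
  have hDR : 2 * R ≤ D := by
    have := Real.add_one_le_exp 6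
    nlinarith
  have hfin := FracBM.lintegral_ball_rpow_lt_top hsn hD0 (2 * R)
  -- The constant is the integral of (D/|w|)^s over the ball of radius 2R, finite because s < n. It
  -- involves only n, p, R and M.
  refine ⟨(∫⁻ w in Metric.ball (0 : FracBM.E n) (2 * R), ENNReal.ofReal ((D / ‖w‖) ^ s)).toReal, fun f u hf hfM hu hsol hu0 => ?_⟩
  have hlog := hsol.ae_le_log_potential hm hm0 hR hf hu hu0
  obtain ⟨κ, hκ, hprob⟩ := FracBM.exists_dominating_density hR hM'0 hf (hfM.trans (le_max_left _ _))
  have hfm := hf.1.aemeasurable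
  have hlm : ∀ y : FracBM.E n, AEMeasurable (fun z => ENNReal.ofReal (s * Real.log (D / ‖y - z‖))) (volume.restrict (Metric.ball 0 R)) := fun y =>
    ((Real.measurable_log.comp (by fun_prop : Measurable fun z => D / ‖y - z‖)).const_mul s).ennreal_ofReal.aemeasurable
  have hmain := FracBM.lintegral_exp_le (v := fun y => n * p * |u y|)
    (μ := (volume.restrict (Metric.ball (0 : FracBM.E n) R)).withDensity fun z => ENNReal.ofReal ((|f z| + κ) / M')) hs0 hDR hR
    ((withDensity_absolutelyContinuous _ _).trans Measure.restrict_le_self.absolutelyContinuous)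
    ((withDensity_absolutelyContinuous _ _).ae_le ((ae_restrict_mem measurableSet_ball).mono fun z hz => mem_ball_zero_iff.1 hz)) (by
      filter_upwards [hlog] with y hy hyB
      rw [abs_of_nonneg (by positivity), ENNReal.ofReal_mul (by positivity),
        lintegral_withDensity_eq_lintegral_mul₀ (by fun_prop) (hlm y)]
      refine (mul_le_mul_right (hy hyB) _).trans ?_
      rw [← lintegral_const_mul' _ _ ENNReal.ofReal_ne_top]
      refine lintegral_mono fun z => ?_
      simp only [Pi.mul_apply]
      -- The choice s = npM'/γ makes np/γ = s/M', so the factor np/γ is split between the density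
      -- |f|/M' and the exponent s.
      calc ENNReal.ofReal (n * p) * (ENNReal.ofReal |f z| * ENNReal.ofReal (1 / γ * Real.log (D / ‖y - z‖)))
          = ENNReal.ofReal (|f z| / M') * ENNReal.ofReal (s * Real.log (D / ‖y - z‖)) := by
            rw [← ENNReal.ofReal_mul (by positivity), ← ENNReal.ofReal_mul (by positivity), ← ENNReal.ofReal_mul (by positivity), hs]
            congr 1
            field_simp
        _ ≤ _ := by
            gcongr
            linarith)
  have habs : ∀ y, abs ((n : ℝ) * p * |u y|) = n * p * |u y| := fun y => abs_of_nonneg (by positivity)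
  simp only [habs] at hmain
  have hum := hu.1
  have hmeas : AEStronglyMeasurable (fun x => Real.exp (n * p * |u x|)) (volume.restrict (Metric.ball (0 : FracBM.E n) R)) := by
    have := hum.aemeasurable
    exact AEMeasurable.aestronglyMeasurable (by fun_prop)
  refine ⟨⟨hmeas, ?_⟩, ?_⟩
  · rw [hasFiniteIntegral_iff_ofReal (Filter.Eventually.of_forall fun x => (Real.exp_pos _).le)]
    exact hmain.trans_lt hfin
  · rw [integral_eq_lintegral_of_nonneg_ae (Filter.Eventually.of_forall fun x => (Real.exp_pos _).le) hmeas]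
    exact ENNReal.toReal_mono hfin.ne hmain
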